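/- Let $m,\ell\in\mathbb N$ with $m\ge 5$, $1\le \ell\le m$ and $$m>2\left(\sqrt{12\ell^2+30\ell+12}+3\ell+6\right),$$ and let $\alpha\in(0,\tfrac{\pi}{2})$ satisfy $$\sin^2\alpha=\frac{\ell(\ell+m-2)+2m-8}{2\ell(\ell+m-2)}.$$ Let $B^m\subset\mathbb R^m$ be the unit ball, $r=|x|$, $y_i=x_i/r$, and let $u^{(\ell)}=(u^{(\ell)}_{i_1\dots i_\ell})_{1\le i_1,\dots,i_\ell\le m}$ be Nakauchi's generalized radial projection, defined on $\mathbb R^m\setminus\{0\}$ by $u^{(1)}_{i_1}=y_{i_1}$ and, for $\ell\ge 2$, $$u^{(\ell)}_{i_1\dots i_\ell}=\sqrt{\tfrac{\ell+m-3}{2\ell+m-4}}\Big(y_{i_\ell}\,u^{(\ell-1)}_{i_1\dots i_{\ell-1}}-\tfrac{1}{\ell+m-3}\,r\,\tfrac{\partial}{\partial x_{i_\ell}}u^{(\ell-1)}_{i_1\dots i_{\ell-1}}\Big).$$ Then the map $q=(\sin\alpha\cdot u^{(\ell)},\cos\alpha)\colon B^m\to\mathbb S^{m^\ell}\subset\mathbb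 R^{m^\ell}\times\mathbb R$ is a proper weak biharmonic map and is strictly stable. Here, with weak derivatives, $W^{2,2}(B^m,\mathbb S^n)$ is the set of $u\in W^{2,2}(B^m,\mathbb R^{n+1})$ with $|u|=1$ a.e. A map $u\in W^{2,2}(B^m,\mathbb S^n)$ is weak biharmonic if $$\Delta^2u+2\operatorname{div}(|\nabla u|^2\nabla u)-\big(\langle\Delta^2u,u\rangle-2|\nabla u|^4\big)u=0$$ in the sense of distributions, where $\langle\Delta^2u,u\rangle u$ acts on a test field $\varphi$ by $\int_{B^m}\langle\Delta u,\Delta(\langle u,\varphi\rangle u)\rangle\,dx$. It is proper if it is not harmonic, i.e. if $\Delta u+|\nabla u|^2u=0$ a.e. fails. With the bienergy $$E_2(u)=\frac12\int_{B^m}\big(|\Delta u|^2-|\nabla u|^4\big)\,dx,$$ $u$ is strictly stable if for every variation $(u_t)_{|t|<\varepsilon}$ of $u=u_0$ with $u_t\in W^{2,2}(B^m,\mathbb S^n)$ and $u_t-u\in W^{2,2}_0(B^m,\mathbb R^{n+1})$, such that $t\mapsto u_t\in W^{2,2}\cap W^{1,4}$ is differentiable near $t=0$ and twice differentiable at $t=0$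 with variational field $\frac{d}{dt}u_t|_{t=0}$ not a.e. zero, the function $t\mapsto E_2(u_t)$ is twice differentiable at $t=0$ and $$\frac{d^2}{dt^2}E_2(u_t)\Big|_{t=0}>0.$$ -/

import Mathlib

open MeasureTheory Filter Topology
open scoped ContDiff

namespace Biharmonic

/-- Euclidean space `ℝ^m`. -/
abbrev Euc (m : ℕ) : Type := EuclideanSpace ℝ (Fin m)

/-- The open unit ball `B^m`. -/
abbrev unitBall (m : ℕ) : Set (Euc m) := Metric.ball 0 1

/-- Lebesgue measure on `B^m`. -/
noncomputable abbrev ballMeasure (m : ℕ) : Measure (Euc m) := volume.restrict (unitBall m)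

/-- The classical partial derivative `∂f/∂x_i`. -/
noncomputable def partialDeriv {m : ℕ} {F : Type*} [NormedAddCommGroup F] [NormedSpace ℝ F]
    (i : Fin m) (f : Euc m → F) (x : Euc m) : F :=
  fderiv ℝ f x (EuclideanSpace.single i 1)

/-- The classical Laplacian `∑ ∂²f/∂x_i²`. -/
noncomputable def laplacian {m : ℕ} {F : Type*} [NormedAddCommGroup F] [NormedSpace ℝ F]
    (f : Euc m → F) (x : Euc m) : F :=
  ∑ i, partialDeriv i (partialDeriv i f) x

section Sobolev

variable {m : ℕ} {F : Type*} [NormedAddCommGroup F] [InnerProductSpace ℝ F]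

/-- `φ ∈ C_c^∞(B^m, F)`. -/
structure IsTest (φ : Euc m → F) : Prop where
  smooth : ContDiff ℝ ∞ φ
  compact : HasCompactSupport φ
  support_subset : tsupport φ ⊆ unitBall m

/-- `g` is the weak (distributional) partial derivative `∂_i f` on `B^m`. -/
structure HasWeakPartial (i : Fin m) (f g : Euc m → F) : Prop where
  locInt : LocallyIntegrableOn f (unitBall m)
  locInt_deriv : LocallyIntegrableOn g (unitBall m)
  integral_eq : ∀ φ : Euc m → ℝ, IsTest φ →
    ∫ x in unitBall m, partialDeriv i φ x • f x = -∫ x in unitBall m, φ x • g x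

open Classical in
/-- The weak partial derivative `∂_i f` on `B^m` (unique up to null sets of `B^m`; the zero
function if there is none). -/
noncomputable def weakPartial (i : Fin m) (f : Euc m → F) : Euc m → F :=
  if h : ∃ g, HasWeakPartial i f g then h.choose else 0

/-- The weak Laplacian `Δf = ∑ ∂_i ∂_i f`. -/
noncomputable def weakLaplacian (f : Euc m → F) (x : Euc m) : F :=
  ∑ i, weakPartial i (weakPartial i f) x

/-- `|∇f|² = ∑ |∂_i f|²`. -/
noncomputable def gradNormSq (f : Euc m → F) (x : Euc m) : ℝ :=
  ∑ i, ‖weakPartial i f x‖ ^ 2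

/-- The Sobolev space `W^{2,2}(B^m, F)`. -/
structure MemW22 (f : Euc m → F) : Prop where
  memLp : MemLp f 2 (ballMeasure m)
  exists_partial : ∀ i, ∃ g, HasWeakPartial i f g
  memLp_partial : ∀ i, MemLp (weakPartial i f) 2 (ballMeasure m)
  exists_partial₂ : ∀ i j, ∃ g, HasWeakPartial j (weakPartial i f) g
  memLp_partial₂ : ∀ i j, MemLp (weakPartial j (weakPartial i f)) 2 (ballMeasure m)

/-- The `W^{2,2}(B^m)` norm (of elements of `W^{2,2}`). -/
noncomputable def normW22 (f : Euc m → F) : ENNReal :=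
  eLpNorm f 2 (ballMeasure m) + ∑ i, eLpNorm (weakPartial i f) 2 (ballMeasure m)
    + ∑ i, ∑ j, eLpNorm (weakPartial j (weakPartial i f)) 2 (ballMeasure m)

/-- `W_0^{2,2}(B^m, F)`: the closure of `C_c^∞(B^m, F)` in `W^{2,2}(B^m, F)`. -/
structure MemW22Zero (f : Euc m → F) : Prop where
  memW22 : MemW22 f
  approx : ∃ φ : ℕ → Euc m → F, (∀ n, IsTest (φ n)) ∧
    Tendsto (fun n => normW22 (fun x => f x - φ n x)) atTop (𝓝 0)

/-- `W^{2,2}(B^m, S)` for the unit sphere `S` of `F`. -/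
structure MemW22Sphere (u : Euc m → F) : Prop where
  memW22 : MemW22 u
  norm_eq_one : ∀ᵐ x ∂(ballMeasure m), ‖u x‖ = 1

/-- The space `W^{2,2} ∩ W^{1,4}`, on which the bienergy is finite and smooth. It contains
`W^{2,2}(B^m, S)`, because `|∇u|² = -⟨u, Δu⟩ ∈ L²` for sphere-valued `u`. -/
structure MemEnergySpace (f : Euc m → F) : Prop where
  memW22 : MemW22 f
  memLp_four : ∀ i, MemLp (weakPartial i f) 4 (ballMeasure m)

/-- The norm of `W^{2,2} ∩ W^{1,4}`. -/
noncomputable def normEnergySpace (f : Euc m → F) : ENNReal :=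
  normW22 f + ∑ i, eLpNorm (weakPartial i f) 4 (ballMeasure m)

/-- The bienergy of a sphere-valued map, `E₂(u) = ½ ∫ (|Δu|² - |∇u|⁴)`. It equals `½ ∫ |τ(u)|²`
with the tension field `τ(u) = Δu + |∇u|² u`. -/
noncomputable def bienergy (u : Euc m → F) : ℝ :=
  1 / 2 * ∫ x in unitBall m, (‖weakLaplacian u x‖ ^ 2 - gradNormSq u x ^ 2)

/-- `u ∈ W^{2,2}(B^m, S)` is harmonic: its tension field `Δu + |∇u|² u` vanishes. -/
structure IsHarmonic (u : Euc m → F) : Prop where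
  memW22Sphere : MemW22Sphere u
  tension_eq_zero : ∀ᵐ x ∂(ballMeasure m), weakLaplacian u x + gradNormSq u x • u x = 0

/-- `u ∈ W^{2,2}(B^m, S)` solves
`Δ²u + 2 div(|∇u|² ∇u) - (⟨Δ²u, u⟩ - 2|∇u|⁴) u = 0` in the sense of distributions.
The term `⟨Δ²u, u⟩ u` acts on a test field `φ` as `Δ²u` acts on `⟨u, φ⟩ u`. -/
structure IsWeakBiharmonic (u : Euc m → F) : Prop where
  memW22Sphere : MemW22Sphere u
  equation : ∀ φ : Euc m → F, IsTest φ →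
    (∫ x in unitBall m, inner ℝ (weakLaplacian u x) (laplacian φ x))
      - 2 * (∫ x in unitBall m,
          gradNormSq u x * ∑ i, inner ℝ (weakPartial i u x) (partialDeriv i φ x))
      - (∫ x in unitBall m,
          inner ℝ (weakLaplacian u x) (weakLaplacian (fun y => (inner ℝ (u y) (φ y) : ℝ) • u y) x))
      + 2 * (∫ x in unitBall m, gradNormSq u x ^ 2 * inner ℝ (u x) (φ x)) = 0

/-- A proper weak biharmonic map is a weak biharmonic map that is not harmonic. -/
structure IsProperWeakBiharmonic (u : Euc m → F) : Prop where
  weakBiharmonic : IsWeakBiharmonic u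
  not_harmonic : ¬ IsHarmonic u

/-- The curve `s ↦ U s` in `W^{2,2} ∩ W^{1,4}` has the derivative `V` at `s = t`. -/
structure HasEnergySpaceDerivAt (U : ℝ → Euc m → F) (V : Euc m → F) (t : ℝ) : Prop where
  eventually_mem : ∀ᶠ s in 𝓝 t, MemEnergySpace (U s)
  mem_deriv : MemEnergySpace V
  tendsto : Tendsto
    (fun s => normEnergySpace (fun x => (s - t)⁻¹ • (U s x - U t x) - V x)) (𝓝[≠] t) (𝓝 0)

/-- `t ↦ U t` (for small `|t|`) is a variation of `u` through sphere-valued `W^{2,2}` maps with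
`U t - u ∈ W_0^{2,2}`, twice differentiable at `t = 0`; `V t` is the derivative of `U` at `t`,
so that `V 0` is the variational vector field. -/
structure IsVariation (u : Euc m → F) (U V : ℝ → Euc m → F) : Prop where
  zero : U 0 = u
  sphere : ∀ᶠ t in 𝓝 (0 : ℝ), MemW22Sphere (U t)
  boundary : ∀ᶠ t in 𝓝 (0 : ℝ), MemW22Zero (fun x => U t x - u x)
  deriv : ∀ᶠ t in 𝓝 (0 : ℝ), HasEnergySpaceDerivAt U (V t) t
  deriv₂ : ∃ W : Euc m → F, HasEnergySpaceDerivAt V W 0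

/-- `u` is strictly stable: for every variation `u_t` of `u` with non-zero variational vector
field, `E₂(u_t)` is twice differentiable at `t = 0` with positive second derivative. -/
def IsStrictlyStable (u : Euc m → F) : Prop :=
  ∀ U V : ℝ → Euc m → F, IsVariation u U V → ¬ (V 0 =ᵐ[ballMeasure m] 0) →
    (∀ᶠ t in 𝓝 (0 : ℝ), DifferentiableAt ℝ (fun s => bienergy (U s)) t) ∧
    DifferentiableAt ℝ (deriv (fun s => bienergy (U s))) 0 ∧
    0 < deriv (deriv (fun s => bienergy (U s))) 0

end Sobolev

/-- The components `u^{(ℓ)}_{i_1 … i_ℓ}(x)` of Nakauchi's generalized radial projection, with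
`y_i = x_i / r`, `r = ‖x‖`. The recursion starts at `ℓ = 1`; the value at `ℓ = 0` is not used.
The case `k + 2` is `ℓ = k + 2`, written with `L = ℓ`. -/
noncomputable def nakauchi (m : ℕ) : (ℓ : ℕ) → (Fin ℓ → Fin m) → Euc m → ℝ
  | 0, _, _ => 1
  | 1, I, x => x (I 0) / ‖x‖
  | k + 2, I, x =>
      let L : ℝ := (k : ℝ) + 2
      Real.sqrt ((L + m - 3) / (2 * L + m - 4)) *
        (x (I (Fin.last (k + 1))) / ‖x‖ * nakauchi m (k + 1) (Fin.init I) x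
          - 1 / (L + m - 3) * ‖x‖ *
            partialDeriv (I (Fin.last (k + 1))) (nakauchi m (k + 1) (Fin.init I)) x)

/-- The ambient space `ℝ^{m^ℓ} × ℝ` of the sphere `S^{m^ℓ}`. -/
abbrev Target (m ℓ : ℕ) : Type := EuclideanSpace ℝ ((Fin ℓ → Fin m) ⊕ Unit)

/-- The map `q = (sin α · u^{(ℓ)}, cos α)`. -/
noncomputable def qMap (m ℓ : ℕ) (α : ℝ) (x : Euc m) : Target m ℓ :=
  WithLp.toLp 2 (Sum.elim (fun I => Real.sin α * nakauchi m ℓ I x) (fun _ => Real.cos α))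

end Biharmonic

/-!
Write `r = |x|`, `s = sin α`, `λ = ℓ(ℓ + m - 2)`, and `e = (0, cos α)`.

*The map.* Nakauchi's recursion turns an eigenmap of the sphere `S^{m-1}` of degree `k` (a map into
a unit sphere whose components are spherical harmonics of degree `k`) into one of degree `k + 1`
(`IsEigenmap.step`); starting from the constant `1`, this shows that `u^{(ℓ)}` is an eigenmap, so
`Δu^{(ℓ)} = -λ r⁻² u^{(ℓ)}` and `|∇u^{(ℓ)}|² = λ r⁻²`. Hence `q - e = s u^{(ℓ)}` satisfies
`Δq = -λ r⁻² (q - e)`, and `|∇q|² = κ r⁻²` with `κ = s² λ`. The condition on `α` reads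
`2 κ = λ + 2m - 8`, and it is equivalent to `Δ²q + 2 div(|∇q|² ∇q) = 0` away from the origin.
Thus `q` is a critical point of the bienergy, not only among maps into the sphere but
among all maps: the first variation vanishes in every direction (`IsProfile.firstVariation`).
Testing with `φ` and with `⟨q, φ⟩ q` gives the weak equation. The tension field of `q` has the
component `κ r⁻² cos² α ≠ 0` along `e`, so `q` is not harmonic.

*Stability.* Since the first variation vanishes also on the acceleration of a variation, the second
derivative of the bienergy depends on the variational field `V` alone:
`∫ |ΔV|² - 4 ∫ ⟨∇q, ∇V⟩² - 2 ∫ |∇q|² |∇V|²` (`bienergy_secondVariation`). By Cauchy–Schwarz it is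
at least `∫ |ΔV|² - 6 κ ∫ r⁻² |∇V|²`. The Hardy–Rellich inequality
`(m² / 4) ∫ r⁻² |∇V|² ≤ ∫ |ΔV|²` on `W_0^{2,2}` (`MemW22Zero.hardyRellich`) follows by integrating
`|ΔV - (m / 2) r⁻² (x · ∇) V|² ≥ 0` and a Rellich–Pohozaev identity for the mixed term. The
hypothesis on `m` and `ℓ` is equivalent, given `m > 6ℓ + 12`, to `m² / 4 > 3 (λ + 2m - 8) = 6 κ`,
and `∫ r⁻² |∇V|²` is positive by the Poincaré inequality.

*The singularity.* All maps in question are smooth away from the origin, where they and their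
derivatives blow up at a controlled rate (`HasPole`). In dimension `m` a pole of order `k < m - 1`
is invisible to integration by parts (`HasPole.integral_partialDeriv_eq_zero`), by cutting off near
the origin, so that classical derivatives are weak derivatives. In the Hardy–Rellich inequality the
weight `r⁻²` is replaced by `(r² + ε)⁻¹`, and `ε` tends to `0` at the end.
-/

namespace Biharmonic

/-! ### Partial derivatives -/

section PartialDerivatives

variable {m : ℕ} {F : Type*} [NormedAddCommGroup F] [InnerProductSpace ℝ F]
  {G : Type*} [NormedAddCommGroup G] [NormedSpace ℝ G]

theorem partialDeriv_congr {i : Fin m} {f g : Euc m → G} {x : Euc m} (h : f =ᶠ[𝓝 x] g) :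
    partialDeriv i f x = partialDeriv i g x := by
  simp only [partialDeriv, h.fderiv_eq]

theorem partialDeriv_eventuallyEq {i : Fin m} {f g : Euc m → G} {x : Euc m} (h : f =ᶠ[𝓝 x] g) :
    partialDeriv i f =ᶠ[𝓝 x] partialDeriv i g := by
  filter_upwards [h.eventuallyEq_nhds] with y hy using partialDeriv_congr hy

theorem laplacian_congr {f g : Euc m → G} {x : Euc m} (h : f =ᶠ[𝓝 x] g) :
    laplacian f x = laplacian g x := by
  simp only [laplacian]
  exact Finset.sum_congr rfl fun i _ => partialDeriv_congr (partialDeriv_eventuallyEq h)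

theorem partialDeriv_add {i : Fin m} {f g : Euc m → G} {x : Euc m}
    (hf : DifferentiableAt ℝ f x) (hg : DifferentiableAt ℝ g x) :
    partialDeriv i (fun y => f y + g y) x = partialDeriv i f x + partialDeriv i g x := by
  simp only [partialDeriv]
  rw [fderiv_fun_add hf hg]
  rfl

theorem partialDeriv_sub {i : Fin m} {f g : Euc m → G} {x : Euc m}
    (hf : DifferentiableAt ℝ f x) (hg : DifferentiableAt ℝ g x) :
    partialDeriv i (fun y => f y - g y) x = partialDeriv i f x - partialDeriv i g x := by
  simp only [partialDeriv]
  rw [fderiv_fun_sub hf hg]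
  rfl

theorem partialDeriv_sum {ι : Type*} {s : Finset ι} {i : Fin m} {f : ι → Euc m → G} {x : Euc m}
    (hf : ∀ j ∈ s, DifferentiableAt ℝ (f j) x) :
    partialDeriv i (fun y => ∑ j ∈ s, f j y) x = ∑ j ∈ s, partialDeriv i (f j) x := by
  simp only [partialDeriv]
  rw [fderiv_fun_sum hf]
  simp

theorem partialDeriv_const (i : Fin m) (c : G) (x : Euc m) :
    partialDeriv i (fun _ => c) x = 0 := by
  simp [partialDeriv]

theorem partialDeriv_smul {i : Fin m} {a : Euc m → ℝ} {f : Euc m → G} {x : Euc m}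
    (ha : DifferentiableAt ℝ a x) (hf : DifferentiableAt ℝ f x) :
    partialDeriv i (fun y => a y • f y) x = a x • partialDeriv i f x + partialDeriv i a x • f x := by
  simp only [partialDeriv]
  rw [fderiv_fun_smul ha hf]
  simp

theorem partialDeriv_mul {i : Fin m} {a f : Euc m → ℝ} {x : Euc m}
    (ha : DifferentiableAt ℝ a x) (hf : DifferentiableAt ℝ f x) :
    partialDeriv i (fun y => a y * f y) x = a x * partialDeriv i f x + partialDeriv i a x * f x :=
  partialDeriv_smul ha hf

theorem partialDeriv_const_smul {i : Fin m} (c : ℝ) {f : Euc m → G} {x : Euc m}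
    (hf : DifferentiableAt ℝ f x) :
    partialDeriv i (fun y => c • f y) x = c • partialDeriv i f x := by
  simp only [partialDeriv]
  rw [fderiv_fun_const_smul hf]
  simp

theorem partialDeriv_inner {i : Fin m} {f g : Euc m → F} {x : Euc m}
    (hf : DifferentiableAt ℝ f x) (hg : DifferentiableAt ℝ g x) :
    partialDeriv i (fun y => inner ℝ (f y) (g y)) x
      = inner ℝ (f x) (partialDeriv i g x) + inner ℝ (partialDeriv i f x) (g x) := by
  simp only [partialDeriv]
  rw [fderiv_inner_apply ℝ hf hg]

theorem partialDeriv_coord (i j : Fin m) (x : Euc m) :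
    partialDeriv i (fun y : Euc m => y j) x = if j = i then 1 else 0 := by
  have h : HasFDerivAt (fun y : Euc m => y j) (EuclideanSpace.proj (𝕜 := ℝ) j) x :=
    (EuclideanSpace.proj (𝕜 := ℝ) j).hasFDerivAt
  simp [partialDeriv, h.fderiv]

theorem contDiff_coord (j : Fin m) : ContDiff ℝ ∞ (fun y : Euc m => y j) :=
  (EuclideanSpace.proj (𝕜 := ℝ) j).contDiff

theorem partialDeriv_norm_sq (i : Fin m) (x : Euc m) :
    partialDeriv i (fun y : Euc m => ‖y‖ ^ 2) x = 2 * x i := by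
  have h : HasFDerivAt (fun y : Euc m => ‖y‖ ^ 2) (2 • (innerSL ℝ x)) x :=
    (hasStrictFDerivAt_norm_sq x).hasFDerivAt
  simp [partialDeriv, h.fderiv, EuclideanSpace.inner_single_right]

/-- Euler's operator `x · ∇ f`, as a derivative in the direction of the base point. -/
theorem sum_coord_smul_partialDeriv (f : Euc m → G) (x : Euc m) :
    ∑ i, x i • partialDeriv i f x = fderiv ℝ f x x := by
  have hx : ∑ i, x i • (EuclideanSpace.single i (1 : ℝ) : Euc m) = x := by
    simpa using (EuclideanSpace.basisFun (Fin m) ℝ).sum_repr x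
  have h : fderiv ℝ f x (∑ i, x i • (EuclideanSpace.single i (1 : ℝ) : Euc m))
      = ∑ i, x i • partialDeriv i f x := by
    rw [map_sum]
    simp only [map_smul, partialDeriv]
  rw [← h, hx]

theorem sum_coord_sq (x : Euc m) : ∑ i, x i ^ 2 = ‖x‖ ^ 2 :=
  (EuclideanSpace.real_norm_sq_eq x).symm

theorem contDiff_partialDeriv {i : Fin m} {f : Euc m → G} (hf : ContDiff ℝ ∞ f) :
    ContDiff ℝ ∞ (partialDeriv i f) :=
  (hf.fderiv_right (m := ∞) (by simp)).clm_apply contDiff_const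

theorem contDiffOn_partialDeriv {s : Set (Euc m)} (hs : IsOpen s) {i : Fin m} {f : Euc m → G}
    (hf : ContDiffOn ℝ ∞ f s) : ContDiffOn ℝ ∞ (partialDeriv i f) s :=
  (hf.fderiv_of_isOpen (m := ∞) hs (by simp)).clm_apply contDiffOn_const

theorem partialDeriv_comm {i j : Fin m} {f : Euc m → G} {x : Euc m} (hf : ContDiffAt ℝ 2 f x) :
    partialDeriv i (partialDeriv j f) x = partialDeriv j (partialDeriv i f) x := by
  have hs : IsSymmSndFDerivAt ℝ f x := hf.isSymmSndFDerivAt (by simp)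
  have hd : DifferentiableAt ℝ (fderiv ℝ f) x :=
    (hf.fderiv_right (m := 1) (by norm_num)).differentiableAt (by norm_num)
  have key : ∀ v w : Euc m, fderiv ℝ (fun y => fderiv ℝ f y v) x w = fderiv ℝ (fderiv ℝ f) x w v := by
    intro v w
    rw [fderiv_clm_apply hd (differentiableAt_const v)]
    simp
  have h1 : partialDeriv i (partialDeriv j f) x = _ := key _ _
  have h2 : partialDeriv j (partialDeriv i f) x = _ := key _ _
  rw [h1, h2]
  exact hs _ _

theorem IsTest.deriv {i : Fin m} {φ : Euc m → F} (hφ : IsTest φ) :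
    IsTest (partialDeriv i φ) where
  smooth := contDiff_partialDeriv hφ.smooth
  compact := hφ.compact.fderiv_apply ℝ _
  support_subset := (tsupport_fderiv_apply_subset ℝ _).trans hφ.support_subset

end PartialDerivatives

/-! ### Functions with a pole at the origin -/

section Poles

variable {m : ℕ} {F : Type*} [NormedAddCommGroup F] [InnerProductSpace ℝ F]
  {G : Type*} [NormedAddCommGroup G] [NormedSpace ℝ G]

/-- `f` is smooth on `ℝ^m \ {0}` and, on the unit ball, it is `O(|x|^{-k})`. -/
structure PoleBound (k : ℕ) (f : Euc m → G) : Prop where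
  contDiffOn : ContDiffOn ℝ ∞ f {0}ᶜ
  bound : ∃ C, ∀ x, x ≠ 0 → ‖x‖ < 1 → ‖x‖ ^ k * ‖f x‖ ≤ C

/-- `f` is smooth on `ℝ^m \ {0}` and, on the unit ball, its partial derivatives of order `j ≤ n`
are `O(|x|^{-(k + j)})`. -/
def HasPole : ℕ → ℕ → (Euc m → G) → Prop
  | 0, k, f => PoleBound k f
  | n + 1, k, f => PoleBound k f ∧ ∀ i, HasPole n (k + 1) (partialDeriv i f)

theorem isOpen_compl_zero : IsOpen ({0}ᶜ : Set (Euc m)) := isOpen_compl_singleton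

theorem HasPole.zero {n k : ℕ} {f : Euc m → G} (h : HasPole n k f) : HasPole 0 k f := by
  cases n with
  | zero => exact h
  | succ n => exact h.1

theorem HasPole.pred {n k : ℕ} {f : Euc m → G} (h : HasPole (n + 1) k f) : HasPole n k f := by
  induction n generalizing k f with
  | zero => exact h.1
  | succ n ih => exact ⟨h.1, fun i => ih (h.2 i)⟩

theorem HasPole.contDiffOn {n k : ℕ} {f : Euc m → G} (h : HasPole n k f) :
    ContDiffOn ℝ ∞ f {0}ᶜ := h.zero.1

theorem HasPole.contDiffAt {n k : ℕ} {f : Euc m → G} (h : HasPole n k f) {x : Euc m}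
    (hx : x ≠ 0) : ContDiffAt ℝ ∞ f x :=
  h.contDiffOn.contDiffAt (isOpen_compl_zero.mem_nhds hx)

theorem HasPole.differentiableAt {n k : ℕ} {f : Euc m → G} (h : HasPole n k f) {x : Euc m}
    (hx : x ≠ 0) : DifferentiableAt ℝ f x :=
  (h.contDiffAt hx).differentiableAt (by simp)

theorem HasPole.differentiableAt_partialDeriv {n k : ℕ} {f : Euc m → G} (h : HasPole n k f)
    (i : Fin m) {x : Euc m} (hx : x ≠ 0) : DifferentiableAt ℝ (partialDeriv i f) x :=
  ((contDiffOn_partialDeriv isOpen_compl_zero h.contDiffOn).contDiffAt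
    (isOpen_compl_zero.mem_nhds hx)).differentiableAt (by simp)

theorem eqOn_partialDeriv {i : Fin m} {f g : Euc m → G} (h : Set.EqOn f g {0}ᶜ) :
    Set.EqOn (partialDeriv i f) (partialDeriv i g) {0}ᶜ := fun _ hx =>
  partialDeriv_congr (h.eventuallyEq_of_mem (isOpen_compl_zero.mem_nhds hx))

theorem HasPole.congr {n k : ℕ} {f g : Euc m → G} (h : HasPole n k f)
    (hfg : Set.EqOn f g {0}ᶜ) : HasPole n k g := by
  induction n generalizing k f g with
  | zero =>
    refine ⟨h.1.congr hfg.symm, ?_⟩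
    obtain ⟨C, hC⟩ := h.2
    exact ⟨C, fun x hx hx1 => by rw [← hfg hx]; exact hC x hx hx1⟩
  | succ n ih => exact ⟨(ih h.pred hfg).zero, fun i => ih (h.2 i) (eqOn_partialDeriv hfg)⟩

theorem HasPole.succ_order {n k : ℕ} {f : Euc m → G} (h : HasPole n k f) :
    HasPole n (k + 1) f := by
  have base : ∀ {k} {f : Euc m → G}, HasPole 0 k f → HasPole 0 (k + 1) f := by
    rintro k f ⟨h, C, hC⟩
    refine ⟨h, C, fun x hx hx1 => le_trans ?_ (hC x hx hx1)⟩
    gcongr ?_ * _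
    exact pow_le_pow_of_le_one (norm_nonneg x) hx1.le k.le_succ
  induction n generalizing k f with
  | zero => exact base h
  | succ n ih => exact ⟨base h.1, fun i => ih (h.2 i)⟩

theorem HasPole.add {n k : ℕ} {f g : Euc m → G} (hf : HasPole n k f) (hg : HasPole n k g) :
    HasPole n k (fun x => f x + g x) := by
  induction n generalizing k f g with
  | zero =>
    obtain ⟨hf, C, hC⟩ := hf
    obtain ⟨hg, D, hD⟩ := hg
    refine ⟨hf.add hg, C + D, fun x hx hx1 => ?_⟩
    calc ‖x‖ ^ k * ‖f x + g x‖ ≤ ‖x‖ ^ k * (‖f x‖ + ‖g x‖) := by gcongr; exact norm_add_le _ _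
      _ ≤ C + D := by linarith [hC x hx hx1, hD x hx hx1]
  | succ n ih =>
    exact ⟨(ih hf.pred hg.pred).zero, fun i => (ih (hf.2 i) (hg.2 i)).congr fun x hx =>
      (partialDeriv_add (hf.differentiableAt hx) (hg.differentiableAt hx)).symm⟩

theorem HasPole.smul {n k l : ℕ} {a : Euc m → ℝ} {f : Euc m → G} (ha : HasPole n k a)
    (hf : HasPole n l f) : HasPole n (k + l) (fun x => a x • f x) := by
  have base : ∀ {k l} {a : Euc m → ℝ} {f : Euc m → G}, HasPole 0 k a → HasPole 0 l f →
      HasPole 0 (k + l) (fun x => a x • f x) := by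
    rintro k l a f ⟨ha, C, hC⟩ ⟨hf, D, hD⟩
    refine ⟨ha.smul hf, C * D, fun x hx hx1 => ?_⟩
    calc ‖x‖ ^ (k + l) * ‖a x • f x‖ = (‖x‖ ^ k * ‖a x‖) * (‖x‖ ^ l * ‖f x‖) := by
          rw [norm_smul]; ring
      _ ≤ C * D := mul_le_mul (hC x hx hx1) (hD x hx hx1) (by positivity)
          (le_trans (by positivity) (hC x hx hx1))
  induction n generalizing k l a f with
  | zero => exact base ha hf
  | succ n ih =>
    refine ⟨base ha.zero hf.zero, fun i => ?_⟩
    have h1 : HasPole n (k + l + 1) (fun x => a x • partialDeriv i f x) :=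
      ih (l := l + 1) ha.pred (hf.2 i)
    have h2 : HasPole n (k + l + 1) (fun x => partialDeriv i a x • f x) := by
      have := ih (ha.2 i) hf.pred
      rwa [add_right_comm] at this
    exact (h1.add h2).congr fun x hx =>
      (partialDeriv_smul (ha.differentiableAt hx) (hf.differentiableAt hx)).symm

theorem HasPole.inner {n k l : ℕ} {f g : Euc m → F} (hf : HasPole n k f)
    (hg : HasPole n l g) : HasPole n (k + l) (fun x => (inner ℝ (f x) (g x) : ℝ)) := by
  have base : ∀ {k l} {f g : Euc m → F}, HasPole 0 k f → HasPole 0 l g →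
      HasPole 0 (k + l) (fun x => (Inner.inner ℝ (f x) (g x) : ℝ)) := by
    rintro k l f g ⟨hf, C, hC⟩ ⟨hg, D, hD⟩
    refine ⟨hf.inner ℝ hg, C * D, fun x hx hx1 => ?_⟩
    calc ‖x‖ ^ (k + l) * ‖(Inner.inner ℝ (f x) (g x) : ℝ)‖
        ≤ ‖x‖ ^ (k + l) * (‖f x‖ * ‖g x‖) := by gcongr; exact norm_inner_le_norm _ _
      _ = (‖x‖ ^ k * ‖f x‖) * (‖x‖ ^ l * ‖g x‖) := by ring
      _ ≤ C * D := mul_le_mul (hC x hx hx1) (hD x hx hx1) (by positivity)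
          (le_trans (by positivity) (hC x hx hx1))
  induction n generalizing k l f g with
  | zero => exact base hf hg
  | succ n ih =>
    refine ⟨base hf.zero hg.zero, fun i => ?_⟩
    have h1 : HasPole n (k + l + 1) (fun x => (Inner.inner ℝ (f x) (partialDeriv i g x) : ℝ)) :=
      ih (l := l + 1) hf.pred (hg.2 i)
    have h2 : HasPole n (k + l + 1) (fun x => (Inner.inner ℝ (partialDeriv i f x) (g x) : ℝ)) := by
      have := ih (hf.2 i) hg.pred
      rwa [add_right_comm] at this
    exact (h1.add h2).congr fun x hx =>
      (partialDeriv_inner (hf.differentiableAt hx) (hg.differentiableAt hx)).symm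

theorem HasPole.of_contDiff (n k : ℕ) {f : Euc m → G} (hf : ContDiff ℝ ∞ f) : HasPole n k f := by
  have base : ∀ k {f : Euc m → G}, ContDiff ℝ ∞ f → HasPole 0 k f := by
    intro k f hf
    refine ⟨hf.contDiffOn, ?_⟩
    obtain ⟨C, hC⟩ := (isCompact_closedBall (0 : Euc m) 1).exists_bound_of_continuousOn
      (f := f) hf.continuous.continuousOn
    refine ⟨C, fun x _ hx1 => ?_⟩
    have h := hC x (by simpa using hx1.le)
    have : ‖x‖ ^ k ≤ 1 := pow_le_one₀ (norm_nonneg x) hx1.le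
    nlinarith [norm_nonneg (f x)]
  induction n generalizing k f with
  | zero => exact base k hf
  | succ n ih => exact ⟨base k hf, fun i => ih (k + 1) (contDiff_partialDeriv hf)⟩

theorem HasPole.const_smul {n k : ℕ} (c : ℝ) {f : Euc m → G} (hf : HasPole n k f) :
    HasPole n k (fun x => c • f x) := by
  have := (HasPole.of_contDiff (m := m) n 0 (contDiff_const (c := c))).smul hf
  rwa [zero_add] at this

theorem HasPole.sub {n k : ℕ} {f g : Euc m → G} (hf : HasPole n k f) (hg : HasPole n k g) :
    HasPole n k (fun x => f x - g x) := by
  simpa [sub_eq_add_neg] using hf.add (hg.const_smul (-1))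

theorem HasPole.sum {ι : Type*} {s : Finset ι} {n k : ℕ} {f : ι → Euc m → G}
    (hf : ∀ j ∈ s, HasPole n k (f j)) : HasPole n k (fun x => ∑ j ∈ s, f j x) := by
  classical
  induction s using Finset.induction_on with
  | empty => simpa using HasPole.of_contDiff n k contDiff_const
  | insert a s ha ih =>
    simp only [Finset.sum_insert ha]
    exact (hf a (by simp)).add (ih fun j hj => hf j (by simp [hj]))

/-- `f` is homogeneous of degree `-k` on `ℝ^m \ {0}`. -/
def IsHomogeneous (k : ℕ) (f : Euc m → G) : Prop :=
  ∀ t : ℝ, 0 < t → ∀ x : Euc m, x ≠ 0 → t ^ k • f (t • x) = f x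

theorem IsHomogeneous.partialDeriv {k : ℕ} {f : Euc m → G} (hf : IsHomogeneous k f)
    (hd : ∀ x ≠ 0, DifferentiableAt ℝ f x) (i : Fin m) :
    IsHomogeneous (k + 1) (partialDeriv i f) := by
  intro t ht x hx
  have htx : t • x ≠ 0 := smul_ne_zero ht.ne' hx
  have h1 : HasFDerivAt (fun y => t ^ k • f (t • y))
      (t ^ k • ((fderiv ℝ f (t • x)).comp (t • ContinuousLinearMap.id ℝ (Euc m)))) x :=
    (((hd _ htx).hasFDerivAt).comp x ((hasFDerivAt_id x).const_smul t)).const_smul _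
  have h2 : (fun y => t ^ k • f (t • y)) =ᶠ[𝓝 x] f := by
    filter_upwards [isOpen_compl_zero.mem_nhds hx] with y hy using hf t ht y hy
  simp only [Biharmonic.partialDeriv]
  rw [← h2.fderiv_eq, h1.fderiv]
  simp [pow_succ, mul_smul]

/-- A homogeneous function of degree `-k` has a pole of order `k`: it is bounded on the unit
sphere, and its derivatives are homogeneous of degree one less. -/
theorem HasPole.of_isHomogeneous (n : ℕ) {k : ℕ} {f : Euc m → G} (hf : ContDiffOn ℝ ∞ f {0}ᶜ)
    (hh : IsHomogeneous k f) : HasPole n k f := by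
  have base : ∀ {k} {f : Euc m → G}, ContDiffOn ℝ ∞ f {0}ᶜ → IsHomogeneous k f →
      HasPole 0 k f := by
    intro k f hf hh
    refine ⟨hf, ?_⟩
    obtain ⟨C, hC⟩ := (isCompact_sphere (0 : Euc m) 1).exists_bound_of_continuousOn
      (f := f) (hf.continuousOn.mono fun x hx => by
        rintro rfl
        simp at hx)
    refine ⟨C, fun x hx _ => ?_⟩
    have hx' : 0 < ‖x‖ := norm_pos_iff.2 hx
    have h := hh ‖x‖ hx' (‖x‖⁻¹ • x) (smul_ne_zero (inv_ne_zero hx'.ne') hx)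
    rw [smul_smul, mul_inv_cancel₀ hx'.ne', one_smul] at h
    have h2 := hC (‖x‖⁻¹ • x) (by simp [norm_smul, hx'.ne'])
    rwa [← h, norm_smul, Real.norm_of_nonneg (by positivity)] at h2
  induction n generalizing k f with
  | zero => exact base hf hh
  | succ n ih =>
    exact ⟨base hf hh, fun i => ih (contDiffOn_partialDeriv isOpen_compl_zero hf)
      (hh.partialDeriv (fun x hx => ((hf.contDiffAt
        (isOpen_compl_zero.mem_nhds hx)).differentiableAt (by simp))) i)⟩

end Poles

/-! ### Integrability of poles -/

section Integrability

variable {m : ℕ} {F : Type*} [NormedAddCommGroup F] [InnerProductSpace ℝ F]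
  {G : Type*} [NormedAddCommGroup G] [NormedSpace ℝ G]

theorem ae_ne_zero (hm : 0 < m) : ∀ᵐ x : Euc m, x ≠ 0 := by
  have : Nonempty (Fin m) := ⟨⟨0, hm⟩⟩
  exact (measure_eq_zero_iff_ae_notMem (s := {0})).1 (by simp)

theorem ae_ball_ne_zero (hm : 0 < m) :
    ∀ᵐ x ∂(ballMeasure m), x ≠ 0 ∧ ‖x‖ < 1 := by
  filter_upwards [ae_restrict_of_ae (ae_ne_zero hm),
    ae_restrict_mem (measurableSet_ball (x := (0 : Euc m)) (ε := 1))] with x hx hx1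
  exact ⟨hx, by simpa using hx1⟩

theorem HasPole.aestronglyMeasurable (hm : 0 < m) {n k : ℕ} {f : Euc m → G}
    (hf : HasPole n k f) : AEStronglyMeasurable f (volume : Measure (Euc m)) := by
  have : Nonempty (Fin m) := ⟨⟨0, hm⟩⟩
  have h := hf.contDiffOn.continuousOn.aestronglyMeasurable (μ := volume)
    isOpen_compl_zero.measurableSet
  rwa [restrict_compl_singleton] at h

theorem integrableOn_norm_pow_neg {k : ℕ} (hk : k < m) :
    IntegrableOn (fun x : Euc m => (‖x‖ ^ k)⁻¹) (unitBall m) := by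
  refine integrableOn_ball_of_norm_le_rpow (C := 1) (α := k) ?_ ?_ ?_ ?_
  · simp; omega
  · simpa using hk
  · refine Eventually.of_forall fun x => ?_
    simp [Real.rpow_neg]
  · exact (by fun_prop : Measurable fun x : Euc m => (‖x‖ ^ k)⁻¹).aestronglyMeasurable

theorem HasPole.ae_bound (hm : 0 < m) {n k : ℕ} {f : Euc m → G} (hf : HasPole n k f) :
    ∃ C, 0 ≤ C ∧ ∀ᵐ x ∂(ballMeasure m), ‖f x‖ ≤ C * (‖x‖ ^ k)⁻¹ := by
  obtain ⟨C, hC⟩ := hf.zero.2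
  refine ⟨max C 0, le_max_right _ _, ?_⟩
  filter_upwards [ae_ball_ne_zero hm] with x hx
  have h := hC x hx.1 hx.2
  have hx' : 0 < ‖x‖ := norm_pos_iff.2 hx.1
  rw [← div_eq_mul_inv, le_div_iff₀ (by positivity), mul_comm]
  exact h.trans (le_max_left _ _)

theorem HasPole.integrable {n k : ℕ} (hk : k < m) {f : Euc m → G} (hf : HasPole n k f) :
    IntegrableOn f (unitBall m) := by
  have hm : 0 < m := by omega
  obtain ⟨C, -, hC⟩ := hf.ae_bound hm
  exact ((integrableOn_norm_pow_neg hk).const_mul C).mono' (hf.aestronglyMeasurable hm).restrict hC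

theorem HasPole.memLp {n k p : ℕ} (hp : p ≠ 0) (hk : k * p < m) {f : Euc m → G}
    (hf : HasPole n k f) : MemLp f p (ballMeasure m) := by
  have hm : 0 < m := by omega
  rw [← integrable_norm_rpow_iff (hf.aestronglyMeasurable hm).restrict (by simpa) (by simp)]
  obtain ⟨C, hC0, hC⟩ := hf.ae_bound hm
  refine ((integrableOn_norm_pow_neg hk).const_mul (C ^ p)).mono' ?_ ?_
  · exact ((hf.aestronglyMeasurable hm).restrict.norm.aemeasurable.pow_const _).aestronglyMeasurable
  · filter_upwards [hC] with x hx
    simp only [ENNReal.toReal_natCast, Real.rpow_natCast]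
    rw [Real.norm_of_nonneg (by positivity)]
    calc ‖f x‖ ^ p ≤ (C * (‖x‖ ^ k)⁻¹) ^ p := by gcongr
      _ = C ^ p * (‖x‖ ^ (k * p))⁻¹ := by rw [mul_pow, inv_pow, pow_mul]

end Integrability

/-! ### Integration by parts across the origin -/

section IntegrationByParts

variable {m : ℕ} {F : Type*} [NormedAddCommGroup F] [InnerProductSpace ℝ F]
  {G : Type*} [NormedAddCommGroup G] [NormedSpace ℝ G]

/-- A smooth cutoff that vanishes for `n|x| ≤ 1` and equals `1` for `n|x| ≥ √2`. -/
noncomputable def cutoff (n : ℕ) (x : Euc m) : ℝ :=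
  Real.smoothTransition ((n : ℝ) ^ 2 * ‖x‖ ^ 2 - 1)

theorem contDiff_cutoff (n : ℕ) : ContDiff ℝ ∞ (cutoff n : Euc m → ℝ) :=
  Real.smoothTransition.contDiff.comp
    ((contDiff_const.mul (contDiff_norm_sq ℝ)).sub contDiff_const)

theorem cutoff_eventuallyEq_one {x : Euc m} (hx : x ≠ 0) :
    ∀ᶠ n : ℕ in atTop, cutoff n =ᶠ[𝓝 x] fun _ => 1 := by
  have hx' : 0 < ‖x‖ ^ 2 := by positivity
  have h1 : Tendsto (fun n : ℕ => (n : ℝ) ^ 2 * ‖x‖ ^ 2) atTop atTop :=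
    ((tendsto_pow_atTop two_ne_zero).comp tendsto_natCast_atTop_atTop).atTop_mul_const hx'
  filter_upwards [h1.eventually_gt_atTop 2] with n hn
  have hc : ContinuousAt (fun y : Euc m => (n : ℝ) ^ 2 * ‖y‖ ^ 2) x := by fun_prop
  filter_upwards [hc.eventually (lt_mem_nhds hn)] with y hy
  exact Real.smoothTransition.one_of_one_le (by linarith)

theorem zero_notMem_tsupport_cutoff (n : ℕ) : (0 : Euc m) ∉ tsupport (cutoff n : Euc m → ℝ) := by
  rw [notMem_tsupport_iff_eventuallyEq]
  have hc : ContinuousAt (fun y : Euc m => (n : ℝ) ^ 2 * ‖y‖ ^ 2) 0 := by fun_prop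
  have h0 : (n : ℝ) ^ 2 * ‖(0 : Euc m)‖ ^ 2 < 1 := by simp
  filter_upwards [hc.eventually (gt_mem_nhds h0)] with y hy
  exact Real.smoothTransition.zero_of_nonpos (by linarith)

theorem abs_cutoff_le_one (n : ℕ) (x : Euc m) : ‖cutoff n x‖ ≤ 1 := by
  rw [cutoff, Real.norm_of_nonneg (Real.smoothTransition.nonneg _)]
  exact Real.smoothTransition.le_one _

/-- The gradient of the cutoffs is `O(1/|x|)` uniformly in `n`. -/
theorem exists_bound_partialDeriv_cutoff :
    ∃ C, ∀ (n : ℕ) (i : Fin m) (x : Euc m), ‖x‖ * ‖partialDeriv i (cutoff n) x‖ ≤ C := by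
  have hcd : Continuous (deriv Real.smoothTransition) :=
    (Real.smoothTransition.contDiff (n := 1)).continuous_deriv le_rfl
  obtain ⟨C, hC⟩ := (isCompact_Icc (a := (-1 : ℝ)) (b := 1)).exists_bound_of_continuousOn
    (f := deriv Real.smoothTransition) hcd.continuousOn
  refine ⟨C * 4, fun n i x => ?_⟩
  have hn : HasFDerivAt (fun y : Euc m => ‖y‖ ^ 2) (2 • (innerSL ℝ x)) x :=
    (hasStrictFDerivAt_norm_sq x).hasFDerivAt
  have hd : HasFDerivAt (cutoff n : Euc m → ℝ)
      (deriv Real.smoothTransition ((n : ℝ) ^ 2 * ‖x‖ ^ 2 - 1) •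
        ((n : ℝ) ^ 2 • (2 • (innerSL ℝ x)))) x :=
    HasDerivAt.comp_hasFDerivAt (h₂ := Real.smoothTransition) x
      (((Real.smoothTransition.contDiff (n := 1)).differentiable (by simp)) _).hasDerivAt
      ((hn.const_mul _).sub_const 1)
  have he : partialDeriv i (cutoff n) x
      = deriv Real.smoothTransition ((n : ℝ) ^ 2 * ‖x‖ ^ 2 - 1) * ((n : ℝ) ^ 2 * (2 * x i)) := by
    simp [partialDeriv, hd.fderiv, EuclideanSpace.inner_single_right]
  have hC0 : 0 ≤ C := (norm_nonneg _).trans (hC 0 (by simp))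
  have hxi : |x i| ≤ ‖x‖ := by simpa using PiLp.norm_apply_le x i
  by_cases hx : (n : ℝ) ^ 2 * ‖x‖ ^ 2 - 1 ≤ 1
  · have h0 : 0 ≤ (n : ℝ) ^ 2 * ‖x‖ ^ 2 := by positivity
    have h1 := hC ((n : ℝ) ^ 2 * ‖x‖ ^ 2 - 1) ⟨by linarith, hx⟩
    rw [he, norm_mul]
    have h2 : ‖(n : ℝ) ^ 2 * (2 * x i)‖ ≤ (n : ℝ) ^ 2 * (2 * ‖x‖) := by
      rw [norm_mul, norm_mul, Real.norm_eq_abs (x i)]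
      simp only [norm_pow, RCLike.norm_natCast, Real.norm_ofNat]
      gcongr
    calc ‖x‖ * (‖deriv Real.smoothTransition ((n : ℝ) ^ 2 * ‖x‖ ^ 2 - 1)‖
          * ‖(n : ℝ) ^ 2 * (2 * x i)‖)
        ≤ ‖x‖ * (C * ((n : ℝ) ^ 2 * (2 * ‖x‖))) := by gcongr
      _ = C * (2 * ((n : ℝ) ^ 2 * ‖x‖ ^ 2)) := by ring
      _ ≤ C * 4 := by gcongr; linarith
  · have h0 : partialDeriv i (cutoff n) x = 0 := by
      rw [partialDeriv_congr (g := fun _ => 1), partialDeriv_const]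
      have hc : ContinuousAt (fun y : Euc m => (n : ℝ) ^ 2 * ‖y‖ ^ 2 - 1) x := by fun_prop
      filter_upwards [hc.eventually (lt_mem_nhds (not_le.1 hx))] with y hy
      exact Real.smoothTransition.one_of_one_le hy.le
    rw [h0]
    simp only [norm_zero, mul_zero]
    positivity

theorem partialDeriv_eq_zero_of_notMem_tsupport {i : Fin m} {f : Euc m → G} {x : Euc m}
    (hx : x ∉ tsupport f) : partialDeriv i f x = 0 := by
  rw [partialDeriv_congr (notMem_tsupport_iff_eventuallyEq.1 hx)]
  exact partialDeriv_const i 0 x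

theorem setIntegral_unitBall {f : Euc m → G} (h : ∀ x ∉ unitBall m, f x = 0) :
    ∫ x in unitBall m, f x = ∫ x, f x :=
  setIntegral_eq_integral_of_forall_compl_eq_zero h

theorem integrable_of_integrableOn_unitBall {E : Type*} [NormedAddCommGroup E] {f : Euc m → E}
    (hf : IntegrableOn f (unitBall m)) (h : ∀ x ∉ unitBall m, f x = 0) : Integrable f :=
  (integrableOn_iff_integrable_of_support_subset fun x hx => by
    by_contra hn
    exact hx (h x hn)).1 hf

/-- The integral of a partial derivative vanishes, for a function with compact support in the unit
ball and a pole of order `k < m - 1` at the origin. -/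
theorem HasPole.integral_partialDeriv_eq_zero {k : ℕ} (hk : k + 1 < m) {f : Euc m → G}
    (hf : HasPole 1 k f) (hs : tsupport f ⊆ unitBall m) (i : Fin m) :
    ∫ x in unitBall m, partialDeriv i f x = 0 := by
  have hm : 0 < m := by omega
  have hf0 : ∀ x ∉ unitBall m, f x = 0 := fun x hx =>
    image_eq_zero_of_notMem_tsupport fun h => hx (hs h)
  have hd0 : ∀ x ∉ unitBall m, partialDeriv i f x = 0 := fun x hx =>
    partialDeriv_eq_zero_of_notMem_tsupport fun h => hx (hs h)
  have hfi : Integrable f := integrable_of_integrableOn_unitBall (hf.integrable (by omega)) hf0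
  have hdi : Integrable (partialDeriv i f) :=
    integrable_of_integrableOn_unitBall ((hf.2 i).integrable hk) hd0
  rw [setIntegral_unitBall hd0]
  obtain ⟨C, hC⟩ := exists_bound_partialDeriv_cutoff (m := m)
  -- the products of `f` with the cutoff gradients are dominated by a pole of order `k + 1`
  have hdom : ∃ D : Euc m → ℝ, Integrable D ∧
      ∀ n, ∀ᵐ x, ‖partialDeriv i (cutoff n) x • f x‖ ≤ D x := by
    obtain ⟨B, hB⟩ := hf.1.bound
    refine ⟨(unitBall m).indicator fun x => C * B * (‖x‖ ^ (k + 1))⁻¹,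
      (integrable_indicator_iff measurableSet_ball).2
        ((integrableOn_norm_pow_neg hk).const_mul _), fun n => ?_⟩
    filter_upwards [ae_ne_zero hm] with x hx
    by_cases hxb : x ∈ unitBall m
    · rw [Set.indicator_of_mem hxb, norm_smul]
      have hx' : 0 < ‖x‖ := norm_pos_iff.2 hx
      rw [← div_eq_mul_inv, le_div_iff₀ (by positivity)]
      have h1 := hC n i x
      have h2 := hB x hx (by simpa using hxb)
      calc ‖partialDeriv i (cutoff n) x‖ * ‖f x‖ * ‖x‖ ^ (k + 1)
          = (‖x‖ * ‖partialDeriv i (cutoff n) x‖) * (‖x‖ ^ k * ‖f x‖) := by ring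
        _ ≤ C * B := mul_le_mul h1 h2 (by positivity) (le_trans (by positivity) h1)
    · rw [Set.indicator_of_notMem hxb, hf0 x hxb]
      simp
  obtain ⟨D, hDi, hD⟩ := hdom
  have hmeas : ∀ n, AEStronglyMeasurable (fun x => partialDeriv i (cutoff n) x • f x) :=
    fun n => (contDiff_partialDeriv (contDiff_cutoff n)).continuous.aestronglyMeasurable.smul
      hfi.aestronglyMeasurable
  have hmeas' : ∀ n, AEStronglyMeasurable (fun x => cutoff n x • partialDeriv i f x) :=
    fun n => (contDiff_cutoff n).continuous.aestronglyMeasurable.smul hdi.aestronglyMeasurable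
  have hbd' : ∀ n, ∀ᵐ x, ‖cutoff n x • partialDeriv i f x‖ ≤ ‖partialDeriv i f x‖ := by
    refine fun n => Eventually.of_forall fun x => ?_
    rw [norm_smul]
    exact mul_le_of_le_one_left (norm_nonneg _) (abs_cutoff_le_one n x)
  have hparts : ∀ n, ∫ x, cutoff n x • partialDeriv i f x
      = -∫ x, partialDeriv i (cutoff n) x • f x := by
    intro n
    refine integral_smul_fderiv_eq_neg_fderiv_smul_of_integrable
      (hDi.mono' (hmeas n) (hD n)) (hdi.norm.mono' (hmeas' n) (hbd' n))
      (hfi.norm.mono' ((contDiff_cutoff n).continuous.aestronglyMeasurable.smul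
        hfi.aestronglyMeasurable) (Eventually.of_forall fun x => ?_))
      (fun x _ => (contDiff_cutoff n).differentiable (by simp) x) fun x hx => ?_
    · simp only [norm_smul]
      exact mul_le_of_le_one_left (norm_nonneg _) (abs_cutoff_le_one n x)
    · refine hf.differentiableAt ?_
      rintro rfl
      exact zero_notMem_tsupport_cutoff n hx
  have hlim1 : Tendsto (fun n => ∫ x, cutoff n x • partialDeriv i f x) atTop
      (𝓝 (∫ x, partialDeriv i f x)) := by
    refine tendsto_integral_of_dominated_convergence _ hmeas' hdi.norm hbd' ?_
    filter_upwards [ae_ne_zero hm] with x hx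
    refine tendsto_const_nhds.congr' ?_
    filter_upwards [cutoff_eventuallyEq_one hx] with n hn
    rw [hn.eq_of_nhds, one_smul]
  have hlim2 : Tendsto (fun n => ∫ x, partialDeriv i (cutoff n) x • f x) atTop
      (𝓝 (∫ _ : Euc m, (0 : G))) := by
    refine tendsto_integral_of_dominated_convergence D hmeas hDi hD ?_
    filter_upwards [ae_ne_zero hm] with x hx
    refine tendsto_const_nhds.congr' ?_
    filter_upwards [cutoff_eventuallyEq_one hx] with n hn
    rw [partialDeriv_congr hn, partialDeriv_const, zero_smul]
  have := tendsto_nhds_unique hlim1 ((hlim2.neg).congr fun n => (hparts n).symm)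
  simpa using this

/-- A function with a pole of order `k < m - 1` has its classical partial derivatives as weak
partial derivatives. -/
theorem HasPole.hasWeakPartial {k : ℕ} (hk : k + 1 < m) {f : Euc m → F}
    (hf : HasPole 1 k f) (i : Fin m) : HasWeakPartial i f (partialDeriv i f) where
  locInt := (hf.integrable (by omega)).locallyIntegrableOn
  locInt_deriv := ((hf.2 i).integrable hk).locallyIntegrableOn
  integral_eq φ hφ := by
    have hφp : HasPole 1 0 φ := HasPole.of_contDiff 1 0 hφ.smooth
    have hφd : HasPole 0 0 (partialDeriv i φ) :=
      HasPole.of_contDiff 0 0 (contDiff_partialDeriv hφ.smooth)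
    have hp : HasPole 1 k (fun x => φ x • f x) := by simpa using hφp.smul hf
    have h0 := hp.integral_partialDeriv_eq_zero hk
      ((tsupport_smul_subset_left φ f).trans hφ.support_subset) i
    have h1 : ∫ x in unitBall m, partialDeriv i (fun x => φ x • f x) x
        = ∫ x in unitBall m, (φ x • partialDeriv i f x + partialDeriv i φ x • f x) := by
      refine integral_congr_ae ?_
      filter_upwards [ae_ball_ne_zero (by omega : 0 < m)] with x hx
      exact partialDeriv_smul (hφp.differentiableAt hx.1) (hf.differentiableAt hx.1)
    rw [h1, integral_add] at h0
    · exact eq_neg_of_add_eq_zero_right h0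
    · exact (hφp.zero.smul (hf.2 i)).integrable (by omega)
    · exact (hφd.smul hf.zero).integrable (by omega)

end IntegrationByParts

/-! ### Weak derivatives -/

section WeakDerivatives

variable {m : ℕ} {F : Type*} [NormedAddCommGroup F] [InnerProductSpace ℝ F]

theorem locallyIntegrableOn_congr_ballMeasure {E : Type*} [NormedAddCommGroup E]
    {f g : Euc m → E}
    (hf : LocallyIntegrableOn f (unitBall m)) (h : f =ᵐ[ballMeasure m] g) :
    LocallyIntegrableOn g (unitBall m) := by
  rw [locallyIntegrableOn_iff Metric.isOpen_ball.isLocallyClosed] at hf ⊢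
  intro K hK hc
  exact (hf K hK hc).congr (ae_restrict_of_ae_restrict_of_subset hK h)

theorem integrableOn_test_smul {f : Euc m → F} (hf : LocallyIntegrableOn f (unitBall m))
    {φ : Euc m → ℝ} (hφ : IsTest φ) : IntegrableOn (fun x => φ x • f x) (unitBall m) := by
  have hK := (locallyIntegrableOn_iff Metric.isOpen_ball.isLocallyClosed).1 hf _
    hφ.support_subset hφ.compact
  have h1 : IntegrableOn (fun x => φ x • f x) (tsupport φ) :=
    hK.continuousOn_smul hφ.smooth.continuous.continuousOn hφ.compact
  exact ((integrableOn_iff_integrable_of_support_subset fun x hx => by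
    by_contra hn
    exact hx (by simp [image_eq_zero_of_notMem_tsupport hn])).1 h1).integrableOn

theorem HasWeakPartial.congr {i : Fin m} {f f' g g' : Euc m → F} (h : HasWeakPartial i f g)
    (hf : f =ᵐ[ballMeasure m] f') (hg : g =ᵐ[ballMeasure m] g') : HasWeakPartial i f' g' where
  locInt := locallyIntegrableOn_congr_ballMeasure h.locInt hf
  locInt_deriv := locallyIntegrableOn_congr_ballMeasure h.locInt_deriv hg
  integral_eq φ hφ := by
    have h1 : ∫ x in unitBall m, partialDeriv i φ x • f' x
        = ∫ x in unitBall m, partialDeriv i φ x • f x :=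
      integral_congr_ae (hf.mono fun x hx => by simp only [hx])
    have h2 : ∫ x in unitBall m, φ x • g' x = ∫ x in unitBall m, φ x • g x :=
      integral_congr_ae (hg.mono fun x hx => by simp only [hx])
    rw [h1, h2, h.integral_eq φ hφ]

theorem HasWeakPartial.sub {i : Fin m} {f f' g g' : Euc m → F} (h : HasWeakPartial i f g)
    (h' : HasWeakPartial i f' g') :
    HasWeakPartial i (fun x => f x - f' x) (fun x => g x - g' x) where
  locInt := h.locInt.sub h'.locInt
  locInt_deriv := h.locInt_deriv.sub h'.locInt_deriv
  integral_eq φ hφ := by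
    simp only [smul_sub]
    rw [integral_sub (integrableOn_test_smul h.locInt hφ.deriv)
      (integrableOn_test_smul h'.locInt hφ.deriv),
      integral_sub (integrableOn_test_smul h.locInt_deriv hφ)
      (integrableOn_test_smul h'.locInt_deriv hφ), h.integral_eq φ hφ, h'.integral_eq φ hφ]
    abel

theorem HasWeakPartial.const_smul {i : Fin m} {f g : Euc m → F} (c : ℝ)
    (h : HasWeakPartial i f g) :
    HasWeakPartial i (fun x => c • f x) (fun x => c • g x) where
  locInt := h.locInt.smul c
  locInt_deriv := h.locInt_deriv.smul c
  integral_eq φ hφ := by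
    simp only [smul_comm _ c, integral_smul]
    rw [h.integral_eq φ hφ, smul_neg]

theorem weakPartial_congr (i : Fin m) {f f' : Euc m → F} (h : f =ᵐ[ballMeasure m] f') :
    weakPartial i f = weakPartial i f' := by
  have : (fun g => HasWeakPartial i f g) = fun g => HasWeakPartial i f' g := by
    funext g
    exact propext ⟨fun hg => hg.congr h (ae_eq_refl g), fun hg => hg.congr h.symm (ae_eq_refl g)⟩
  have hchoose : ∀ P Q : (Euc m → F) → Prop, P = Q → ∀ (_ : Decidable (∃ g, P g))
      (_ : Decidable (∃ g, Q g)), (if h : ∃ g, P g then h.choose else 0)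
        = if h : ∃ g, Q g then h.choose else 0 := by
    rintro P _ rfl d d'
    congr
  exact hchoose _ _ this _ _

theorem hasWeakPartial_weakPartial {i : Fin m} {f : Euc m → F} (h : ∃ g, HasWeakPartial i f g) :
    HasWeakPartial i f (weakPartial i f) := by
  rw [weakPartial, dif_pos h]
  exact h.choose_spec

variable [CompleteSpace F]

/-- Weak partial derivatives are unique almost everywhere. -/
theorem HasWeakPartial.ae_eq {i : Fin m} {f g g' : Euc m → F} (h : HasWeakPartial i f g)
    (h' : HasWeakPartial i f g') : g =ᵐ[ballMeasure m] g' := by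
  have h0 := h.sub h'
  have key := Metric.isOpen_ball.ae_eq_zero_of_integral_contDiff_smul_eq_zero (μ := volume)
    h0.locInt_deriv fun φ h1 h2 h3 => by
      have hφ : IsTest φ := ⟨h1, h2, h3⟩
      have h4 := h0.integral_eq φ hφ
      simp only [sub_self, smul_zero, integral_zero] at h4
      rw [setIntegral_unitBall fun x hx => by
        simp [image_eq_zero_of_notMem_tsupport fun h => hx (h3 h)]] at h4
      exact neg_eq_zero.1 h4.symm
  filter_upwards [(ae_restrict_iff' measurableSet_ball).2 key] with x hx
  exact sub_eq_zero.1 hx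

theorem HasWeakPartial.weakPartial_ae_eq {i : Fin m} {f g : Euc m → F}
    (h : HasWeakPartial i f g) : weakPartial i f =ᵐ[ballMeasure m] g :=
  (hasWeakPartial_weakPartial ⟨g, h⟩).ae_eq h

omit [CompleteSpace F] in
/-- `g` and `h` are the first and second weak derivatives of `f` on the unit ball. -/
structure IsJet (f : Euc m → F) (g : Fin m → Euc m → F) (h : Fin m → Fin m → Euc m → F) :
    Prop where
  first : ∀ i, HasWeakPartial i f (g i)
  second : ∀ i j, HasWeakPartial j (g i) (h i j)

end WeakDerivatives

/-! ### Weak derivatives of second order and the space `W^{2,2}` -/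

section Jets

variable {m : ℕ} {F : Type*} [NormedAddCommGroup F] [InnerProductSpace ℝ F]
  {f f' : Euc m → F} {g g' : Fin m → Euc m → F} {h h' : Fin m → Fin m → Euc m → F}

theorem IsJet.sub (hf : IsJet f g h) (hf' : IsJet f' g' h') :
    IsJet (fun x => f x - f' x) (fun i x => g i x - g' i x) (fun i j x => h i j x - h' i j x) :=
  ⟨fun i => (hf.first i).sub (hf'.first i), fun i j => (hf.second i j).sub (hf'.second i j)⟩

theorem IsJet.const_smul (c : ℝ) (hf : IsJet f g h) :
    IsJet (fun x => c • f x) (fun i x => c • g i x) (fun i j x => c • h i j x) :=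
  ⟨fun i => (hf.first i).const_smul c, fun i j => (hf.second i j).const_smul c⟩

theorem HasPole.isJet {k : ℕ} (hk : k + 2 < m) (hf : HasPole 2 k f) :
    IsJet f (fun i => partialDeriv i f) (fun i j => partialDeriv j (partialDeriv i f)) :=
  ⟨fun i => hf.pred.hasWeakPartial (by omega) i,
    fun i j => (hf.2 i).hasWeakPartial (by omega) j⟩

theorem IsTest.hasPole (n : ℕ) (hf : IsTest f) : HasPole n 0 f := HasPole.of_contDiff n 0 hf.smooth

theorem MemW22.isJet (hf : MemW22 f) :
    IsJet f (fun i => weakPartial i f) (fun i j => weakPartial j (weakPartial i f)) :=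
  ⟨fun i => hasWeakPartial_weakPartial (hf.exists_partial i),
    fun i j => hasWeakPartial_weakPartial (hf.exists_partial₂ i j)⟩

variable [CompleteSpace F]

theorem IsJet.weakPartial_ae_eq (hf : IsJet f g h) (i : Fin m) :
    weakPartial i f =ᵐ[ballMeasure m] g i :=
  (hf.first i).weakPartial_ae_eq

theorem IsJet.weakPartial₂_ae_eq (hf : IsJet f g h) (i j : Fin m) :
    weakPartial j (weakPartial i f) =ᵐ[ballMeasure m] h i j := by
  rw [weakPartial_congr j (hf.weakPartial_ae_eq i)]
  exact (hf.second i j).weakPartial_ae_eq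

theorem IsJet.weakLaplacian_ae_eq (hf : IsJet f g h) :
    weakLaplacian f =ᵐ[ballMeasure m] fun x => ∑ i, h i i x := by
  filter_upwards [eventually_all.2 fun i => hf.weakPartial₂_ae_eq i i] with x hx
  exact Finset.sum_congr rfl fun i _ => hx i

theorem IsJet.gradNormSq_ae_eq (hf : IsJet f g h) :
    gradNormSq f =ᵐ[ballMeasure m] fun x => ∑ i, ‖g i x‖ ^ 2 := by
  filter_upwards [eventually_all.2 fun i => hf.weakPartial_ae_eq i] with x hx
  exact Finset.sum_congr rfl fun i _ => by rw [hx i]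

theorem IsJet.memW22 (hf : IsJet f g h) (h0 : MemLp f 2 (ballMeasure m))
    (h1 : ∀ i, MemLp (g i) 2 (ballMeasure m)) (h2 : ∀ i j, MemLp (h i j) 2 (ballMeasure m)) :
    MemW22 f where
  memLp := h0
  exists_partial i := ⟨_, hf.first i⟩
  memLp_partial i := (h1 i).ae_eq (hf.weakPartial_ae_eq i).symm
  exists_partial₂ i j := ⟨_, (hf.second i j).congr (hf.weakPartial_ae_eq i).symm (ae_eq_refl _)⟩
  memLp_partial₂ i j := (h2 i j).ae_eq (hf.weakPartial₂_ae_eq i j).symm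

theorem IsJet.normW22_eq (hf : IsJet f g h) :
    normW22 f = eLpNorm f 2 (ballMeasure m) + ∑ i, eLpNorm (g i) 2 (ballMeasure m)
      + ∑ i, ∑ j, eLpNorm (h i j) 2 (ballMeasure m) := by
  simp only [normW22]
  congr 1
  · congr 1
    exact Finset.sum_congr rfl fun i _ => eLpNorm_congr_ae (hf.weakPartial_ae_eq i)
  · exact Finset.sum_congr rfl fun i _ => Finset.sum_congr rfl fun j _ =>
      eLpNorm_congr_ae (hf.weakPartial₂_ae_eq i j)

theorem MemW22.sub (hf : MemW22 f) (hf' : MemW22 f') : MemW22 (fun x => f x - f' x) :=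
  (hf.isJet.sub hf'.isJet).memW22 (hf.memLp.sub hf'.memLp)
    (fun i => (hf.memLp_partial i).sub (hf'.memLp_partial i))
    (fun i j => (hf.memLp_partial₂ i j).sub (hf'.memLp_partial₂ i j))

theorem MemW22.const_smul (c : ℝ) (hf : MemW22 f) : MemW22 (fun x => c • f x) :=
  (hf.isJet.const_smul c).memW22 (hf.memLp.const_smul c)
    (fun i => (hf.memLp_partial i).const_smul c)
    (fun i j => (hf.memLp_partial₂ i j).const_smul c)

theorem HasPole.memW22 {k : ℕ} (hk : (k + 2) * 2 < m) (hf : HasPole 2 k f) : MemW22 f :=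
  (hf.isJet (by omega)).memW22 (hf.memLp (p := 2) (by simp) (by omega))
    (fun i => (hf.2 i).memLp (p := 2) (by simp) (by omega))
    (fun i j => ((hf.2 i).2 j).memLp (p := 2) (by simp) (by omega))

theorem IsTest.memW22 (hm : 4 < m) (hf : IsTest f) : MemW22 f := (hf.hasPole 2).memW22 (by omega)

theorem normW22_const_smul (c : ℝ) (hf : MemW22 f) :
    normW22 (fun x => c • f x) = ‖c‖ₑ * normW22 f := by
  rw [(hf.isJet.const_smul c).normW22_eq, hf.isJet.normW22_eq]
  simp only [mul_add, Finset.mul_sum]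
  have : ∀ u : Euc m → F, eLpNorm (fun x => c • u x) 2 (ballMeasure m)
      = ‖c‖ₑ * eLpNorm u 2 (ballMeasure m) := fun u => eLpNorm_const_smul c u _ _
  simp only [this]

theorem normW22_sub_le {u v w : Euc m → F} (hu : MemW22 u) (hv : MemW22 v) (hw : MemW22 w) :
    normW22 (fun x => u x - w x)
      ≤ normW22 (fun x => u x - v x) + normW22 (fun x => v x - w x) := by
  have key : ∀ {a b c : Euc m → F}, MemLp a 2 (ballMeasure m) → MemLp b 2 (ballMeasure m) →
      MemLp c 2 (ballMeasure m) → eLpNorm (fun x => a x - c x) 2 (ballMeasure m)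
        ≤ eLpNorm (fun x => a x - b x) 2 (ballMeasure m)
          + eLpNorm (fun x => b x - c x) 2 (ballMeasure m) := by
    intro a b c ha hb hc
    have := eLpNorm_add_le (ha.sub hb).1 (hb.sub hc).1 (p := 2) (by norm_num)
    rw [sub_add_sub_cancel] at this
    exact this
  rw [(hu.isJet.sub hw.isJet).normW22_eq, (hu.isJet.sub hv.isJet).normW22_eq,
    (hv.isJet.sub hw.isJet).normW22_eq]
  have h0 := key hu.memLp hv.memLp hw.memLp
  have h1 := Finset.sum_le_sum fun i (_ : i ∈ Finset.univ) =>
    key (hu.memLp_partial i) (hv.memLp_partial i) (hw.memLp_partial i)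
  have h2 := Finset.sum_le_sum fun i (_ : i ∈ Finset.univ) =>
    Finset.sum_le_sum fun j (_ : j ∈ Finset.univ) =>
    key (hu.memLp_partial₂ i j) (hv.memLp_partial₂ i j) (hw.memLp_partial₂ i j)
  simp only [Finset.sum_add_distrib] at h1 h2
  refine (add_le_add (add_le_add h0 h1) h2).trans_eq ?_
  abel

theorem normW22_sub_comm {u v : Euc m → F} (hu : MemW22 u) (hv : MemW22 v) :
    normW22 (fun x => u x - v x) = normW22 (fun x => v x - u x) := by
  have := normW22_const_smul (-1) (hv.sub hu)
  simpa using this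

end Jets

/-! ### The space `W_0^{2,2}` -/

section ZeroTrace

variable {m : ℕ} {F : Type*} [NormedAddCommGroup F] [InnerProductSpace ℝ F]

theorem MemW22Zero.exists_test {f : Euc m → F} (hf : MemW22Zero f) {ε : ENNReal} (hε : ε ≠ 0) :
    ∃ φ, IsTest φ ∧ normW22 (fun x => f x - φ x) < ε := by
  obtain ⟨φ, hφ, hlim⟩ := hf.approx
  obtain ⟨n, hn⟩ := (hlim.eventually (gt_mem_nhds hε.bot_lt)).exists
  exact ⟨φ n, hφ n, hn⟩

theorem IsTest.sub {φ ψ : Euc m → F} (hφ : IsTest φ) (hψ : IsTest ψ) :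
    IsTest (fun x => φ x - ψ x) where
  smooth := hφ.smooth.sub hψ.smooth
  compact := hφ.compact.sub hψ.compact
  support_subset := (tsupport_sub φ ψ).trans (Set.union_subset hφ.support_subset hψ.support_subset)

theorem IsTest.const_smul (c : ℝ) {φ : Euc m → F} (hφ : IsTest φ) :
    IsTest (fun x => c • φ x) where
  smooth := contDiff_const.smul hφ.smooth
  compact := hφ.compact.smul_left (f := fun _ => c)
  support_subset := (tsupport_smul_subset_right (fun _ => c) φ).trans hφ.support_subset

theorem memW22Zero_of_exists_test {f : Euc m → F} (hf : MemW22 f)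
    (h : ∀ ε : ENNReal, ε ≠ 0 → ∃ φ, IsTest φ ∧ normW22 (fun x => f x - φ x) ≤ ε) :
    MemW22Zero f := by
  refine ⟨hf, ?_⟩
  choose φ hφ hn using fun n : ℕ => h ((n : ENNReal)⁻¹) (by simp)
  exact ⟨φ, hφ, tendsto_of_tendsto_of_tendsto_of_le_of_le tendsto_const_nhds
    ENNReal.tendsto_inv_nat_nhds_zero (fun _ => bot_le) hn⟩

variable [CompleteSpace F]

theorem MemW22Zero.sub (hm : 4 < m) {f g : Euc m → F} (hf : MemW22Zero f) (hg : MemW22Zero g) :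
    MemW22Zero (fun x => f x - g x) := by
  refine memW22Zero_of_exists_test (hf.memW22.sub hg.memW22) fun ε hε => ?_
  obtain ⟨φ, hφ, h1⟩ := hf.exists_test (ENNReal.half_pos hε).ne'
  obtain ⟨ψ, hψ, h2⟩ := hg.exists_test (ENNReal.half_pos hε).ne'
  refine ⟨_, hφ.sub hψ, ?_⟩
  have h3 := normW22_sub_le (hf.memW22.sub (hφ.memW22 hm))
    (((hf.memW22.sub hf.memW22))) (hg.memW22.sub (hψ.memW22 hm))
  have h4 := normW22_const_smul (-1) (hg.memW22.sub (hψ.memW22 hm))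
  simp only [sub_self, sub_zero, zero_sub] at h3
  simp only [neg_smul, one_smul, enorm_neg, enorm_one, one_mul] at h4
  calc normW22 (fun x => f x - g x - (φ x - ψ x))
      = normW22 (fun x => f x - φ x - (g x - ψ x)) := by congr 1; funext x; abel
    _ ≤ _ := h3
    _ ≤ ε / 2 + ε / 2 := by rw [h4]; exact add_le_add h1.le h2.le
    _ = ε := ENNReal.add_halves ε

theorem MemW22Zero.const_smul (hm : 4 < m) (c : ℝ) {f : Euc m → F} (hf : MemW22Zero f) :
    MemW22Zero (fun x => c • f x) := by
  obtain ⟨φ, hφ, hlim⟩ := hf.approx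
  refine ⟨hf.memW22.const_smul c, fun n x => c • φ n x, fun n => (hφ n).const_smul c, ?_⟩
  have h1 : ∀ n, normW22 (fun x => c • f x - c • φ n x)
      = ‖c‖ₑ * normW22 (fun x => f x - φ n x) := by
    intro n
    rw [← normW22_const_smul c (hf.memW22.sub ((hφ n).memW22 hm))]
    simp only [smul_sub]
  simp only [h1]
  simpa using ENNReal.Tendsto.const_mul hlim (Or.inr (by simp : ‖c‖ₑ ≠ ⊤))

/-- `W_0^{2,2}` is closed in `W^{2,2}`. -/
theorem memW22Zero_of_tendsto (hm : 4 < m) {l : Filter ℝ} [l.NeBot] {u : ℝ → Euc m → F}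
    {f : Euc m → F} (hf : MemW22 f) (hu : ∀ᶠ s in l, MemW22Zero (u s))
    (hlim : Tendsto (fun s => normW22 (fun x => u s x - f x)) l (𝓝 0)) : MemW22Zero f := by
  refine memW22Zero_of_exists_test hf fun ε hε => ?_
  obtain ⟨s, hs, h1⟩ := (hu.and (hlim.eventually
    (gt_mem_nhds (ENNReal.half_pos hε)))).exists
  obtain ⟨φ, hφ, h2⟩ := hs.exists_test (ENNReal.half_pos hε).ne'
  refine ⟨φ, hφ, (normW22_sub_le hf hs.memW22 (hφ.memW22 hm)).trans ?_⟩
  rw [normW22_sub_comm hf hs.memW22]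
  exact (add_le_add h1.le h2.le).trans_eq (ENNReal.add_halves ε)

end ZeroTrace

/-! ### Hardy–Rellich and Poincaré inequalities for test fields -/

section HardyRellich

variable {m : ℕ} {F : Type*} [NormedAddCommGroup F] [InnerProductSpace ℝ F]

theorem norm_sq_sum_coord_smul_le (x : Euc m) (v : Fin m → F) :
    ‖∑ i, x i • v i‖ ^ 2 ≤ ‖x‖ ^ 2 * ∑ i, ‖v i‖ ^ 2 := by
  have h1 : ‖∑ i, x i • v i‖ ≤ ∑ i, |x i| * ‖v i‖ :=
    (norm_sum_le _ _).trans_eq (Finset.sum_congr rfl fun i _ => by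
      rw [norm_smul, Real.norm_eq_abs])
  calc ‖∑ i, x i • v i‖ ^ 2 ≤ (∑ i, |x i| * ‖v i‖) ^ 2 := by gcongr
    _ ≤ (∑ i, |x i| ^ 2) * ∑ i, ‖v i‖ ^ 2 := Finset.sum_mul_sq_le_sq_mul_sq _ _ _
    _ = ‖x‖ ^ 2 * ∑ i, ‖v i‖ ^ 2 := by simp only [sq_abs, sum_coord_sq]

theorem contDiff_weight {ε : ℝ} (hε : 0 < ε) :
    ContDiff ℝ ∞ (fun x : Euc m => (‖x‖ ^ 2 + ε)⁻¹) :=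
  ((contDiff_norm_sq ℝ).add contDiff_const).inv fun x => by positivity

theorem partialDeriv_weight {ε : ℝ} (hε : 0 < ε) (i : Fin m) (x : Euc m) :
    partialDeriv i (fun x : Euc m => (‖x‖ ^ 2 + ε)⁻¹) x = -2 * x i * ((‖x‖ ^ 2 + ε)⁻¹) ^ 2 := by
  have hn : HasFDerivAt (fun y : Euc m => ‖y‖ ^ 2 + ε) (2 • (innerSL ℝ x)) x :=
    (hasStrictFDerivAt_norm_sq x).hasFDerivAt.add_const ε
  have hd := (hasDerivAt_inv (by positivity : ‖x‖ ^ 2 + ε ≠ 0)).comp_hasFDerivAt x hn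
  have he : partialDeriv i (fun x : Euc m => (‖x‖ ^ 2 + ε)⁻¹) x = _ :=
    congrArg (fun L => L (EuclideanSpace.single i 1)) hd.fderiv
  rw [he]
  simp [EuclideanSpace.inner_single_right]
  ring

theorem IsTest.integral_partialDeriv_eq_zero (hm : 1 < m) {f : Euc m → ℝ} (hf : IsTest f)
    (i : Fin m) : ∫ x in unitBall m, partialDeriv i f x = 0 :=
  (hf.hasPole 1).integral_partialDeriv_eq_zero hm hf.support_subset i

theorem isTest_of_eq_zero {f : Euc m → ℝ} (hf : ContDiff ℝ ∞ f) {φ : Euc m → F} (hφ : IsTest φ)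
    (h : ∀ x, x ∉ tsupport φ → f x = 0) : IsTest f := by
  have hs : tsupport f ⊆ tsupport φ :=
    closure_minimal (fun x hx => by by_contra hn; exact hx (h x hn)) (isClosed_tsupport φ)
  exact ⟨hf, hφ.compact.of_isClosed_subset (isClosed_tsupport f) hs, hs.trans hφ.support_subset⟩

theorem IsTest.integrable {φ : Euc m → ℝ} (hφ : IsTest φ) : IntegrableOn φ (unitBall m) :=
  (hφ.smooth.continuous.integrable_of_hasCompactSupport hφ.compact).integrableOn

/-- The divergence of the Rellich–Pohozaev field `w (⟨∂_i φ, x · ∇φ⟩ - ½ x_i |∇φ|²)`,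
`w = (|x|² + ε)⁻¹`. -/
theorem sum_partialDeriv_rellichField {ε : ℝ} (hε : 0 < ε) {φ : Euc m → F}
    (hφ : ContDiff ℝ ∞ φ) (x : Euc m) :
    ∑ i, partialDeriv i (fun y => (‖y‖ ^ 2 + ε)⁻¹ *
        ((inner ℝ (partialDeriv i φ y) (∑ j, y j • partialDeriv j φ y) : ℝ)
          - 1 / 2 * (y i * ∑ j, (inner ℝ (partialDeriv j φ y) (partialDeriv j φ y) : ℝ)))) x
      = (‖x‖ ^ 2 + ε)⁻¹ * (inner ℝ (laplacian φ x) (∑ j, x j • partialDeriv j φ x) : ℝ)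
        + (1 - m / 2) * (‖x‖ ^ 2 + ε)⁻¹ * ∑ j, ‖partialDeriv j φ x‖ ^ 2
        + ‖x‖ ^ 2 * ((‖x‖ ^ 2 + ε)⁻¹) ^ 2 * ∑ j, ‖partialDeriv j φ x‖ ^ 2
        - 2 * ((‖x‖ ^ 2 + ε)⁻¹) ^ 2 * ‖∑ j, x j • partialDeriv j φ x‖ ^ 2 := by
  set w : Euc m → ℝ := fun y => (‖y‖ ^ 2 + ε)⁻¹ with hw
  set E : Euc m → F := fun y => ∑ j, y j • partialDeriv j φ y with hE
  set N : Euc m → ℝ := fun y => ∑ j, (inner ℝ (partialDeriv j φ y) (partialDeriv j φ y) : ℝ)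
    with hN
  have dw : DifferentiableAt ℝ w x := (contDiff_weight hε).differentiable (by simp) x
  have dφ : ∀ i, DifferentiableAt ℝ (partialDeriv i φ) x := fun i =>
    (contDiff_partialDeriv hφ).differentiable (by simp) x
  have dx : ∀ i : Fin m, DifferentiableAt ℝ (fun y : Euc m => y i) x := fun i =>
    (contDiff_coord i).differentiable (by simp) x
  have dE : DifferentiableAt ℝ E x :=
    DifferentiableAt.fun_sum fun j _ => (dx j).smul (dφ j)
  have dN : DifferentiableAt ℝ N x :=
    DifferentiableAt.fun_sum fun j _ => (dφ j).inner ℝ (dφ j)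
  have hEi : ∀ i, partialDeriv i E x
      = partialDeriv i φ x + ∑ j, x j • partialDeriv i (partialDeriv j φ) x := by
    intro i
    rw [hE, partialDeriv_sum fun j _ => (dx j).fun_smul (dφ j)]
    rw [Finset.sum_congr rfl fun j _ => partialDeriv_smul (dx j) (dφ j)]
    simp [Finset.sum_add_distrib, partialDeriv_coord, add_comm]
  have hNi : ∀ i, partialDeriv i N x
      = 2 * ∑ j, (inner ℝ (partialDeriv j φ x) (partialDeriv i (partialDeriv j φ) x) : ℝ) := by
    intro i
    rw [hN, partialDeriv_sum fun j _ => (dφ j).inner ℝ (dφ j), Finset.mul_sum]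
    refine Finset.sum_congr rfl fun j _ => ?_
    rw [partialDeriv_inner (dφ j) (dφ j), real_inner_comm, two_mul, real_inner_comm]
  have hterm : ∀ i, partialDeriv i (fun y => w y * ((inner ℝ (partialDeriv i φ y) (E y) : ℝ)
          - 1 / 2 * (y i * N y))) x
      = w x * ((inner ℝ (partialDeriv i φ x) (partialDeriv i φ x) : ℝ)
          + (∑ j, x j * (inner ℝ (partialDeriv i φ x) (partialDeriv i (partialDeriv j φ) x) : ℝ))
          + (inner ℝ (partialDeriv i (partialDeriv i φ) x) (E x) : ℝ)
          - 1 / 2 * N x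
          - x i * ∑ j, (inner ℝ (partialDeriv j φ x) (partialDeriv i (partialDeriv j φ) x) : ℝ))
        - 2 * w x ^ 2 * (inner ℝ (x i • partialDeriv i φ x) (E x) : ℝ)
        + w x ^ 2 * x i ^ 2 * N x := by
    intro i
    have d1 := (dφ i).inner ℝ dE
    have d2 : DifferentiableAt ℝ (fun y : Euc m => y i * N y) x := (dx i).mul dN
    have d3 : DifferentiableAt ℝ (fun y : Euc m => 1 / 2 * (y i * N y)) x := d2.const_mul _
    rw [partialDeriv_mul dw (d1.fun_sub d3), partialDeriv_sub d1 d3, partialDeriv_inner (dφ i) dE,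
      partialDeriv_mul (a := fun _ => 1 / 2) (differentiableAt_const _) d2,
      partialDeriv_mul (dx i) dN, partialDeriv_const, partialDeriv_coord, hEi, hNi,
      partialDeriv_weight hε, inner_add_right, inner_sum, real_inner_smul_left]
    simp only [real_inner_smul_right, if_true]
    ring
  rw [Finset.sum_congr rfl fun i _ => hterm i]
  have hcancel : ∑ i, ∑ j, x j * (inner ℝ (partialDeriv i φ x)
        (partialDeriv i (partialDeriv j φ) x) : ℝ)
      = ∑ i, x i * ∑ j, (inner ℝ (partialDeriv j φ x)
        (partialDeriv i (partialDeriv j φ) x) : ℝ) := by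
    rw [Finset.sum_comm]
    refine Finset.sum_congr rfl fun i _ => ?_
    rw [Finset.mul_sum]
    refine Finset.sum_congr rfl fun j _ => ?_
    rw [partialDeriv_comm (hφ.contDiffAt.of_le ENat.LEInfty.out)]
  have hNx : N x = ∑ j, ‖partialDeriv j φ x‖ ^ 2 := by
    simp only [hN, real_inner_self_eq_norm_sq]
  have hlap : (inner ℝ (laplacian φ x) (E x) : ℝ)
      = ∑ i, (inner ℝ (partialDeriv i (partialDeriv i φ) x) (E x) : ℝ) := by
    rw [laplacian, sum_inner]
  have hEE : ∑ i, (inner ℝ (x i • partialDeriv i φ x) (E x) : ℝ) = ‖E x‖ ^ 2 := by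
    rw [← sum_inner, real_inner_self_eq_norm_sq]
  have hxx := sum_coord_sq x
  rw [hlap, ← hNx]
  simp only [Finset.sum_add_distrib, Finset.sum_sub_distrib, ← Finset.mul_sum, ← Finset.sum_mul,
    hEE, hcancel, hxx, Finset.sum_const, Finset.card_univ, Fintype.card_fin, nsmul_eq_mul]
  have hN' : ∑ i, (inner ℝ (partialDeriv i φ x) (partialDeriv i φ x) : ℝ) = N x := rfl
  rw [hN']
  ring

/-- A Hardy–Rellich inequality with a regularised weight. For `α = m / 2` the constant `m² / 4`
is the sharp one; it is obtained by integrating `|Δφ - α (x · ∇φ) / (|x|² + ε)|² ≥ 0`. -/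
theorem IsTest.hardyRellich {ε α : ℝ} (hε : 0 < ε) (hα : 4 ≤ α) (hm : 1 < m) {φ : Euc m → F}
    (hφ : IsTest φ) :
    (α * m - α ^ 2) * ∫ x in unitBall m, (‖x‖ ^ 2 + ε)⁻¹ * ∑ j, ‖partialDeriv j φ x‖ ^ 2
      ≤ ∫ x in unitBall m, ‖laplacian φ x‖ ^ 2 := by
  set Φ : Fin m → Euc m → ℝ := fun i y => (‖y‖ ^ 2 + ε)⁻¹ *
        ((inner ℝ (partialDeriv i φ y) (∑ j, y j • partialDeriv j φ y) : ℝ)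
          - 1 / 2 * (y i * ∑ j, (inner ℝ (partialDeriv j φ y) (partialDeriv j φ y) : ℝ))) with hΦ
  have cφ : ∀ i, ContDiff ℝ ∞ (partialDeriv i φ) := fun i => contDiff_partialDeriv hφ.smooth
  have z1 : ∀ x, x ∉ tsupport φ → ∀ i, partialDeriv i φ x = 0 := fun x hx i =>
    partialDeriv_eq_zero_of_notMem_tsupport hx
  have hΦt : ∀ i, IsTest (Φ i) := by
    intro i
    refine isTest_of_eq_zero ?_ hφ fun x hx => ?_
    · exact (contDiff_weight hε).mul (((cφ i).inner ℝ (ContDiff.sum fun j _ =>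
        (contDiff_coord j).smul (cφ j))).sub (contDiff_const.mul ((contDiff_coord i).mul
          (ContDiff.sum fun j _ => (cφ j).inner ℝ (cφ j)))))
    · simp [hΦ, z1 x hx]
  have hNt : IsTest (fun x => (‖x‖ ^ 2 + ε)⁻¹ * ∑ j, ‖partialDeriv j φ x‖ ^ 2) := by
    refine isTest_of_eq_zero ?_ hφ fun x hx => ?_
    · exact (contDiff_weight hε).mul (ContDiff.sum fun j _ => (cφ j).norm_sq ℝ)
    · simp [z1 x hx]
  have hLt : IsTest (fun x => ‖laplacian φ x‖ ^ 2) := by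
    refine isTest_of_eq_zero ?_ hφ fun x hx => ?_
    · exact (ContDiff.sum fun j _ => contDiff_partialDeriv (cφ j)).norm_sq ℝ
    · have : ∀ i, partialDeriv i (partialDeriv i φ) x = 0 := fun i =>
        partialDeriv_eq_zero_of_notMem_tsupport fun h => hx (tsupport_fderiv_apply_subset ℝ _ h)
      simp [laplacian, this]
  have hdiv : ∫ x in unitBall m, ∑ i, partialDeriv i (Φ i) x = 0 := by
    rw [integral_finsetSum _ fun i _ => (hΦt i).deriv.integrable]
    exact Finset.sum_eq_zero fun i _ => (hΦt i).integral_partialDeriv_eq_zero hm i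
  have hdivi : IntegrableOn (fun x => ∑ i, partialDeriv i (Φ i) x) (unitBall m) :=
    integrable_finsetSum _ fun i _ => (hΦt i).deriv.integrable
  have hle : ∫ x in unitBall m, (2 * α * ∑ i, partialDeriv i (Φ i) x
      + (α * m - α ^ 2) * ((‖x‖ ^ 2 + ε)⁻¹ * ∑ j, ‖partialDeriv j φ x‖ ^ 2))
      ≤ ∫ x in unitBall m, ‖laplacian φ x‖ ^ 2 := by
    refine integral_mono ((hdivi.const_mul _).add (hNt.integrable.const_mul _)) hLt.integrable
      fun x => ?_
    simp only [hΦ]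
    rw [sum_partialDeriv_rellichField hε hφ.smooth x]
    set w := (‖x‖ ^ 2 + ε)⁻¹ with hw
    set N := ∑ j, ‖partialDeriv j φ x‖ ^ 2 with hN
    set E := ∑ j, x j • partialDeriv j φ x with hE
    have hw0 : 0 < w := by positivity
    have hN0 : 0 ≤ N := Finset.sum_nonneg fun j _ => by positivity
    have hrw : ‖x‖ ^ 2 * w ≤ 1 := by
      rw [hw, ← div_eq_mul_inv, div_le_one (by positivity)]
      linarith
    have hEN : ‖E‖ ^ 2 ≤ ‖x‖ ^ 2 * N := norm_sq_sum_coord_smul_le x _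
    have hsq : 0 ≤ ‖laplacian φ x - (α * w) • E‖ ^ 2 := by positivity
    rw [norm_sub_sq_real, real_inner_smul_right, norm_smul, mul_pow, Real.norm_eq_abs,
      sq_abs] at hsq
    have h1 : ‖x‖ ^ 2 * w ^ 2 * N ≤ w * N := by
      calc ‖x‖ ^ 2 * w ^ 2 * N = (‖x‖ ^ 2 * w) * (w * N) := by ring
        _ ≤ 1 * (w * N) := by gcongr
        _ = w * N := one_mul _
    have h2 : w ^ 2 * ‖E‖ ^ 2 ≤ w * N := by
      calc w ^ 2 * ‖E‖ ^ 2 ≤ w ^ 2 * (‖x‖ ^ 2 * N) := by gcongr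
        _ = ‖x‖ ^ 2 * w ^ 2 * N := by ring
        _ ≤ w * N := h1
    -- the remaining terms are `2α |x|² w² N + (α² - 4α) w² |E|² ≤ (α² - 2α) w N`; the condition
    -- `α ≥ 4` makes the coefficient of `|E|²` nonnegative
    nlinarith [mul_le_mul_of_nonneg_left h1 (by linarith : 0 ≤ 2 * α),
      mul_le_mul_of_nonneg_left h2 (by nlinarith : 0 ≤ α ^ 2 - 4 * α)]
  rw [integral_add (hdivi.const_mul _) (hNt.integrable.const_mul _), integral_const_mul,
    integral_const_mul, hdiv] at hle
  linarith

/-- A Poincaré inequality on the unit ball, from `∑ |∂_i φ + x_i φ|² ≥ 0`. -/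
theorem IsTest.poincare (hm : 1 < m) {φ : Euc m → F} (hφ : IsTest φ) :
    (m - 1 : ℝ) * ∫ x in unitBall m, ‖φ x‖ ^ 2
      ≤ ∫ x in unitBall m, ∑ j, ‖partialDeriv j φ x‖ ^ 2 := by
  have cφ : ∀ i, ContDiff ℝ ∞ (partialDeriv i φ) := fun i => contDiff_partialDeriv hφ.smooth
  have z0 : ∀ x, x ∉ tsupport φ → φ x = 0 := fun x hx => image_eq_zero_of_notMem_tsupport hx
  have z1 : ∀ x, x ∉ tsupport φ → ∀ i, partialDeriv i φ x = 0 := fun x hx i =>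
    partialDeriv_eq_zero_of_notMem_tsupport hx
  set Φ : Fin m → Euc m → ℝ := fun i y => y i * (inner ℝ (φ y) (φ y) : ℝ) with hΦ
  have hΦt : ∀ i, IsTest (Φ i) := fun i => isTest_of_eq_zero
    ((contDiff_coord i).mul (hφ.smooth.inner ℝ hφ.smooth)) hφ fun x hx => by simp [hΦ, z0 x hx]
  have hNt : IsTest (fun x => ∑ j, ‖partialDeriv j φ x‖ ^ 2) :=
    isTest_of_eq_zero (ContDiff.sum fun j _ => (cφ j).norm_sq ℝ) hφ fun x hx => by simp [z1 x hx]
  have h0t : IsTest (fun x => ‖φ x‖ ^ 2) :=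
    isTest_of_eq_zero (hφ.smooth.norm_sq ℝ) hφ fun x hx => by simp [z0 x hx]
  have hdiv : ∫ x in unitBall m, ∑ i, partialDeriv i (Φ i) x = 0 := by
    rw [integral_finsetSum _ fun i _ => (hΦt i).deriv.integrable]
    exact Finset.sum_eq_zero fun i _ => (hΦt i).integral_partialDeriv_eq_zero hm i
  have hdivi : IntegrableOn (fun x => ∑ i, partialDeriv i (Φ i) x) (unitBall m) :=
    integrable_finsetSum _ fun i _ => (hΦt i).deriv.integrable
  have hle : ∫ x in unitBall m, ((m - 1 : ℝ) * ‖φ x‖ ^ 2 - ∑ i, partialDeriv i (Φ i) x)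
      ≤ ∫ x in unitBall m, ∑ j, ‖partialDeriv j φ x‖ ^ 2 := by
    refine setIntegral_mono_on ((h0t.integrable.const_mul _).sub hdivi) hNt.integrable
      measurableSet_ball fun x hx => ?_
    have hx1 : ‖x‖ < 1 := by simpa using hx
    have dφ : DifferentiableAt ℝ φ x := hφ.smooth.differentiable (by simp) x
    have hterm : ∀ i, partialDeriv i (Φ i) x
        = 2 * (x i * inner ℝ (partialDeriv i φ x) (φ x)) + ‖φ x‖ ^ 2 := by
      intro i
      simp only [hΦ]
      rw [partialDeriv_mul ((contDiff_coord i).differentiable (by simp) x) (dφ.inner ℝ dφ),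
        partialDeriv_inner dφ dφ, partialDeriv_coord, real_inner_self_eq_norm_sq,
        real_inner_comm (partialDeriv i φ x)]
      simp only [if_true]
      ring
    have hsq : 0 ≤ ∑ i, ‖partialDeriv i φ x + x i • φ x‖ ^ 2 :=
      Finset.sum_nonneg fun i _ => by positivity
    have hexp : ∀ i, ‖partialDeriv i φ x + x i • φ x‖ ^ 2 = ‖partialDeriv i φ x‖ ^ 2
        + 2 * (x i * inner ℝ (partialDeriv i φ x) (φ x)) + x i ^ 2 * ‖φ x‖ ^ 2 := by
      intro i
      rw [norm_add_sq_real, real_inner_smul_right, norm_smul, mul_pow, Real.norm_eq_abs, sq_abs]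
    simp only [hexp, hterm, Finset.sum_add_distrib, ← Finset.sum_mul, sum_coord_sq,
      Finset.sum_const, Finset.card_univ, Fintype.card_fin, nsmul_eq_mul] at hsq ⊢
    have : ‖x‖ ^ 2 * ‖φ x‖ ^ 2 ≤ 1 * ‖φ x‖ ^ 2 := by
      gcongr
      exact pow_le_one₀ (norm_nonneg x) hx1.le
    linarith
  rw [integral_sub (h0t.integrable.const_mul _) hdivi, integral_const_mul, hdiv] at hle
  linarith

end HardyRellich

/-! ### Differentiability of the bienergy -/

section SecondVariation

variable {m : ℕ} {E : Type*} [NormedAddCommGroup E] {F : Type*} [NormedAddCommGroup F]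
  [InnerProductSpace ℝ F]

open Classical in
/-- The class of `f` in `L^p(B^m)`, with the value `0` if `f` is not in `L^p`. -/
noncomputable def toLpOrZero (p : ENNReal) (f : Euc m → E) : Lp E p (ballMeasure m) :=
  if h : MemLp f p (ballMeasure m) then h.toLp f else 0

theorem toLpOrZero_of_memLp {p : ENNReal} {f : Euc m → E} (h : MemLp f p (ballMeasure m)) :
    toLpOrZero p f = h.toLp f := dif_pos h

theorem coeFn_toLpOrZero {p : ENNReal} {f : Euc m → E} (h : MemLp f p (ballMeasure m)) :
    toLpOrZero p f =ᵐ[ballMeasure m] f := by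
  rw [toLpOrZero_of_memLp h]
  exact h.coeFn_toLp

theorem hasDerivAt_toLpOrZero {p : ENNReal} [Fact (1 ≤ p)] {f : ℝ → Euc m → F} {g : Euc m → F}
    {t : ℝ} (hf : ∀ᶠ s in 𝓝 t, MemLp (f s) p (ballMeasure m)) (hg : MemLp g p (ballMeasure m))
    (hlim : Tendsto (fun s => eLpNorm (fun x => (s - t)⁻¹ • (f s x - f t x) - g x) p
      (ballMeasure m)) (𝓝[≠] t) (𝓝 0)) :
    HasDerivAt (fun s => toLpOrZero p (f s)) (toLpOrZero p g) t := by
  rw [hasDerivAt_iff_tendsto_slope, Lp.tendsto_Lp_iff_tendsto_eLpNorm']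
  refine hlim.congr' ?_
  filter_upwards [hf.filter_mono nhdsWithin_le_nhds] with s hs
  have ht := hf.self_of_nhds
  refine eLpNorm_congr_ae ?_
  rw [slope_def_module]
  filter_upwards [coeFn_toLpOrZero hs, coeFn_toLpOrZero ht, coeFn_toLpOrZero hg,
    Lp.coeFn_sub ((s - t)⁻¹ • (toLpOrZero p (f s) - toLpOrZero p (f t))) (toLpOrZero p g),
    Lp.coeFn_smul (s - t)⁻¹ (toLpOrZero p (f s) - toLpOrZero p (f t)),
    Lp.coeFn_sub (toLpOrZero p (f s)) (toLpOrZero p (f t))] with x h1 h2 h3 h4 h5 h6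
  simp only [h5, h6, Pi.sub_apply, Pi.smul_apply, h1, h2, h3]

theorem MemW22.memLp_weakLaplacian {f : Euc m → F} (hf : MemW22 f) :
    MemLp (weakLaplacian f) 2 (ballMeasure m) :=
  memLp_finsetSum _ fun i _ => hf.memLp_partial₂ i i

theorem eLpNorm_weakLaplacian_le {f : Euc m → F} (hf : MemW22 f) :
    eLpNorm (weakLaplacian f) 2 (ballMeasure m) ≤ normW22 f := by
  calc eLpNorm (weakLaplacian f) 2 (ballMeasure m)
      ≤ ∑ i, eLpNorm (weakPartial i (weakPartial i f)) 2 (ballMeasure m) := by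
        have : weakLaplacian f = ∑ i, weakPartial i (weakPartial i f) := by
          funext x
          simp [weakLaplacian]
        rw [this]
        exact eLpNorm_sum_le (fun i _ => (hf.memLp_partial₂ i i).1) (by norm_num)
    _ ≤ ∑ i, ∑ j, eLpNorm (weakPartial j (weakPartial i f)) 2 (ballMeasure m) :=
        Finset.sum_le_sum fun i _ => Finset.single_le_sum
          (f := fun j => eLpNorm (weakPartial j (weakPartial i f)) 2 (ballMeasure m))
          (fun _ _ => bot_le) (Finset.mem_univ i)
    _ ≤ normW22 f := le_add_self

theorem eLpNorm_weakPartial_le (f : Euc m → F) (i : Fin m) :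
    eLpNorm (weakPartial i f) 2 (ballMeasure m) ≤ normW22 f := by
  refine le_trans ?_ (le_self_add : _ ≤ normW22 f)
  refine le_trans ?_ le_add_self
  exact Finset.single_le_sum (f := fun i => eLpNorm (weakPartial i f) 2 (ballMeasure m))
    (fun _ _ => bot_le) (Finset.mem_univ i)

theorem eLpNorm_le_normW22 (f : Euc m → F) :
    eLpNorm f 2 (ballMeasure m) ≤ normW22 f := by
  simp only [normW22, add_assoc]
  exact le_self_add

theorem normW22_le_normEnergySpace (f : Euc m → F) : normW22 f ≤ normEnergySpace f :=
  le_self_add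

theorem eLpNorm_weakPartial_four_le (f : Euc m → F) (i : Fin m) :
    eLpNorm (weakPartial i f) 4 (ballMeasure m) ≤ normEnergySpace f := by
  refine le_trans ?_ le_add_self
  exact Finset.single_le_sum (f := fun i => eLpNorm (weakPartial i f) 4 (ballMeasure m))
    (fun _ _ => bot_le) (Finset.mem_univ i)

/-- `¼ + ¼ = ½`, for products of two gradients in `L⁴`. -/
instance holderTriple_four_four_two : ENNReal.HolderTriple 4 4 2 where
  inv_add_inv_eq_inv := by
    rw [← ENNReal.toReal_eq_toReal_iff' (by simp) (by simp), ENNReal.toReal_add (by simp) (by simp)]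
    simp only [ENNReal.toReal_inv, ENNReal.toReal_ofNat]
    norm_num

instance fact_one_le_four : Fact ((1 : ENNReal) ≤ 4) := ⟨by norm_num⟩

variable [CompleteSpace F]

theorem HasEnergySpaceDerivAt.hasDerivAt_weakLaplacian {U : ℝ → Euc m → F} {V : Euc m → F}
    {t : ℝ} (h : HasEnergySpaceDerivAt U V t) :
    HasDerivAt (fun s => toLpOrZero 2 (weakLaplacian (U s))) (toLpOrZero 2 (weakLaplacian V)) t := by
  refine hasDerivAt_toLpOrZero
    (h.eventually_mem.mono fun s hs => hs.memW22.memLp_weakLaplacian)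
    h.mem_deriv.memW22.memLp_weakLaplacian ?_
  refine tendsto_of_tendsto_of_tendsto_of_le_of_le' tendsto_const_nhds h.tendsto
    (Eventually.of_forall fun _ => bot_le) ?_
  filter_upwards [h.eventually_mem.filter_mono nhdsWithin_le_nhds] with s hs
  have ht := h.eventually_mem.self_of_nhds
  have hD := ((hs.memW22.sub ht.memW22).const_smul (s - t)⁻¹).sub h.mem_deriv.memW22
  refine le_trans (le_of_eq (eLpNorm_congr_ae ?_))
    ((eLpNorm_weakLaplacian_le hD).trans (normW22_le_normEnergySpace _))
  filter_upwards [(((hs.memW22.isJet.sub ht.memW22.isJet).const_smul (s - t)⁻¹).sub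
    h.mem_deriv.memW22.isJet).weakLaplacian_ae_eq] with x hx
  rw [hx]
  simp only [weakLaplacian, Finset.sum_sub_distrib, ← Finset.smul_sum]

theorem HasEnergySpaceDerivAt.hasDerivAt_weakPartial {U : ℝ → Euc m → F} {V : Euc m → F}
    {t : ℝ} (h : HasEnergySpaceDerivAt U V t) (i : Fin m) :
    HasDerivAt (fun s => toLpOrZero 4 (weakPartial i (U s))) (toLpOrZero 4 (weakPartial i V)) t := by
  refine hasDerivAt_toLpOrZero (h.eventually_mem.mono fun s hs => hs.memLp_four i)
    (h.mem_deriv.memLp_four i) ?_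
  refine tendsto_of_tendsto_of_tendsto_of_le_of_le' tendsto_const_nhds h.tendsto
    (Eventually.of_forall fun _ => bot_le) ?_
  filter_upwards [h.eventually_mem.filter_mono nhdsWithin_le_nhds] with s hs
  have ht := h.eventually_mem.self_of_nhds
  refine le_trans (le_of_eq (eLpNorm_congr_ae ?_)) (eLpNorm_weakPartial_four_le _ i)
  exact ((((hs.memW22.isJet.sub ht.memW22.isJet).const_smul (s - t)⁻¹).sub
    h.mem_deriv.memW22.isJet).weakPartial_ae_eq i).symm

/-- The bounded bilinear map `L⁴ × L⁴ → L²` induced by the inner product. -/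
noncomputable def innerL4 : Lp F 4 (ballMeasure m) →L[ℝ] Lp F 4 (ballMeasure m) →L[ℝ]
    Lp ℝ 2 (ballMeasure m) :=
  ContinuousLinearMap.holderL (ballMeasure m) 4 4 2 (innerSL ℝ)

omit [CompleteSpace F] in
theorem coeFn_innerL4 {f g : Euc m → F} (hf : MemLp f 4 (ballMeasure m))
    (hg : MemLp g 4 (ballMeasure m)) :
    innerL4 (toLpOrZero 4 f) (toLpOrZero 4 g) =ᵐ[ballMeasure m]
      fun x => (inner ℝ (f x) (g x) : ℝ) := by
  have h := ContinuousLinearMap.coeFn_holder (r := 2) (innerSL ℝ : F →L[ℝ] F →L[ℝ] ℝ)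
    (toLpOrZero 4 f : Lp F 4 (ballMeasure m)) (toLpOrZero 4 g : Lp F 4 (ballMeasure m))
  filter_upwards [h, coeFn_toLpOrZero hf, coeFn_toLpOrZero hg] with x h1 h2 h3
  rw [h2, h3] at h1
  exact h1

omit [CompleteSpace F] in
theorem integrable_inner {f g : Euc m → F} (hf : MemLp f 2 (ballMeasure m))
    (hg : MemLp g 2 (ballMeasure m)) :
    Integrable (fun x => (inner ℝ (f x) (g x) : ℝ)) (ballMeasure m) :=
  (hf.norm.integrable_mul hg.norm).mono' (hf.1.inner hg.1)
    (Eventually.of_forall fun _ => norm_inner_le_norm _ _)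

omit [CompleteSpace F] in
theorem inner_toLpOrZero {f g : Euc m → F} (hf : MemLp f 2 (ballMeasure m))
    (hg : MemLp g 2 (ballMeasure m)) :
    (inner ℝ (toLpOrZero 2 f) (toLpOrZero 2 g) : ℝ)
      = ∫ x in unitBall m, (inner ℝ (f x) (g x) : ℝ) := by
  rw [L2.inner_def]
  refine integral_congr_ae ?_
  filter_upwards [coeFn_toLpOrZero hf, coeFn_toLpOrZero hg] with x h1 h2
  rw [h1, h2]

/-- `∑ ⟨∂_i f, ∂_i g⟩` as an element of `L²(B^m)`, for `f, g ∈ W^{1,4}`. -/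
noncomputable def gradPairing (f g : Euc m → F) : Lp ℝ 2 (ballMeasure m) :=
  ∑ i, innerL4 (toLpOrZero 4 (weakPartial i f)) (toLpOrZero 4 (weakPartial i g))

omit [CompleteSpace F] in
theorem coeFn_gradPairing {f g : Euc m → F} (hf : MemEnergySpace f) (hg : MemEnergySpace g) :
    gradPairing f g =ᵐ[ballMeasure m]
      fun x => ∑ i, (inner ℝ (weakPartial i f x) (weakPartial i g x) : ℝ) := by
  have h1 : gradPairing f g =ᵐ[ballMeasure m] fun x => ∑ i,
      innerL4 (toLpOrZero 4 (weakPartial i f)) (toLpOrZero 4 (weakPartial i g)) x :=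
    Lp.coeFn_fun_finsetSum _ _
  filter_upwards [h1, eventually_all.2 fun i => coeFn_innerL4 (hf.memLp_four i) (hg.memLp_four i)]
    with x hx h2
  rw [hx]
  exact Finset.sum_congr rfl fun i _ => h2 i

omit [CompleteSpace F] in
theorem integrable_gradPairing_mul {f g f' g' : Euc m → F} (hf : MemEnergySpace f)
    (hg : MemEnergySpace g) (hf' : MemEnergySpace f') (hg' : MemEnergySpace g') :
    Integrable (fun x => (∑ i, (inner ℝ (weakPartial i f x) (weakPartial i g x) : ℝ))
      * ∑ i, (inner ℝ (weakPartial i f' x) (weakPartial i g' x) : ℝ)) (ballMeasure m) :=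
  ((Lp.memLp (gradPairing f g)).ae_eq (coeFn_gradPairing hf hg)).integrable_mul
    ((Lp.memLp (gradPairing f' g')).ae_eq (coeFn_gradPairing hf' hg'))

omit [CompleteSpace F] in
theorem inner_gradPairing {f g f' g' : Euc m → F} (hf : MemEnergySpace f)
    (hg : MemEnergySpace g) (hf' : MemEnergySpace f') (hg' : MemEnergySpace g') :
    (inner ℝ (gradPairing f g) (gradPairing f' g') : ℝ)
      = ∫ x in unitBall m, (∑ i, (inner ℝ (weakPartial i f x) (weakPartial i g x) : ℝ))
        * ∑ i, (inner ℝ (weakPartial i f' x) (weakPartial i g' x) : ℝ) := by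
  rw [L2.inner_def]
  refine integral_congr_ae ?_
  filter_upwards [coeFn_gradPairing hf hg, coeFn_gradPairing hf' hg'] with x h1 h2
  rw [h1, h2]
  simp [mul_comm]

omit [CompleteSpace F] in
theorem gradPairing_comm {f g : Euc m → F} (hf : MemEnergySpace f) (hg : MemEnergySpace g) :
    gradPairing f g = gradPairing g f := by
  refine Lp.ext ?_
  filter_upwards [coeFn_gradPairing hf hg, coeFn_gradPairing hg hf] with x h1 h2
  rw [h1, h2]
  simp only [real_inner_comm]

theorem HasEnergySpaceDerivAt.hasDerivAt_gradPairing {U U' : ℝ → Euc m → F} {V V' : Euc m → F}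
    {t : ℝ} (h : HasEnergySpaceDerivAt U V t) (h' : HasEnergySpaceDerivAt U' V' t) :
    HasDerivAt (fun s => gradPairing (U s) (U' s))
      (gradPairing (U t) V' + gradPairing V (U' t)) t := by
  simp only [gradPairing, ← Finset.sum_add_distrib]
  refine HasDerivAt.fun_sum fun i _ => ?_
  have h1 := h.hasDerivAt_weakPartial i
  have h2 := h'.hasDerivAt_weakPartial i
  -- only the bilinearity of `innerL4` matters
  generalize (innerL4 : Lp F 4 (ballMeasure m) →L[ℝ] Lp F 4 (ballMeasure m) →L[ℝ]
    Lp ℝ 2 (ballMeasure m)) = B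
  exact B.hasDerivAt_of_bilinear (fun _ => h1) (fun _ => h2)

omit [CompleteSpace F] in
theorem bienergy_eq {u : Euc m → F} (hu : MemEnergySpace u) :
    bienergy u = 1 / 2 * ((inner ℝ (toLpOrZero 2 (weakLaplacian u))
      (toLpOrZero 2 (weakLaplacian u)) : ℝ)
        - (inner ℝ (gradPairing u u) (gradPairing u u) : ℝ)) := by
  have h2 := hu.memW22.memLp_weakLaplacian
  rw [inner_toLpOrZero h2 h2, inner_gradPairing hu hu hu hu,
    ← integral_sub (integrable_inner h2 h2) (integrable_gradPairing_mul hu hu hu hu), bienergy]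
  simp only [real_inner_self_eq_norm_sq, gradNormSq, sq]

/-- The bienergy is twice differentiable along curves in `W^{2,2} ∩ W^{1,4}` that are twice
differentiable at `0`, and its second derivative is given by the second variation formula. -/
theorem bienergy_secondVariation {U V : ℝ → Euc m → F} {W : Euc m → F}
    (hU : ∀ᶠ t in 𝓝 (0 : ℝ), HasEnergySpaceDerivAt U (V t) t)
    (hV : HasEnergySpaceDerivAt V W 0) :
    (∀ᶠ t in 𝓝 (0 : ℝ), DifferentiableAt ℝ (fun s => bienergy (U s)) t) ∧
    HasDerivAt (deriv (fun s => bienergy (U s)))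
      ((∫ x in unitBall m, ‖weakLaplacian (V 0) x‖ ^ 2)
        - 4 * (∫ x in unitBall m,
            (∑ i, (inner ℝ (weakPartial i (U 0) x) (weakPartial i (V 0) x) : ℝ)) ^ 2)
        - 2 * (∫ x in unitBall m, gradNormSq (U 0) x * gradNormSq (V 0) x)
        + ((∫ x in unitBall m, (inner ℝ (weakLaplacian (U 0) x) (weakLaplacian W x) : ℝ))
        - 2 * (∫ x in unitBall m, gradNormSq (U 0) x *
            ∑ i, (inner ℝ (weakPartial i (U 0) x) (weakPartial i W x) : ℝ)))) 0 := by
  have hfirst : ∀ᶠ t in 𝓝 (0 : ℝ), HasDerivAt (fun s => bienergy (U s))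
      ((inner ℝ (toLpOrZero 2 (weakLaplacian (U t))) (toLpOrZero 2 (weakLaplacian (V t))) : ℝ)
        - 2 * (inner ℝ (gradPairing (U t) (U t)) (gradPairing (U t) (V t)) : ℝ)) t := by
    filter_upwards [hU] with t ht
    have hUt := ht.eventually_mem.self_of_nhds
    have h1 := ht.hasDerivAt_weakLaplacian
    have h2 := ht.hasDerivAt_gradPairing ht
    have h3 := ((h1.inner ℝ h1).sub (h2.inner ℝ h2)).const_mul (1 / 2)
    refine (h3.congr_of_eventuallyEq ?_).congr_deriv ?_
    · filter_upwards [ht.eventually_mem] with s hs using bienergy_eq hs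
    · rw [gradPairing_comm ht.mem_deriv hUt, real_inner_comm (toLpOrZero 2 (weakLaplacian (U t))),
        real_inner_comm (gradPairing (U t) (U t)), inner_add_right]
      ring
  refine ⟨hfirst.mono fun t ht => ht.differentiableAt, ?_⟩
  have hU0 := hU.self_of_nhds
  have mU := hU0.eventually_mem.self_of_nhds
  have mV := hU0.mem_deriv
  have mW := hV.mem_deriv
  have h1 := hU0.hasDerivAt_weakLaplacian
  have h2 := hV.hasDerivAt_weakLaplacian
  have h3 := hU0.hasDerivAt_gradPairing hU0
  have h4 := hU0.hasDerivAt_gradPairing hV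
  have h5 := (h1.inner ℝ h2).sub ((h3.inner ℝ h4).const_mul 2)
  refine (h5.congr_of_eventuallyEq (hfirst.mono fun t ht => ht.deriv)).congr_deriv ?_
  rw [gradPairing_comm mV mU]
  simp only [inner_add_left, inner_add_right]
  rw [inner_toLpOrZero mU.memW22.memLp_weakLaplacian mW.memW22.memLp_weakLaplacian,
    inner_toLpOrZero mV.memW22.memLp_weakLaplacian mV.memW22.memLp_weakLaplacian,
    inner_gradPairing mU mU mU mW, inner_gradPairing mU mU mV mV, inner_gradPairing mU mV mU mV]
  simp only [real_inner_self_eq_norm_sq, gradNormSq, ← sq]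
  ring

end SecondVariation

/-! ### Hardy–Rellich and Poincaré inequalities on `W_0^{2,2}` -/

section Limits

variable {m : ℕ} {F : Type*} [NormedAddCommGroup F] [InnerProductSpace ℝ F]

theorem tendsto_toLpOrZero {E : Type*} [NormedAddCommGroup E] {f : ℕ → Euc m → E} {g : Euc m → E}
    (hf : ∀ n, MemLp (f n) 2 (ballMeasure m)) (hg : MemLp g 2 (ballMeasure m))
    (hlim : Tendsto (fun n => eLpNorm (fun x => g x - f n x) 2 (ballMeasure m)) atTop (𝓝 0)) :
    Tendsto (fun n => toLpOrZero 2 (f n)) atTop (𝓝 (toLpOrZero 2 g)) := by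
  simp only [toLpOrZero_of_memLp hg, fun n => toLpOrZero_of_memLp (hf n)]
  rw [Lp.tendsto_Lp_iff_tendsto_eLpNorm'' f hf g hg]
  refine hlim.congr fun n => ?_
  rw [eLpNorm_sub_comm]
  rfl

theorem tendsto_integral_inner {f g : ℕ → Euc m → F} {f' g' : Euc m → F}
    (hf : ∀ n, MemLp (f n) 2 (ballMeasure m)) (hf' : MemLp f' 2 (ballMeasure m))
    (hflim : Tendsto (fun n => eLpNorm (fun x => f' x - f n x) 2 (ballMeasure m)) atTop (𝓝 0))
    (hg : ∀ n, MemLp (g n) 2 (ballMeasure m)) (hg' : MemLp g' 2 (ballMeasure m))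
    (hglim : Tendsto (fun n => eLpNorm (fun x => g' x - g n x) 2 (ballMeasure m)) atTop (𝓝 0)) :
    Tendsto (fun n => ∫ x in unitBall m, (inner ℝ (f n x) (g n x) : ℝ)) atTop
      (𝓝 (∫ x in unitBall m, (inner ℝ (f' x) (g' x) : ℝ))) := by
  have h := (tendsto_toLpOrZero hf hf' hflim).inner (𝕜 := ℝ) (tendsto_toLpOrZero hg hg' hglim)
  rw [inner_toLpOrZero hf' hg'] at h
  exact h.congr fun n => inner_toLpOrZero (hf n) (hg n)

theorem tendsto_integral_inner_const {g : ℕ → Euc m → F} {f g' : Euc m → F}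
    (hf : MemLp f 2 (ballMeasure m))
    (hg : ∀ n, MemLp (g n) 2 (ballMeasure m)) (hg' : MemLp g' 2 (ballMeasure m))
    (hglim : Tendsto (fun n => eLpNorm (fun x => g' x - g n x) 2 (ballMeasure m)) atTop (𝓝 0)) :
    Tendsto (fun n => ∫ x in unitBall m, (inner ℝ (f x) (g n x) : ℝ)) atTop
      (𝓝 (∫ x in unitBall m, (inner ℝ (f x) (g' x) : ℝ))) :=
  tendsto_integral_inner (fun _ => hf) hf (by simp) hg hg' hglim

theorem tendsto_integral_norm_sq {f : ℕ → Euc m → F} {f' : Euc m → F}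
    (hf : ∀ n, MemLp (f n) 2 (ballMeasure m)) (hf' : MemLp f' 2 (ballMeasure m))
    (hflim : Tendsto (fun n => eLpNorm (fun x => f' x - f n x) 2 (ballMeasure m)) atTop (𝓝 0)) :
    Tendsto (fun n => ∫ x in unitBall m, ‖f n x‖ ^ 2) atTop
      (𝓝 (∫ x in unitBall m, ‖f' x‖ ^ 2)) := by
  simpa only [real_inner_self_eq_norm_sq] using tendsto_integral_inner hf hf' hflim hf hf' hflim

theorem memLp_weight_smul {f : Euc m → F} (hf : MemLp f 2 (ballMeasure m)) {a : Euc m → ℝ}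
    (ha : Continuous a) {C : ℝ} (hC : ∀ x, ‖a x‖ ≤ C) :
    MemLp (fun x => a x • f x) 2 (ballMeasure m) :=
  hf.of_le_mul (ha.aestronglyMeasurable.smul hf.1) (Eventually.of_forall fun x => by
    rw [norm_smul]
    exact mul_le_mul_of_nonneg_right (hC x) (norm_nonneg _))

theorem tendsto_integral_weight_norm_sq {f : ℕ → Euc m → F} {f' : Euc m → F}
    (hf : ∀ n, MemLp (f n) 2 (ballMeasure m)) (hf' : MemLp f' 2 (ballMeasure m))
    (hflim : Tendsto (fun n => eLpNorm (fun x => f' x - f n x) 2 (ballMeasure m)) atTop (𝓝 0))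
    {a : Euc m → ℝ} (ha : Continuous a) {C : ℝ} (hC : ∀ x, ‖a x‖ ≤ C) :
    Tendsto (fun n => ∫ x in unitBall m, a x * ‖f n x‖ ^ 2) atTop
      (𝓝 (∫ x in unitBall m, a x * ‖f' x‖ ^ 2)) := by
  have h1 : Tendsto (fun n => eLpNorm (fun x => a x • f' x - a x • f n x) 2 (ballMeasure m))
      atTop (𝓝 0) := by
    have h0 : Tendsto (fun n => ENNReal.ofReal C *
        eLpNorm (fun x => f' x - f n x) 2 (ballMeasure m)) atTop (𝓝 0) := by
      simpa using ENNReal.Tendsto.const_mul hflim (Or.inr (by simp : ENNReal.ofReal C ≠ ⊤))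
    refine tendsto_of_tendsto_of_tendsto_of_le_of_le tendsto_const_nhds h0
      (fun _ => bot_le) fun n => ?_
    refine eLpNorm_le_mul_eLpNorm_of_ae_le_mul (Eventually.of_forall fun x => ?_) 2
    rw [← smul_sub, norm_smul]
    exact mul_le_mul_of_nonneg_right (hC x) (norm_nonneg _)
  have h2 := tendsto_integral_inner (fun n => memLp_weight_smul (hf n) ha hC)
    (memLp_weight_smul hf' ha hC) h1 hf hf' hflim
  simpa only [real_inner_smul_left, real_inner_self_eq_norm_sq] using h2

theorem integrable_norm_sq {f : Euc m → F} (hf : MemLp f 2 (ballMeasure m)) :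
    Integrable (fun x => ‖f x‖ ^ 2) (ballMeasure m) := by
  simpa only [real_inner_self_eq_norm_sq] using integrable_inner hf hf

theorem integrable_weight_norm_sq {f : Euc m → F} (hf : MemLp f 2 (ballMeasure m)) {a : Euc m → ℝ}
    (ha : Continuous a) {C : ℝ} (hC : ∀ x, ‖a x‖ ≤ C) :
    Integrable (fun x => a x * ‖f x‖ ^ 2) (ballMeasure m) := by
  simpa only [real_inner_smul_left, real_inner_self_eq_norm_sq] using
    integrable_inner (memLp_weight_smul hf ha hC) hf

theorem IsTest.memLp (hm : 0 < m) {φ : Euc m → F} (hφ : IsTest φ) :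
    MemLp φ 2 (ballMeasure m) := (hφ.hasPole 0).memLp (p := 2) (by simp) (by omega)

theorem IsTest.laplacian {φ : Euc m → F} (hφ : IsTest φ) : IsTest (laplacian φ) where
  smooth := ContDiff.sum fun _ _ => hφ.deriv.deriv.smooth
  compact := hφ.compact.of_isClosed_subset (isClosed_tsupport _)
    (closure_minimal (fun x hx => by
      by_contra hn
      refine hx (Finset.sum_eq_zero fun i _ => ?_)
      exact partialDeriv_eq_zero_of_notMem_tsupport
        fun h => hn (tsupport_fderiv_apply_subset ℝ _ h)) (isClosed_tsupport φ))
  support_subset := (closure_minimal (fun x hx => by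
      by_contra hn
      refine hx (Finset.sum_eq_zero fun i _ => ?_)
      exact partialDeriv_eq_zero_of_notMem_tsupport
        fun h => hn (tsupport_fderiv_apply_subset ℝ _ h)) (isClosed_tsupport φ)).trans
      hφ.support_subset

variable [CompleteSpace F]

/-- Elements of `W_0^{2,2}` are approximated by test functions, together with their gradients and
Laplacians, in `L²`. -/
theorem MemW22Zero.exists_approx (hm : 4 < m) {f : Euc m → F} (hf : MemW22Zero f) :
    ∃ φ : ℕ → Euc m → F, (∀ n, IsTest (φ n)) ∧
      Tendsto (fun n => eLpNorm (fun x => f x - φ n x) 2 (ballMeasure m)) atTop (𝓝 0) ∧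
      (∀ i, Tendsto (fun n => eLpNorm (fun x => weakPartial i f x - partialDeriv i (φ n) x) 2
        (ballMeasure m)) atTop (𝓝 0)) ∧
      Tendsto (fun n => eLpNorm (fun x => weakLaplacian f x - laplacian (φ n) x) 2
        (ballMeasure m)) atTop (𝓝 0) := by
  obtain ⟨φ, hφ, hlim⟩ := hf.approx
  have hj : ∀ n, IsJet (fun x => f x - φ n x) _ _ := fun n =>
    hf.memW22.isJet.sub (((hφ n).hasPole 2).isJet (by omega))
  have squeeze : ∀ {g : ℕ → ENNReal}, (∀ n, g n ≤ normW22 (fun x => f x - φ n x)) →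
      Tendsto g atTop (𝓝 0) := fun h =>
    tendsto_of_tendsto_of_tendsto_of_le_of_le tendsto_const_nhds hlim (fun _ => bot_le) h
  refine ⟨φ, hφ, squeeze fun n => eLpNorm_le_normW22 _, fun i => squeeze fun n => ?_,
    squeeze fun n => ?_⟩
  · exact (eLpNorm_congr_ae ((hj n).weakPartial_ae_eq i)).symm.le.trans (eLpNorm_weakPartial_le _ i)
  · refine le_trans (le_of_eq (eLpNorm_congr_ae ?_))
      (eLpNorm_weakLaplacian_le (hf.memW22.sub ((hφ n).memW22 hm)))
    filter_upwards [(hj n).weakLaplacian_ae_eq] with x hx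
    rw [hx]
    simp only [weakLaplacian, laplacian, Finset.sum_sub_distrib]

theorem MemW22Zero.poincare (hm : 4 < m) {f : Euc m → F} (hf : MemW22Zero f) :
    (m - 1 : ℝ) * ∫ x in unitBall m, ‖f x‖ ^ 2 ≤ ∫ x in unitBall m, gradNormSq f x := by
  obtain ⟨φ, hφ, h0, h1, -⟩ := hf.exists_approx hm
  have hlim0 := (tendsto_integral_norm_sq (fun n => (hφ n).memLp (by omega))
    hf.memW22.memLp h0).const_mul (m - 1 : ℝ)
  have hlim1 := tendsto_finsetSum Finset.univ fun i _ =>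
    tendsto_integral_norm_sq (fun n => (hφ n).deriv.memLp (by omega))
      (hf.memW22.memLp_partial i) (h1 i)
  have hsum : ∫ x in unitBall m, gradNormSq f x
      = ∑ i, ∫ x in unitBall m, ‖weakPartial i f x‖ ^ 2 :=
    integral_finsetSum _ fun i _ => integrable_norm_sq (hf.memW22.memLp_partial i)
  rw [hsum]
  refine le_of_tendsto_of_tendsto' hlim0 hlim1 fun n => ?_
  refine ((hφ n).poincare (by omega)).trans_eq ?_
  exact integral_finsetSum _ fun i _ => integrable_norm_sq ((hφ n).deriv.memLp (by omega))

theorem MemW22Zero.hardyRellich_regularised {ε α : ℝ} (hε : 0 < ε) (hα : 4 ≤ α) (hm : 4 < m)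
    {f : Euc m → F} (hf : MemW22Zero f) :
    (α * m - α ^ 2) * ∫ x in unitBall m, (‖x‖ ^ 2 + ε)⁻¹ * gradNormSq f x
      ≤ ∫ x in unitBall m, ‖weakLaplacian f x‖ ^ 2 := by
  obtain ⟨φ, hφ, -, h1, h2⟩ := hf.exists_approx hm
  have hw : Continuous fun x : Euc m => (‖x‖ ^ 2 + ε)⁻¹ := (contDiff_weight hε).continuous
  have hwC : ∀ x : Euc m, ‖(‖x‖ ^ 2 + ε)⁻¹‖ ≤ ε⁻¹ := fun x => by
    rw [Real.norm_of_nonneg (by positivity)]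
    gcongr
    nlinarith [norm_nonneg x]
  have hlim1 := (tendsto_finsetSum Finset.univ fun i _ =>
    tendsto_integral_weight_norm_sq (fun n => (hφ n).deriv.memLp (by omega))
      (hf.memW22.memLp_partial i) (h1 i) hw hwC).const_mul (α * m - α ^ 2)
  have hlim2 := tendsto_integral_norm_sq (fun n => (hφ n).laplacian.memLp (by omega))
    hf.memW22.memLp_weakLaplacian h2
  have hsum : ∫ x in unitBall m, (‖x‖ ^ 2 + ε)⁻¹ * gradNormSq f x
      = ∑ i, ∫ x in unitBall m, (‖x‖ ^ 2 + ε)⁻¹ * ‖weakPartial i f x‖ ^ 2 := by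
    simp only [gradNormSq, Finset.mul_sum]
    exact integral_finsetSum _ fun i _ =>
      integrable_weight_norm_sq (hf.memW22.memLp_partial i) hw hwC
  rw [hsum]
  refine le_of_tendsto_of_tendsto' hlim1 hlim2 fun n => ?_
  refine le_of_eq_of_le ?_ ((hφ n).hardyRellich hε hα (by omega))
  congr 1
  simp only [Finset.mul_sum]
  exact (integral_finsetSum _ fun i _ =>
      integrable_weight_norm_sq ((hφ n).deriv.memLp (by omega)) hw hwC).symm

theorem contDiffOn_norm_sq_inv : ContDiffOn ℝ ∞ (fun x : Euc m => (‖x‖ ^ 2)⁻¹) {0}ᶜ :=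
  (contDiff_norm_sq ℝ).contDiffOn.inv fun x hx => by
    have : x ≠ 0 := hx
    positivity

theorem hasPole_norm_sq_inv (n : ℕ) : HasPole n 2 (fun x : Euc m => (‖x‖ ^ 2)⁻¹) := by
  refine HasPole.of_isHomogeneous n contDiffOn_norm_sq_inv fun t ht x hx => ?_
  have : 0 < ‖x‖ := norm_pos_iff.2 hx
  rw [norm_smul, Real.norm_of_nonneg ht.le, smul_eq_mul]
  field_simp

omit [CompleteSpace F] in
theorem MemEnergySpace.memLp_gradNormSq {f : Euc m → F} (hf : MemEnergySpace f) :
    MemLp (gradNormSq f) 2 (ballMeasure m) := by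
  refine (Lp.memLp (gradPairing f f)).ae_eq ?_
  filter_upwards [coeFn_gradPairing hf hf] with x hx
  rw [hx]
  simp only [real_inner_self_eq_norm_sq, gradNormSq]

omit [CompleteSpace F] in
theorem MemEnergySpace.integrable_norm_sq_inv_mul_gradNormSq (hm : 4 < m) {f : Euc m → F}
    (hf : MemEnergySpace f) :
    Integrable (fun x => (‖x‖ ^ 2)⁻¹ * gradNormSq f x) (ballMeasure m) := by
  have h : MemLp (fun x : Euc m => (‖x‖ ^ 2)⁻¹) 2 (ballMeasure m) :=
    (hasPole_norm_sq_inv 0).memLp (p := 2) (by simp) (by omega)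
  exact h.integrable_mul hf.memLp_gradNormSq

/-- The Hardy–Rellich inequality `(m² / 4) ∫ |∇f|² / |x|² ≤ ∫ |Δf|²`. -/
theorem MemW22Zero.hardyRellich (hm : 8 ≤ m) {f : Euc m → F} (hf : MemW22Zero f)
    (hf' : MemEnergySpace f) :
    (m : ℝ) ^ 2 / 4 * ∫ x in unitBall m, (‖x‖ ^ 2)⁻¹ * gradNormSq f x
      ≤ ∫ x in unitBall m, ‖weakLaplacian f x‖ ^ 2 := by
  have hm' : (8 : ℝ) ≤ m := by exact_mod_cast hm
  have hε : ∀ n : ℕ, (0 : ℝ) < 1 / ((n : ℝ) + 1) := fun n => by positivity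
  have hg0 : ∀ x, 0 ≤ gradNormSq f x := fun x => Finset.sum_nonneg fun i _ => by positivity
  have hlim : Tendsto (fun n : ℕ => ∫ x in unitBall m,
      (‖x‖ ^ 2 + 1 / ((n : ℝ) + 1))⁻¹ * gradNormSq f x) atTop
      (𝓝 (∫ x in unitBall m, (‖x‖ ^ 2)⁻¹ * gradNormSq f x)) := by
    refine tendsto_integral_of_dominated_convergence _ (fun n => ?_)
      (hf'.integrable_norm_sq_inv_mul_gradNormSq (by omega)) (fun n => ?_) ?_
    · exact (contDiff_weight (hε n)).continuous.aestronglyMeasurable.mul hf'.memLp_gradNormSq.1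
    · filter_upwards [ae_ball_ne_zero (by omega : 0 < m)] with x hx
      have hx0 : 0 < ‖x‖ := norm_pos_iff.2 hx.1
      have := hε n
      rw [Real.norm_of_nonneg (mul_nonneg (by positivity) (hg0 x))]
      refine mul_le_mul_of_nonneg_right ?_ (hg0 x)
      exact inv_anti₀ (by positivity) (by linarith)
    · filter_upwards [ae_ball_ne_zero (by omega : 0 < m)] with x hx
      have hx0 : 0 < ‖x‖ := norm_pos_iff.2 hx.1
      have h1 : Tendsto (fun n : ℕ => ‖x‖ ^ 2 + 1 / ((n : ℝ) + 1)) atTop (𝓝 (‖x‖ ^ 2 + 0)) :=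
        tendsto_const_nhds.add tendsto_one_div_add_atTop_nhds_zero_nat
      rw [add_zero] at h1
      exact (h1.inv₀ (by positivity)).mul_const _
  refine le_of_tendsto (hlim.const_mul _) (Eventually.of_forall fun n => ?_)
  have h := hf.hardyRellich_regularised (hε n) (α := m / 2) (by linarith) (by omega)
  have he : (m : ℝ) / 2 * m - (m / 2) ^ 2 = m ^ 2 / 4 := by ring
  rwa [he] at h

end Limits

/-! ### Critical points of the bienergy built from eigenmaps -/

section Profiles

variable {m : ℕ} {F : Type*} [NormedAddCommGroup F] [InnerProductSpace ℝ F]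

/-- A map `q` into the unit sphere of `F`, homogeneous of degree `0`, such that `q - e` is an
eigenmap, `Δq = -lam |x|⁻² (q - e)`, with energy density `|∇q|² = κ |x|⁻²`. The relation between
`lam`, `κ` and `m` says that `Δ²q + 2 div(|∇q|² ∇q) = 0` away from the origin. -/
structure IsProfile (q : Euc m → F) (e : F) (lam κ : ℝ) : Prop where
  smooth : ContDiffOn ℝ ∞ q {0}ᶜ
  homogeneous : IsHomogeneous 0 q
  norm_eq_one : ∀ x, x ≠ 0 → ‖q x‖ = 1
  laplacian_eq : ∀ x, x ≠ 0 → laplacian q x = -(lam * (‖x‖ ^ 2)⁻¹) • (q x - e)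
  grad_eq : ∀ x, x ≠ 0 → ∑ i, ‖partialDeriv i q x‖ ^ 2 = κ * (‖x‖ ^ 2)⁻¹
  balance : 2 * κ = lam + 2 * m - 8

theorem partialDeriv_norm_sq_inv (i : Fin m) {x : Euc m} (hx : x ≠ 0) :
    partialDeriv i (fun x : Euc m => (‖x‖ ^ 2)⁻¹) x = -2 * x i * ((‖x‖ ^ 2)⁻¹) ^ 2 := by
  have hx0 : ‖x‖ ^ 2 ≠ 0 := by positivity
  have hn : HasFDerivAt (fun y : Euc m => ‖y‖ ^ 2) (2 • (innerSL ℝ x)) x :=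
    (hasStrictFDerivAt_norm_sq x).hasFDerivAt
  have hd := (hasDerivAt_inv hx0).comp_hasFDerivAt x hn
  have he : partialDeriv i (fun x : Euc m => (‖x‖ ^ 2)⁻¹) x = _ :=
    congrArg (fun L => L (EuclideanSpace.single i 1)) hd.fderiv
  rw [he]
  simp [EuclideanSpace.inner_single_right]
  ring

/-- Euler's relation for functions that are homogeneous of degree `-k`. -/
theorem IsHomogeneous.euler {G : Type*} [NormedAddCommGroup G] [NormedSpace ℝ G] {k : ℕ}
    {f : Euc m → G} (hf : IsHomogeneous k f) {x : Euc m} (hx : x ≠ 0)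
    (hd : DifferentiableAt ℝ f x) :
    ∑ i, x i • Biharmonic.partialDeriv i f x = -(k : ℝ) • f x := by
  rw [sum_coord_smul_partialDeriv]
  have h1 : HasDerivAt (fun t : ℝ => t ^ k • f (t • x)) (fderiv ℝ f x x + (k : ℝ) • f x) 1 := by
    have h2 : HasDerivAt (fun t : ℝ => t • x) ((1 : ℝ) • x) 1 := (hasDerivAt_id 1).smul_const x
    have h3 : HasFDerivAt f (fderiv ℝ f x) ((1 : ℝ) • x) := by
      rw [one_smul]
      exact hd.hasFDerivAt
    have h5 := (hasDerivAt_pow k (1 : ℝ)).fun_smul (h3.comp_hasDerivAt 1 h2)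
    simpa using h5
  have h4 : (fun t : ℝ => t ^ k • f (t • x)) =ᶠ[𝓝 1] fun _ => f x := by
    filter_upwards [lt_mem_nhds (zero_lt_one (α := ℝ))] with t ht
    exact hf t ht x hx
  have h6 := h1.unique ((hasDerivAt_const (1 : ℝ) (f x)).congr_of_eventuallyEq h4)
  rw [neg_smul]
  exact eq_neg_of_add_eq_zero_left h6

variable {q : Euc m → F} {e : F} {lam κ : ℝ}

theorem IsProfile.hasPole (hq : IsProfile q e lam κ) (n : ℕ) : HasPole n 0 q :=
  HasPole.of_isHomogeneous n hq.smooth hq.homogeneous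

theorem IsProfile.inner_partialDeriv (hq : IsProfile q e lam κ) (i : Fin m) {x : Euc m}
    (hx : x ≠ 0) : (inner ℝ (q x) (partialDeriv i q x) : ℝ) = 0 := by
  have hd := (hq.hasPole 0).differentiableAt hx
  have h1 := partialDeriv_inner (i := i) hd hd
  have h2 : partialDeriv i (fun y => (inner ℝ (q y) (q y) : ℝ)) x = 0 := by
    rw [partialDeriv_congr (g := fun _ => (1 : ℝ)), partialDeriv_const]
    filter_upwards [isOpen_compl_zero.mem_nhds hx] with y hy
    rw [real_inner_self_eq_norm_sq, hq.norm_eq_one y hy, one_pow]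
  rw [h2, real_inner_comm (partialDeriv i q x)] at h1
  rw [real_inner_comm]
  linarith

/-- The vector field whose divergence is `⟨Δq, Δψ⟩ - 2|∇q|² ⟨∇q, ∇ψ⟩`. -/
noncomputable def greenField (q : Euc m → F) (e : F) (lam κ : ℝ) (ψ : Euc m → F) (i : Fin m)
    (y : Euc m) : ℝ :=
  -lam * ((‖y‖ ^ 2)⁻¹ * (inner ℝ (q y - e) (partialDeriv i ψ y) : ℝ))
    + (lam - 2 * κ) * ((‖y‖ ^ 2)⁻¹ * (inner ℝ (partialDeriv i q y) (ψ y) : ℝ))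
    - 2 * lam * ((‖y‖ ^ 2)⁻¹ * ((‖y‖ ^ 2)⁻¹ * (y i * (inner ℝ (q y - e) (ψ y) : ℝ))))

theorem IsProfile.hasPole_sub (hq : IsProfile q e lam κ) (n : ℕ) :
    HasPole n 0 (fun y => q y - e) :=
  (hq.hasPole n).sub (HasPole.of_contDiff n 0 contDiff_const)

theorem IsProfile.hasPole_greenField (hq : IsProfile q e lam κ) {ψ : Euc m → F}
    (hψ : HasPole 2 0 ψ) (i : Fin m) : HasPole 1 4 (greenField q e lam κ ψ i) := by
  have hρ := hasPole_norm_sq_inv (m := m) 1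
  have h1 : HasPole 1 3 fun y => (‖y‖ ^ 2)⁻¹ * (inner ℝ (q y - e) (partialDeriv i ψ y) : ℝ) :=
    hρ.smul ((hq.hasPole_sub 1).inner (hψ.2 i))
  have h2 : HasPole 1 3 fun y => (‖y‖ ^ 2)⁻¹ * (inner ℝ (partialDeriv i q y) (ψ y) : ℝ) :=
    hρ.smul (((hq.hasPole 2).2 i).inner hψ.pred)
  have h3 : HasPole 1 4 fun y => (‖y‖ ^ 2)⁻¹ * ((‖y‖ ^ 2)⁻¹ *
      (y i * (inner ℝ (q y - e) (ψ y) : ℝ))) :=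
    hρ.smul (hρ.smul ((HasPole.of_contDiff 1 0 (contDiff_coord i)).smul
      ((hq.hasPole_sub 1).inner hψ.pred)))
  exact (((h1.const_smul (-lam)).add (h2.const_smul (lam - 2 * κ))).succ_order).sub
    (h3.const_smul (2 * lam))

/-- The divergence of the Green field. The terms with `⟨q - e, ψ⟩ |x|⁻⁴` cancel because of
`2κ = lam + 2m - 8`; the radial derivative of `q` vanishes. -/
theorem IsProfile.sum_partialDeriv_greenField (hq : IsProfile q e lam κ) {ψ : Euc m → F}
    (hψ : HasPole 2 0 ψ) {x : Euc m} (hx : x ≠ 0) :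
    ∑ i, partialDeriv i (greenField q e lam κ ψ i) x
      = (inner ℝ (laplacian q x) (laplacian ψ x) : ℝ)
        - 2 * (κ * (‖x‖ ^ 2)⁻¹ * ∑ i, (inner ℝ (partialDeriv i q x) (partialDeriv i ψ x) : ℝ)) := by
  set ρ : ℝ := (‖x‖ ^ 2)⁻¹ with hρ
  have hρr : ρ * ‖x‖ ^ 2 = 1 := inv_mul_cancel₀ (by positivity)
  have dρ : DifferentiableAt ℝ (fun y : Euc m => (‖y‖ ^ 2)⁻¹) x :=
    (hasPole_norm_sq_inv 0).differentiableAt hx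
  have dq := (hq.hasPole 0).differentiableAt hx
  have dv := (hq.hasPole_sub 0).differentiableAt hx
  have dqi := fun i => (hq.hasPole 0).differentiableAt_partialDeriv i hx
  have dψ := hψ.differentiableAt hx
  have dψi := fun i => hψ.differentiableAt_partialDeriv i hx
  have dx : ∀ i : Fin m, DifferentiableAt ℝ (fun y : Euc m => y i) x := fun i =>
    (contDiff_coord i).differentiable (by simp) x
  have hv : ∀ i, partialDeriv i (fun y => q y - e) x = partialDeriv i q x := fun i => by
    rw [partialDeriv_sub dq (differentiableAt_const e), partialDeriv_const, sub_zero]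
  have hterm : ∀ i, partialDeriv i (greenField q e lam κ ψ i) x
      = -lam * (ρ * ((inner ℝ (q x - e) (partialDeriv i (partialDeriv i ψ) x) : ℝ)
            + (inner ℝ (partialDeriv i q x) (partialDeriv i ψ x) : ℝ))
          - 2 * ρ ^ 2 * (inner ℝ (q x - e) (x i • partialDeriv i ψ x) : ℝ))
        + (lam - 2 * κ) * (ρ * ((inner ℝ (partialDeriv i q x) (partialDeriv i ψ x) : ℝ)
            + (inner ℝ (partialDeriv i (partialDeriv i q) x) (ψ x) : ℝ))
          - 2 * ρ ^ 2 * (inner ℝ (x i • partialDeriv i q x) (ψ x) : ℝ))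
        - 2 * lam * (ρ ^ 2 * ((inner ℝ (q x - e) (x i • partialDeriv i ψ x) : ℝ)
            + (inner ℝ (x i • partialDeriv i q x) (ψ x) : ℝ)
            + (inner ℝ (q x - e) (ψ x) : ℝ))
          - 4 * ρ ^ 3 * x i ^ 2 * (inner ℝ (q x - e) (ψ x) : ℝ)) := by
    intro i
    have d1 := dv.inner ℝ (dψi i)
    have d2 := (dqi i).inner ℝ dψ
    have d3 := dv.inner ℝ dψ
    have e1 := dρ.fun_mul d1
    have e2 := dρ.fun_mul d2
    have e3 := (dx i).fun_mul d3
    have e4 := dρ.fun_mul e3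
    have e5 := dρ.fun_mul e4
    unfold greenField
    rw [partialDeriv_sub ((e1.const_mul _).fun_add (e2.const_mul _)) (e5.const_mul _),
      partialDeriv_add (e1.const_mul _) (e2.const_mul _),
      partialDeriv_mul (a := fun _ => -lam) (differentiableAt_const _) e1,
      partialDeriv_mul (a := fun _ => lam - 2 * κ) (differentiableAt_const _) e2,
      partialDeriv_mul (a := fun _ => 2 * lam) (differentiableAt_const _) e5,
      partialDeriv_mul dρ d1, partialDeriv_mul dρ d2, partialDeriv_mul dρ e4,
      partialDeriv_mul dρ e3, partialDeriv_mul (dx i) d3,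
      partialDeriv_inner dv (dψi i), partialDeriv_inner (dqi i) dψ, partialDeriv_inner dv dψ,
      hv, partialDeriv_norm_sq_inv i hx, partialDeriv_coord]
    simp only [partialDeriv_const, if_true, real_inner_smul_left, real_inner_smul_right, ← hρ]
    ring
  have hE : ∑ i, (inner ℝ (x i • partialDeriv i q x) (ψ x) : ℝ) = 0 := by
    rw [← sum_inner, hq.homogeneous.euler hx dq]
    simp
  have hL : ∑ i, (inner ℝ (partialDeriv i (partialDeriv i q) x) (ψ x) : ℝ)
      = -(lam * ρ) * (inner ℝ (q x - e) (ψ x) : ℝ) := by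
    rw [← sum_inner]
    have := hq.laplacian_eq x hx
    rw [laplacian] at this
    rw [this, real_inner_smul_left]
  have hL' : (inner ℝ (laplacian q x) (laplacian ψ x) : ℝ)
      = -(lam * ρ) * ∑ i, (inner ℝ (q x - e) (partialDeriv i (partialDeriv i ψ) x) : ℝ) := by
    rw [hq.laplacian_eq x hx, real_inner_smul_left, laplacian, inner_sum]
  rw [Finset.sum_congr rfl fun i _ => hterm i, hL']
  simp only [Finset.sum_add_distrib, Finset.sum_sub_distrib, ← Finset.mul_sum, ← Finset.sum_mul,
    hE, hL, sum_coord_sq, Finset.sum_const, Finset.card_univ, Fintype.card_fin, nsmul_eq_mul]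
  have hb := hq.balance
  have hκ : κ = (lam + 2 * m - 8) / 2 := by linarith
  have hρ3 : ρ ^ 3 * ‖x‖ ^ 2 = ρ ^ 2 := by rw [pow_succ, mul_assoc, hρr, mul_one]
  rw [hκ]
  linear_combination (8 * lam * (inner ℝ (q x - e) (ψ x) : ℝ)) * hρ3

/-- A profile is a critical point of the (unconstrained) bienergy: its first variation vanishes on
all fields with compact support that are as singular at the origin as the profile itself. -/
theorem IsProfile.firstVariation (hm : 5 < m) (hq : IsProfile q e lam κ) {ψ : Euc m → F}
    (hψ : HasPole 2 0 ψ) (hs : tsupport ψ ⊆ unitBall m) :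
    (∫ x in unitBall m, (inner ℝ (laplacian q x) (laplacian ψ x) : ℝ))
      - 2 * (∫ x in unitBall m, κ * (‖x‖ ^ 2)⁻¹ *
          ∑ i, (inner ℝ (partialDeriv i q x) (partialDeriv i ψ x) : ℝ)) = 0 := by
  have hMs : ∀ i, tsupport (greenField q e lam κ ψ i) ⊆ unitBall m := fun i =>
    (closure_minimal (fun x hx => by
      by_contra hn
      refine hx ?_
      simp [greenField, image_eq_zero_of_notMem_tsupport hn,
        partialDeriv_eq_zero_of_notMem_tsupport hn]) (isClosed_tsupport ψ)).trans hs
  have hM := fun i => hq.hasPole_greenField hψ i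
  have h0 : ∫ x in unitBall m, ∑ i, partialDeriv i (greenField q e lam κ ψ i) x = 0 := by
    rw [integral_finsetSum _ fun i _ => ((hM i).2 i).integrable (by omega)]
    exact Finset.sum_eq_zero fun i _ => (hM i).integral_partialDeriv_eq_zero (by omega) (hMs i) i
  have hlap : ∀ {f : Euc m → F}, HasPole 2 0 f → HasPole 0 2 (laplacian f) := fun hf =>
    HasPole.sum fun i _ => (hf.2 i).2 i
  have i1 : IntegrableOn (fun x => (inner ℝ (laplacian q x) (laplacian ψ x) : ℝ))
      (unitBall m) := ((hlap (hq.hasPole 2)).inner (hlap hψ)).integrable (by omega)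
  have i2 : IntegrableOn (fun x => κ * (‖x‖ ^ 2)⁻¹ *
      ∑ i, (inner ℝ (partialDeriv i q x) (partialDeriv i ψ x) : ℝ)) (unitBall m) := by
    have : HasPole 0 4 fun x : Euc m => κ * (‖x‖ ^ 2)⁻¹ *
        ∑ i, (inner ℝ (partialDeriv i q x) (partialDeriv i ψ x) : ℝ) :=
      ((hasPole_norm_sq_inv 0).const_smul κ).smul
        (HasPole.sum fun i _ => ((hq.hasPole 1).2 i).inner (hψ.pred.2 i))
    exact this.integrable (by omega)
  rw [← integral_const_mul, ← integral_sub i1 (i2.const_mul 2), ← h0]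
  refine integral_congr_ae ?_
  filter_upwards [ae_ball_ne_zero (by omega : 0 < m)] with x hx
  exact (hq.sum_partialDeriv_greenField hψ hx.1).symm

theorem IsProfile.isJet (hm : 5 < m) (hq : IsProfile q e lam κ) :
    IsJet q (fun i => partialDeriv i q) (fun i j => partialDeriv j (partialDeriv i q)) :=
  (hq.hasPole 2).isJet (by omega)

variable [CompleteSpace F]

theorem HasPole.weakLaplacian_ae_eq {k : ℕ} (hk : k + 2 < m) {f : Euc m → F} (hf : HasPole 2 k f) :
    weakLaplacian f =ᵐ[ballMeasure m] laplacian f :=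
  (hf.isJet hk).weakLaplacian_ae_eq

theorem IsProfile.gradNormSq_ae_eq (hm : 5 < m) (hq : IsProfile q e lam κ) :
    gradNormSq q =ᵐ[ballMeasure m] fun x => κ * (‖x‖ ^ 2)⁻¹ := by
  filter_upwards [(hq.isJet hm).gradNormSq_ae_eq, ae_ball_ne_zero (by omega : 0 < m)] with x h1 h2
  rw [h1, hq.grad_eq x h2.1]

theorem IsProfile.memW22Sphere (hm : 5 < m) (hq : IsProfile q e lam κ) : MemW22Sphere q where
  memW22 := (hq.hasPole 2).memW22 (by omega)
  norm_eq_one := by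
    filter_upwards [ae_ball_ne_zero (by omega : 0 < m)] with x hx using hq.norm_eq_one x hx.1

/-- The weak equation is the difference of the first variations in the directions `φ` and
`⟨q, φ⟩ q`; as `q` is orthogonal to its derivatives, the gradient term of the latter is
`|∇q|⁴ ⟨q, φ⟩`. -/
theorem IsProfile.isWeakBiharmonic (hm : 5 < m) (hq : IsProfile q e lam κ) :
    IsWeakBiharmonic q where
  memW22Sphere := hq.memW22Sphere hm
  equation φ hφ := by
    have hφp := hφ.hasPole 2
    have hψ : HasPole 2 0 (fun y => (inner ℝ (q y) (φ y) : ℝ) • q y) :=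
      ((hq.hasPole 2).inner hφp).smul (hq.hasPole 2)
    have hψs : tsupport (fun y => (inner ℝ (q y) (φ y) : ℝ) • q y) ⊆ unitBall m :=
      (closure_minimal (fun x hx => by
        by_contra hn
        exact hx (by simp [image_eq_zero_of_notMem_tsupport hn]))
        (isClosed_tsupport φ)).trans hφ.support_subset
    have hne := ae_ball_ne_zero (by omega : 0 < m)
    have hlap := (hq.hasPole 2).weakLaplacian_ae_eq (by omega)
    have hgrad := hq.gradNormSq_ae_eq hm
    have hpart : ∀ᵐ x ∂(ballMeasure m), ∀ i, weakPartial i q x = partialDeriv i q x :=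
      eventually_all.2 fun i => (hq.isJet hm).weakPartial_ae_eq i
    have L1 := hq.firstVariation hm hφp hφ.support_subset
    have L2 := hq.firstVariation hm hψ hψs
    have T1 : (∫ x in unitBall m, (inner ℝ (weakLaplacian q x) (laplacian φ x) : ℝ))
        = ∫ x in unitBall m, (inner ℝ (laplacian q x) (laplacian φ x) : ℝ) :=
      integral_congr_ae (hlap.mono fun x hx => by simp only [hx])
    have T2 : (∫ x in unitBall m, gradNormSq q x *
          ∑ i, (inner ℝ (weakPartial i q x) (partialDeriv i φ x) : ℝ))
        = ∫ x in unitBall m, κ * (‖x‖ ^ 2)⁻¹ *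
          ∑ i, (inner ℝ (partialDeriv i q x) (partialDeriv i φ x) : ℝ) := by
      refine integral_congr_ae ?_
      filter_upwards [hgrad, hpart] with x h1 h2
      simp only [h1, h2]
    have T3 : (∫ x in unitBall m, (inner ℝ (weakLaplacian q x)
          (weakLaplacian (fun y => (inner ℝ (q y) (φ y) : ℝ) • q y) x) : ℝ))
        = ∫ x in unitBall m, (inner ℝ (laplacian q x)
          (laplacian (fun y => (inner ℝ (q y) (φ y) : ℝ) • q y) x) : ℝ) := by
      refine integral_congr_ae ?_
      filter_upwards [hlap, hψ.weakLaplacian_ae_eq (by omega)] with x h1 h2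
      rw [h1, h2]
    have T4 : (∫ x in unitBall m, gradNormSq q x ^ 2 * (inner ℝ (q x) (φ x) : ℝ))
        = ∫ x in unitBall m, κ * (‖x‖ ^ 2)⁻¹ * ∑ i, (inner ℝ (partialDeriv i q x)
          (partialDeriv i (fun y => (inner ℝ (q y) (φ y) : ℝ) • q y) x) : ℝ) := by
      refine integral_congr_ae ?_
      filter_upwards [hgrad, hne] with x h1 h2
      have dq := (hq.hasPole 0).differentiableAt h2.1
      have hterm : ∀ i, (inner ℝ (partialDeriv i q x)
          (partialDeriv i (fun y => (inner ℝ (q y) (φ y) : ℝ) • q y) x) : ℝ)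
          = (inner ℝ (q x) (φ x) : ℝ) * ‖partialDeriv i q x‖ ^ 2 := by
        intro i
        rw [partialDeriv_smul (dq.inner ℝ (hφp.differentiableAt h2.1)) dq, inner_add_right,
          real_inner_smul_right, real_inner_smul_right,
          real_inner_comm (q x), hq.inner_partialDeriv i h2.1, real_inner_self_eq_norm_sq]
        ring
      simp only [hterm, ← Finset.mul_sum, hq.grad_eq x h2.1, h1]
      ring
    rw [T1, T2, T3, T4]
    linarith

/-- The first variation of a profile vanishes on `W_0^{2,2}`. -/
theorem IsProfile.firstVariation_memW22Zero (hm : 6 < m) (hq : IsProfile q e lam κ)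
    {W : Euc m → F} (hW : MemW22Zero W) :
    (∫ x in unitBall m, (inner ℝ (weakLaplacian q x) (weakLaplacian W x) : ℝ))
      - 2 * (∫ x in unitBall m, gradNormSq q x *
          ∑ i, (inner ℝ (weakPartial i q x) (weakPartial i W x) : ℝ)) = 0 := by
  obtain ⟨φ, hφ, -, h1, h2⟩ := hW.exists_approx (by omega)
  have hlap := (hq.hasPole 2).weakLaplacian_ae_eq (by omega)
  have hgrad := hq.gradNormSq_ae_eq (by omega)
  have hpart : ∀ᵐ x ∂(ballMeasure m), ∀ i, weakPartial i q x = partialDeriv i q x :=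
    eventually_all.2 fun i => (hq.isJet (by omega)).weakPartial_ae_eq i
  have hlapL : MemLp (laplacian q) 2 (ballMeasure m) := by
    have : HasPole 0 2 (laplacian q) := HasPole.sum fun i _ => ((hq.hasPole 2).2 i).2 i
    exact this.memLp (p := 2) (by simp) (by omega)
  have hpL : ∀ i, MemLp (fun x => (κ * (‖x‖ ^ 2)⁻¹) • partialDeriv i q x) 2 (ballMeasure m) := by
    intro i
    have : HasPole 0 3 (fun x => (κ * (‖x‖ ^ 2)⁻¹) • partialDeriv i q x) :=
      ((hasPole_norm_sq_inv 0).const_smul κ).smul ((hq.hasPole 1).2 i)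
    exact this.memLp (p := 2) (by simp) (by omega)
  have T1 : (∫ x in unitBall m, (inner ℝ (weakLaplacian q x) (weakLaplacian W x) : ℝ))
      = ∫ x in unitBall m, (inner ℝ (laplacian q x) (weakLaplacian W x) : ℝ) :=
    integral_congr_ae (hlap.mono fun x hx => by simp only [hx])
  have T2 : (∫ x in unitBall m, gradNormSq q x *
        ∑ i, (inner ℝ (weakPartial i q x) (weakPartial i W x) : ℝ))
      = ∑ i, ∫ x in unitBall m,
        (inner ℝ ((κ * (‖x‖ ^ 2)⁻¹) • partialDeriv i q x) (weakPartial i W x) : ℝ) := by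
    rw [← integral_finsetSum _ fun i _ => integrable_inner (hpL i) (hW.memW22.memLp_partial i)]
    refine integral_congr_ae ?_
    filter_upwards [hgrad, hpart] with x h1 h2
    simp only [h1, h2, Finset.mul_sum, real_inner_smul_left]
  have l1 := tendsto_integral_inner_const hlapL (fun n => (hφ n).laplacian.memLp (by omega))
    hW.memW22.memLp_weakLaplacian h2
  have l2 := tendsto_finsetSum Finset.univ fun i _ => tendsto_integral_inner_const (hpL i)
    (fun n => (hφ n).deriv.memLp (by omega)) (hW.memW22.memLp_partial i) (h1 i)
  rw [T1, T2]
  refine tendsto_nhds_unique (l1.sub (l2.const_mul 2)) (tendsto_const_nhds.congr fun n => ?_)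
  rw [← hq.firstVariation (by omega) ((hφ n).hasPole 2) (hφ n).support_subset,
    ← integral_finsetSum _ fun i _ =>
      integrable_inner (hpL i) ((hφ n).deriv.memLp (by omega))]
  simp only [Finset.mul_sum, real_inner_smul_left]

end Profiles

/-! ### Eigenmaps of the sphere -/

section Eigenmaps

variable {m : ℕ}

theorem contDiffOn_norm : ContDiffOn ℝ ∞ (fun x : Euc m => ‖x‖) {0}ᶜ := fun _ hx =>
  (contDiffAt_norm ℝ hx).contDiffWithinAt

theorem contDiffOn_norm_inv : ContDiffOn ℝ ∞ (fun x : Euc m => ‖x‖⁻¹) {0}ᶜ :=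
  contDiffOn_norm.inv fun _ hx => norm_ne_zero_iff.2 hx

theorem differentiableAt_of_contDiffOn {G : Type*} [NormedAddCommGroup G] [NormedSpace ℝ G]
    {f : Euc m → G} (hf : ContDiffOn ℝ ∞ f {0}ᶜ) {x : Euc m} (hx : x ≠ 0) :
    DifferentiableAt ℝ f x :=
  (hf.contDiffAt (isOpen_compl_zero.mem_nhds hx)).differentiableAt (by simp)

theorem partialDeriv_norm (i : Fin m) {x : Euc m} (hx : x ≠ 0) :
    partialDeriv i (fun x : Euc m => ‖x‖) x = x i * ‖x‖⁻¹ := by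
  have hd := differentiableAt_of_contDiffOn contDiffOn_norm hx
  have h1 := partialDeriv_norm_sq i x
  simp only [sq] at h1
  rw [partialDeriv_mul hd hd] at h1
  have : ‖x‖ ≠ 0 := norm_ne_zero_iff.2 hx
  field_simp
  linarith

theorem partialDeriv_norm_inv (i : Fin m) {x : Euc m} (hx : x ≠ 0) :
    partialDeriv i (fun x : Euc m => ‖x‖⁻¹) x = -(x i * ‖x‖⁻¹ ^ 3) := by
  have hd := differentiableAt_of_contDiffOn contDiffOn_norm_inv hx
  have h1 := partialDeriv_norm_sq_inv i hx
  have h0 : (fun x : Euc m => (‖x‖ ^ 2)⁻¹) = fun x : Euc m => ‖x‖⁻¹ * ‖x‖⁻¹ := by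
    funext y
    rw [sq, mul_inv]
  rw [h0, partialDeriv_mul hd hd] at h1
  have : ‖x‖ ≠ 0 := norm_ne_zero_iff.2 hx
  field_simp at h1 ⊢
  linarith

theorem laplacian_mul {a f : Euc m → ℝ} (ha : ContDiffOn ℝ ∞ a {0}ᶜ)
    (hf : ContDiffOn ℝ ∞ f {0}ᶜ) {x : Euc m} (hx : x ≠ 0) :
    laplacian (fun y => a y * f y) x = a x * laplacian f x
      + 2 * ∑ i, partialDeriv i a x * partialDeriv i f x + f x * laplacian a x := by
  have hai := fun i => contDiffOn_partialDeriv isOpen_compl_zero (i := i) ha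
  have hfi := fun i => contDiffOn_partialDeriv isOpen_compl_zero (i := i) hf
  have h : ∀ i, partialDeriv i (partialDeriv i fun y => a y * f y) x
      = a x * partialDeriv i (partialDeriv i f) x + 2 * (partialDeriv i a x * partialDeriv i f x)
        + f x * partialDeriv i (partialDeriv i a) x := by
    intro i
    rw [partialDeriv_congr (g := fun y => a y * partialDeriv i f y + partialDeriv i a y * f y)]
    · rw [partialDeriv_add, partialDeriv_mul, partialDeriv_mul]
      · ring
      · exact differentiableAt_of_contDiffOn (hai i) hx
      · exact differentiableAt_of_contDiffOn hf hx
      · exact differentiableAt_of_contDiffOn ha hx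
      · exact differentiableAt_of_contDiffOn (hfi i) hx
      · exact differentiableAt_of_contDiffOn (ha.mul (hfi i)) hx
      · exact differentiableAt_of_contDiffOn ((hai i).mul hf) hx
    · filter_upwards [isOpen_compl_zero.mem_nhds hx] with y hy
      exact partialDeriv_mul (differentiableAt_of_contDiffOn ha hy)
        (differentiableAt_of_contDiffOn hf hy)
  simp only [laplacian, h, Finset.sum_add_distrib, ← Finset.mul_sum]

theorem laplacian_sub {f g : Euc m → ℝ} (hf : ContDiffOn ℝ ∞ f {0}ᶜ)
    (hg : ContDiffOn ℝ ∞ g {0}ᶜ) {x : Euc m} (hx : x ≠ 0) :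
    laplacian (fun y => f y - g y) x = laplacian f x - laplacian g x := by
  simp only [laplacian, ← Finset.sum_sub_distrib]
  refine Finset.sum_congr rfl fun i _ => ?_
  rw [partialDeriv_congr (g := fun y => partialDeriv i f y - partialDeriv i g y)]
  · exact partialDeriv_sub
      (differentiableAt_of_contDiffOn (contDiffOn_partialDeriv isOpen_compl_zero hf) hx)
      (differentiableAt_of_contDiffOn (contDiffOn_partialDeriv isOpen_compl_zero hg) hx)
  · filter_upwards [isOpen_compl_zero.mem_nhds hx] with y hy
    exact partialDeriv_sub (differentiableAt_of_contDiffOn hf hy)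
      (differentiableAt_of_contDiffOn hg hy)

theorem laplacian_sum {ι : Type*} {s : Finset ι} {f : ι → Euc m → ℝ}
    (hf : ∀ j, ContDiffOn ℝ ∞ (f j) {0}ᶜ) {x : Euc m} (hx : x ≠ 0) :
    laplacian (fun y => ∑ j ∈ s, f j y) x = ∑ j ∈ s, laplacian (f j) x := by
  simp only [laplacian]
  rw [Finset.sum_comm]
  refine Finset.sum_congr rfl fun i _ => ?_
  rw [partialDeriv_congr (g := fun y => ∑ j ∈ s, partialDeriv i (f j) y)]
  · exact partialDeriv_sum fun j _ =>
      differentiableAt_of_contDiffOn (contDiffOn_partialDeriv isOpen_compl_zero (hf j)) hx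
  · filter_upwards [isOpen_compl_zero.mem_nhds hx] with y hy
    exact partialDeriv_sum fun j _ => differentiableAt_of_contDiffOn (hf j) hy

theorem laplacian_const (c : ℝ) (x : Euc m) : laplacian (fun _ => c) x = 0 := by
  have : ∀ i : Fin m, partialDeriv i (fun _ : Euc m => c) = fun _ => 0 := fun i =>
    funext fun y => partialDeriv_const i c y
  simp [laplacian, this, partialDeriv_const]

theorem laplacian_const_mul (c : ℝ) {f : Euc m → ℝ} (hf : ContDiffOn ℝ ∞ f {0}ᶜ) {x : Euc m}
    (hx : x ≠ 0) : laplacian (fun y => c * f y) x = c * laplacian f x := by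
  rw [laplacian_mul contDiffOn_const hf hx]
  simp [partialDeriv_const, laplacian_const]

theorem laplacian_coord (i : Fin m) (x : Euc m) : laplacian (fun y : Euc m => y i) x = 0 := by
  have : ∀ j : Fin m, partialDeriv j (fun y : Euc m => y i) = fun _ => if i = j then 1 else 0 :=
    fun j => funext fun y => partialDeriv_coord j i y
  simp [laplacian, this, partialDeriv_const]

theorem partialDeriv_laplacian {f : Euc m → ℝ} (hf : ContDiffOn ℝ ∞ f {0}ᶜ) (i : Fin m)
    {x : Euc m} (hx : x ≠ 0) : laplacian (partialDeriv i f) x = partialDeriv i (laplacian f) x := by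
  have hfj := fun j => contDiffOn_partialDeriv isOpen_compl_zero (i := j) hf
  have hfjj := fun j => contDiffOn_partialDeriv isOpen_compl_zero (i := j) (hfj j)
  have h2 : ∀ {g : Euc m → ℝ}, ContDiffOn ℝ ∞ g {0}ᶜ → ∀ {y}, y ≠ 0 → ContDiffAt ℝ 2 g y :=
    fun hg _ hy => (hg.contDiffAt (isOpen_compl_zero.mem_nhds hy)).of_le ENat.LEInfty.out
  have hr : partialDeriv i (laplacian f) x
      = ∑ j, partialDeriv i (partialDeriv j (partialDeriv j f)) x :=
    partialDeriv_sum fun j _ => differentiableAt_of_contDiffOn (hfjj j) hx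
  rw [hr]
  refine Finset.sum_congr rfl fun j _ => ?_
  rw [partialDeriv_comm (h2 (hfj j) hx)]
  refine partialDeriv_congr ?_
  filter_upwards [isOpen_compl_zero.mem_nhds hx] with y hy
  exact partialDeriv_comm (h2 hf hy)

theorem laplacian_norm {x : Euc m} (hx : x ≠ 0) :
    laplacian (fun y : Euc m => ‖y‖) x = (m - 1) * ‖x‖⁻¹ := by
  have hr : ‖x‖ ≠ 0 := norm_ne_zero_iff.2 hx
  have h : ∀ i, partialDeriv i (partialDeriv i fun y : Euc m => ‖y‖) x
      = ‖x‖⁻¹ - x i ^ 2 * ‖x‖⁻¹ ^ 3 := by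
    intro i
    rw [partialDeriv_congr (g := fun y : Euc m => y i * ‖y‖⁻¹)]
    · rw [partialDeriv_mul ((contDiff_coord i).differentiable (by simp) x)
        (differentiableAt_of_contDiffOn contDiffOn_norm_inv hx), partialDeriv_norm_inv i hx,
        partialDeriv_coord]
      simp only [if_true]
      ring
    · filter_upwards [isOpen_compl_zero.mem_nhds hx] with y hy using partialDeriv_norm i hy
  simp only [laplacian, h, Finset.sum_sub_distrib, ← Finset.sum_mul, sum_coord_sq,
    Finset.sum_const, Finset.card_univ, Fintype.card_fin, nsmul_eq_mul]
  field_simp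

theorem laplacian_norm_inv {x : Euc m} (hx : x ≠ 0) :
    laplacian (fun y : Euc m => ‖y‖⁻¹) x = -(m - 3) * ‖x‖⁻¹ ^ 3 := by
  have hr : ‖x‖ ≠ 0 := norm_ne_zero_iff.2 hx
  have hd := differentiableAt_of_contDiffOn contDiffOn_norm_inv hx
  have hone := laplacian_const 1 x
  -- expand `Δ(|x| |x|⁻¹) = Δ 1 = 0`
  rw [← laplacian_congr (f := fun y : Euc m => ‖y‖ * ‖y‖⁻¹),
    laplacian_mul contDiffOn_norm contDiffOn_norm_inv hx, laplacian_norm hx] at hone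
  · have hs : ∑ i, partialDeriv i (fun y : Euc m => ‖y‖) x * partialDeriv i (fun y => ‖y‖⁻¹) x
        = -(‖x‖⁻¹ ^ 2) := by
      have : ∀ i, partialDeriv i (fun y : Euc m => ‖y‖) x * partialDeriv i (fun y => ‖y‖⁻¹) x
          = x i ^ 2 * -(‖x‖⁻¹ ^ 4) := fun i => by
        rw [partialDeriv_norm i hx, partialDeriv_norm_inv i hx]
        ring
      simp only [this, ← Finset.sum_mul, sum_coord_sq]
      field_simp
    rw [hs] at hone
    field_simp at hone ⊢
    linarith
  · filter_upwards [isOpen_compl_zero.mem_nhds hx] with y hy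
    exact mul_inv_cancel₀ (norm_ne_zero_iff.2 hy)

/-- A family of functions, homogeneous of degree `0`, that are eigenfunctions of the Laplacian of
the sphere for the eigenvalue `μ` and together define a map into the unit sphere. -/
structure IsEigenmap {ι : Type*} [Fintype ι] (u : ι → Euc m → ℝ) (μ : ℝ) : Prop where
  smooth : ∀ j, ContDiffOn ℝ ∞ (u j) {0}ᶜ
  homogeneous : ∀ j, IsHomogeneous 0 (u j)
  laplacian_eq : ∀ j x, x ≠ 0 → laplacian (u j) x = -μ * ‖x‖⁻¹ ^ 2 * u j x
  sum_sq : ∀ x, x ≠ 0 → ∑ j, u j x ^ 2 = 1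

/-- The energy density of an eigenmap is `μ |x|⁻²`: expand `0 = Δ(∑ u_j²)`. -/
theorem IsEigenmap.sum_partialDeriv_sq {ι : Type*} [Fintype ι] {u : ι → Euc m → ℝ} {μ : ℝ}
    (hu : IsEigenmap u μ) {x : Euc m} (hx : x ≠ 0) :
    ∑ j, ∑ i, partialDeriv i (u j) x ^ 2 = μ * ‖x‖⁻¹ ^ 2 := by
  have h0 : laplacian (fun y => ∑ j, u j y * u j y) x = 0 := by
    rw [laplacian_congr (g := fun _ => 1), laplacian_const]
    filter_upwards [isOpen_compl_zero.mem_nhds hx] with y hy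
    simpa [sq] using hu.sum_sq y hy
  rw [laplacian_sum (fun j => (hu.smooth j).mul (hu.smooth j)) hx] at h0
  have h1 : ∀ j, laplacian (fun y => u j y * u j y) x
      = 2 * ∑ i, partialDeriv i (u j) x ^ 2 - 2 * (μ * ‖x‖⁻¹ ^ 2) * u j x ^ 2 := by
    intro j
    rw [laplacian_mul (hu.smooth j) (hu.smooth j) hx, hu.laplacian_eq j x hx]
    simp only [← sq]
    ring
  simp only [h1, Finset.sum_sub_distrib, ← Finset.mul_sum, hu.sum_sq x hx] at h0
  linarith

/-- `Δ(|x|⁻¹ x_i v)` for an eigenfunction `v` of degree `0`. -/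
theorem laplacian_coord_mul {v : Euc m → ℝ} {μ : ℝ} (hv : ContDiffOn ℝ ∞ v {0}ᶜ)
    (hh : IsHomogeneous 0 v) (hl : ∀ x, x ≠ 0 → laplacian v x = -μ * ‖x‖⁻¹ ^ 2 * v x)
    (i : Fin m) {x : Euc m} (hx : x ≠ 0) :
    laplacian (fun y => ‖y‖⁻¹ * (y i * v y)) x
      = -(m - 1 + μ) * ‖x‖⁻¹ ^ 3 * (x i * v x) + 2 * ‖x‖⁻¹ * partialDeriv i v x := by
  have cx : ContDiffOn ℝ ∞ (fun y : Euc m => y i) {0}ᶜ := (contDiff_coord i).contDiffOn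
  have dv := differentiableAt_of_contDiffOn hv hx
  have dx := differentiableAt_of_contDiffOn cx hx
  have hg : ∀ j, partialDeriv j (fun y : Euc m => y i * v y) x
      = x i * partialDeriv j v x + if i = j then v x else 0 := fun j => by
    rw [partialDeriv_mul dx dv, partialDeriv_coord]
    simp
  have hL : laplacian (fun y => y i * v y) x
      = x i * (-μ * ‖x‖⁻¹ ^ 2 * v x) + 2 * partialDeriv i v x := by
    rw [laplacian_mul cx hv hx, hl x hx, laplacian_coord]
    simp [partialDeriv_coord]
  have he := hh.euler hx dv
  simp only [smul_eq_mul, Nat.cast_zero, neg_zero, zero_mul] at he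
  have hs : ∑ j, partialDeriv j (fun y : Euc m => ‖y‖⁻¹) x
      * partialDeriv j (fun y : Euc m => y i * v y) x = -(‖x‖⁻¹ ^ 3 * (x i * v x)) := by
    have : ∀ j, partialDeriv j (fun y : Euc m => ‖y‖⁻¹) x
        * partialDeriv j (fun y : Euc m => y i * v y) x
        = -(‖x‖⁻¹ ^ 3 * x i) * (x j * partialDeriv j v x)
          - if i = j then ‖x‖⁻¹ ^ 3 * (x j * v x) else 0 := fun j => by
      rw [hg, partialDeriv_norm_inv j hx]
      split_ifs <;> ring
    simp only [this, Finset.sum_sub_distrib, ← Finset.mul_sum, he]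
    simp
  rw [laplacian_mul contDiffOn_norm_inv (cx.mul hv) hx, hL, hs, laplacian_norm_inv hx]
  ring

/-- `Δ(|x| ∂_i v)` for an eigenfunction `v` of degree `0`. -/
theorem laplacian_norm_mul_partialDeriv {v : Euc m → ℝ} {μ : ℝ} (hv : ContDiffOn ℝ ∞ v {0}ᶜ)
    (hh : IsHomogeneous 0 v) (hl : ∀ x, x ≠ 0 → laplacian v x = -μ * ‖x‖⁻¹ ^ 2 * v x)
    (i : Fin m) {x : Euc m} (hx : x ≠ 0) :
    laplacian (fun y => ‖y‖ * partialDeriv i v y) x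
      = (m - 3 - μ) * ‖x‖⁻¹ * partialDeriv i v x + 2 * μ * ‖x‖⁻¹ ^ 3 * (x i * v x) := by
  have hr : ‖x‖ ≠ 0 := norm_ne_zero_iff.2 hx
  have cvi := contDiffOn_partialDeriv isOpen_compl_zero (i := i) hv
  have dv := differentiableAt_of_contDiffOn hv hx
  have dr := differentiableAt_of_contDiffOn contDiffOn_norm_inv hx
  have hL : laplacian (partialDeriv i v) x
      = 2 * μ * ‖x‖⁻¹ ^ 4 * (x i * v x) - μ * ‖x‖⁻¹ ^ 2 * partialDeriv i v x := by
    rw [partialDeriv_laplacian hv i hx,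
      partialDeriv_congr (g := fun y => -μ * (‖y‖⁻¹ * (‖y‖⁻¹ * v y)))]
    · have d1 := dr.fun_mul dv
      have d2 := dr.fun_mul d1
      rw [partialDeriv_mul (a := fun _ => -μ) (differentiableAt_const _) d2,
        partialDeriv_mul dr d1, partialDeriv_mul dr dv, partialDeriv_const,
        partialDeriv_norm_inv i hx]
      ring
    · filter_upwards [isOpen_compl_zero.mem_nhds hx] with y hy
      rw [hl y hy]
      ring
  have he := (hh.partialDeriv (fun y hy => differentiableAt_of_contDiffOn hv hy) i).euler hx
    (differentiableAt_of_contDiffOn cvi hx)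
  simp only [smul_eq_mul, zero_add, Nat.cast_one, neg_mul, one_mul] at he
  have hs : ∑ j, partialDeriv j (fun y : Euc m => ‖y‖) x * partialDeriv j (partialDeriv i v) x
      = -(‖x‖⁻¹ * partialDeriv i v x) := by
    have : ∀ j, partialDeriv j (fun y : Euc m => ‖y‖) x * partialDeriv j (partialDeriv i v) x
        = ‖x‖⁻¹ * (x j * partialDeriv j (partialDeriv i v) x) := fun j => by
      rw [partialDeriv_norm j hx]
      ring
    simp only [this, ← Finset.mul_sum, he]
    ring
  rw [laplacian_mul contDiffOn_norm cvi hx, hL, hs, laplacian_norm hx]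
  field_simp
  ring

end Eigenmaps

/-! ### The generalized radial projection -/

section RadialProjection

variable {m : ℕ}

theorem isHomogeneous_norm_inv_mul_coord_mul {v : Euc m → ℝ} (hh : IsHomogeneous 0 v) (i : Fin m) :
    IsHomogeneous 0 (fun y => ‖y‖⁻¹ * (y i * v y)) := by
  intro t ht x hx
  have h := hh t ht x hx
  simp only [pow_zero, one_smul] at h ⊢
  rw [h, norm_smul, Real.norm_of_nonneg ht.le, PiLp.smul_apply, smul_eq_mul]
  field_simp

theorem isHomogeneous_norm_mul_partialDeriv {v : Euc m → ℝ} (hh : IsHomogeneous 0 v)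
    (hv : ContDiffOn ℝ ∞ v {0}ᶜ) (i : Fin m) :
    IsHomogeneous 0 (fun y => ‖y‖ * partialDeriv i v y) := by
  intro t ht x hx
  have h := hh.partialDeriv (fun y hy => differentiableAt_of_contDiffOn hv hy) i t ht x hx
  simp only [zero_add, pow_one, pow_zero, smul_eq_mul] at h ⊢
  rw [← h, norm_smul, Real.norm_of_nonneg ht.le]
  ring

theorem IsHomogeneous.linear {u v : Euc m → ℝ} {k : ℕ} (hu : IsHomogeneous k u)
    (hv : IsHomogeneous k v) (a b : ℝ) : IsHomogeneous k (fun y => a * (u y - b * v y)) := by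
  intro t ht x hx
  have h1 := hu t ht x hx
  have h2 := hv t ht x hx
  simp only [smul_eq_mul] at h1 h2 ⊢
  rw [← h1, ← h2]
  ring

/-- Nakauchi's recursion raises the degree of an eigenmap by one. -/
theorem IsEigenmap.step {ι : Type*} [Fintype ι] {u : ι → Euc m → ℝ} {κ : ℝ} (hκ : 0 ≤ κ)
    (hm : 2 < m) (hu : IsEigenmap u (κ * (κ + m - 2))) :
    IsEigenmap (fun (p : Fin m × ι) (x : Euc m) =>
      Real.sqrt ((κ + m - 2) / (2 * κ + m - 2)) *
        (‖x‖⁻¹ * (x p.1 * u p.2 x) - 1 / (κ + m - 2) * (‖x‖ * partialDeriv p.1 (u p.2) x)))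
      ((κ + 1) * (κ + m - 1)) := by
  have hm' : (2 : ℝ) < m := by exact_mod_cast hm
  have hd : 0 < κ + m - 2 := by linarith
  have hd' : 0 < 2 * κ + m - 2 := by linarith
  have cA : ∀ p : Fin m × ι, ContDiffOn ℝ ∞ (fun y : Euc m => ‖y‖⁻¹ * (y p.1 * u p.2 y)) {0}ᶜ :=
    fun p => contDiffOn_norm_inv.mul ((contDiff_coord p.1).contDiffOn.mul (hu.smooth p.2))
  have cB : ∀ p : Fin m × ι, ContDiffOn ℝ ∞ (fun y : Euc m => ‖y‖ * partialDeriv p.1 (u p.2) y)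
      {0}ᶜ :=
    fun p => contDiffOn_norm.mul (contDiffOn_partialDeriv isOpen_compl_zero (hu.smooth p.2))
  refine ⟨fun p => ?_, fun p => ?_, fun p x hx => ?_, fun x hx => ?_⟩
  · exact contDiffOn_const.mul ((cA p).sub (contDiffOn_const.mul (cB p)))
  · exact (isHomogeneous_norm_inv_mul_coord_mul (hu.homogeneous p.2) p.1).linear
      (isHomogeneous_norm_mul_partialDeriv (hu.homogeneous p.2) (hu.smooth p.2) p.1) _ _
  · have hr : ‖x‖ ≠ 0 := norm_ne_zero_iff.2 hx
    rw [laplacian_const_mul _ ((cA p).sub (contDiffOn_const.mul (cB p))) hx,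
      laplacian_sub (cA p) (contDiffOn_const.mul (cB p)) hx, laplacian_const_mul _ (cB p) hx,
      laplacian_coord_mul (hu.smooth p.2) (hu.homogeneous p.2) (hu.laplacian_eq p.2) p.1 hx,
      laplacian_norm_mul_partialDeriv (hu.smooth p.2) (hu.homogeneous p.2)
        (hu.laplacian_eq p.2) p.1 hx]
    field_simp
    ring
  · have hr : ‖x‖ ≠ 0 := norm_ne_zero_iff.2 hx
    have hsq : Real.sqrt ((κ + m - 2) / (2 * κ + m - 2)) ^ 2 = (κ + m - 2) / (2 * κ + m - 2) :=
      Real.sq_sqrt (by positivity)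
    have he : ∀ j, ∑ i, x i * partialDeriv i (u j) x = 0 := fun j => by
      simpa using (hu.homogeneous j).euler hx (differentiableAt_of_contDiffOn (hu.smooth j) hx)
    have hterm : ∀ p : Fin m × ι, (Real.sqrt ((κ + m - 2) / (2 * κ + m - 2)) *
        (‖x‖⁻¹ * (x p.1 * u p.2 x)
          - 1 / (κ + m - 2) * (‖x‖ * partialDeriv p.1 (u p.2) x))) ^ 2
        = (κ + m - 2) / (2 * κ + m - 2) * (x p.1 ^ 2 * (‖x‖⁻¹ ^ 2 * u p.2 x ^ 2)
          - 2 / (κ + m - 2) * u p.2 x * (x p.1 * partialDeriv p.1 (u p.2) x)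
          + ‖x‖ ^ 2 / (κ + m - 2) ^ 2 * partialDeriv p.1 (u p.2) x ^ 2) := fun p => by
      rw [mul_pow, hsq]
      field_simp
      ring
    have hx2 := sum_coord_sq x
    rw [Finset.sum_congr rfl fun p _ => hterm p, Fintype.sum_prod_type_right]
    simp only [← Finset.mul_sum, Finset.sum_add_distrib, Finset.sum_sub_distrib, ← Finset.sum_mul,
      he, hx2, hu.sum_sq x hx, hu.sum_partialDeriv_sq hx]
    simp only [mul_zero]
    have hne : 2 * κ + m - 2 ≠ 0 := hd'.ne'
    have hne' : κ + m - 2 ≠ 0 := hd.ne'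
    rw [div_mul_eq_mul_div, div_eq_one_iff_eq hne]
    field_simp
    ring

theorem IsEigenmap.reindex {ι ι' : Type*} [Fintype ι] [Fintype ι'] {u : ι → Euc m → ℝ} {μ : ℝ}
    (hu : IsEigenmap u μ) (σ : ι' ≃ ι) : IsEigenmap (fun j => u (σ j)) μ where
  smooth _ := hu.smooth _
  homogeneous _ := hu.homogeneous _
  laplacian_eq _ := hu.laplacian_eq _
  sum_sq x hx := (Equiv.sum_comp σ fun j => u j x ^ 2).trans (hu.sum_sq x hx)

/-- The recursion for the generalized radial projection, started at the constant map `ℓ = 0`. -/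
theorem nakauchi_succ (hm : 2 < m) (k : ℕ) (I : Fin (k + 1) → Fin m) (x : Euc m) :
    nakauchi m (k + 1) I x = Real.sqrt (((k : ℝ) + m - 2) / (2 * k + m - 2)) *
        (‖x‖⁻¹ * (x (I (Fin.last k)) * nakauchi m k (Fin.init I) x)
          - 1 / ((k : ℝ) + m - 2) *
            (‖x‖ * partialDeriv (I (Fin.last k)) (nakauchi m k (Fin.init I)) x)) := by
  have hm' : (2 : ℝ) < m := by exact_mod_cast hm
  cases k with
  | zero =>
    have h0 : nakauchi m 0 (Fin.init I) = fun _ => 1 := by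
      funext y
      simp [nakauchi]
    have h1 : (m : ℝ) - 2 ≠ 0 := by linarith
    rw [h0, partialDeriv_const]
    simp [nakauchi, h1, div_eq_inv_mul]
  | succ k =>
    have e1 : ((k : ℝ) + 1 + m - 2) = (k : ℝ) + 2 + m - 3 := by ring
    have e2 : (2 * ((k : ℝ) + 1) + m - 2) = 2 * ((k : ℝ) + 2) + m - 4 := by ring
    push_cast
    rw [e1, e2, nakauchi]
    ring

theorem isEigenmap_nakauchi (hm : 2 < m) (k : ℕ) :
    IsEigenmap (nakauchi m k) ((k : ℝ) * (k + m - 2)) := by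
  induction k with
  | zero =>
    have h0 : nakauchi m 0 = fun _ _ => 1 := by
      funext I y
      simp [nakauchi]
    rw [h0]
    refine ⟨fun _ => contDiffOn_const, fun _ t ht x hx => by simp, fun _ x hx => ?_, ?_⟩
    · rw [laplacian_const]
      simp
    · intro x hx
      simp
  | succ k ih =>
    have h := (ih.step (Nat.cast_nonneg k) hm).reindex (Fin.snocEquiv fun _ => Fin m).symm
    have hfun : nakauchi m (k + 1) = _ := funext fun I => funext fun x => nakauchi_succ hm k I x
    rw [hfun]
    have hμ : (((k + 1 : ℕ) : ℝ) * ((k + 1 : ℕ) + m - 2)) = ((k : ℝ) + 1) * (k + m - 1) := by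
      push_cast
      ring
    rw [hμ]
    exact h

end RadialProjection

/-! ### The map `q` -/

section TargetMap

variable {m ℓ : ℕ} {α : ℝ}

theorem partialDeriv_clm_comp {G H : Type*} [NormedAddCommGroup G] [NormedSpace ℝ G]
    [NormedAddCommGroup H] [NormedSpace ℝ H] (L : G →L[ℝ] H) {i : Fin m} {f : Euc m → G} {x : Euc m}
    (hf : DifferentiableAt ℝ f x) :
    partialDeriv i (fun y => L (f y)) x = L (partialDeriv i f x) := by
  have h := (L.hasFDerivAt.comp x hf.hasFDerivAt).fderiv
  exact congrArg (fun T => T (EuclideanSpace.single i 1)) h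

theorem laplacian_clm_comp {G H : Type*} [NormedAddCommGroup G] [NormedSpace ℝ G]
    [NormedAddCommGroup H] [NormedSpace ℝ H] (L : G →L[ℝ] H) {f : Euc m → G}
    (hf : ContDiffOn ℝ ∞ f {0}ᶜ) {x : Euc m} (hx : x ≠ 0) :
    laplacian (fun y => L (f y)) x = L (laplacian f x) := by
  simp only [laplacian, map_sum]
  refine Finset.sum_congr rfl fun i _ => ?_
  rw [partialDeriv_congr (g := fun y => L (partialDeriv i f y))]
  · exact partialDeriv_clm_comp L
      (differentiableAt_of_contDiffOn (contDiffOn_partialDeriv isOpen_compl_zero hf) hx)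
  · filter_upwards [isOpen_compl_zero.mem_nhds hx] with y hy
    exact partialDeriv_clm_comp L (differentiableAt_of_contDiffOn hf hy)

/-- The constant part `(0, cos α)` of the map `q`. -/
noncomputable def poleVector (m ℓ : ℕ) (α : ℝ) : Target m ℓ :=
  WithLp.toLp 2 (Sum.elim (fun _ => 0) (fun _ => Real.cos α))

/-- The hypothesis is the condition on `α`, cleared of denominators. -/
theorem isProfile_qMap (hm : 2 < m)
    (hα : 2 * (Real.sin α ^ 2 * ((ℓ : ℝ) * (ℓ + m - 2))) = (ℓ : ℝ) * (ℓ + m - 2) + 2 * m - 8) :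
    IsProfile (qMap m ℓ α) (poleVector m ℓ α) ((ℓ : ℝ) * (ℓ + m - 2))
      (Real.sin α ^ 2 * ((ℓ : ℝ) * (ℓ + m - 2))) := by
  have hu := isEigenmap_nakauchi hm ℓ
  have hsmooth : ContDiffOn ℝ ∞ (qMap m ℓ α) {0}ᶜ := by
    rw [contDiffOn_euclidean]
    rintro (I | _)
    · exact contDiffOn_const.mul (hu.smooth I)
    · exact contDiffOn_const
  have hpd : ∀ x, x ≠ 0 → ∀ i j, partialDeriv i (qMap m ℓ α) x j
      = partialDeriv i (fun y => qMap m ℓ α y j) x := fun x hx i j =>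
    (partialDeriv_clm_comp (EuclideanSpace.proj (𝕜 := ℝ) j)
      (differentiableAt_of_contDiffOn hsmooth hx)).symm
  have hlap : ∀ x, x ≠ 0 → ∀ j, laplacian (qMap m ℓ α) x j
      = laplacian (fun y => qMap m ℓ α y j) x := fun x hx j =>
    (laplacian_clm_comp (EuclideanSpace.proj (𝕜 := ℝ) j) hsmooth hx).symm
  refine ⟨hsmooth, fun t ht x hx => ?_, fun x hx => ?_, fun x hx => ?_, fun x hx => ?_, hα⟩
  · ext (I | _)
    · have := hu.homogeneous I t ht x hx
      simp only [pow_zero, one_smul] at this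
      simp [qMap, this]
    · simp [qMap]
  · have h1 : ‖qMap m ℓ α x‖ ^ 2 = 1 := by
      rw [EuclideanSpace.real_norm_sq_eq, Fintype.sum_sum_type]
      simp only [qMap, Sum.elim_inl, Sum.elim_inr, mul_pow, ← Finset.mul_sum, hu.sum_sq x hx]
      simp
    exact (pow_eq_one_iff_of_nonneg (norm_nonneg _) two_ne_zero).1 h1
  · ext (I | _)
    · rw [hlap x hx]
      have : (fun y => qMap m ℓ α y (Sum.inl I)) = fun y => Real.sin α * nakauchi m ℓ I y := rfl
      rw [this, laplacian_const_mul _ (hu.smooth I) hx, hu.laplacian_eq I x hx]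
      simp only [qMap, poleVector, PiLp.smul_apply, PiLp.sub_apply, Sum.elim_inl, smul_eq_mul]
      ring
    · rw [hlap x hx]
      have : (fun y => qMap m ℓ α y (Sum.inr ())) = fun y => Real.cos α := rfl
      rw [this, laplacian_const]
      simp [qMap, poleVector]
  · have h1 : ∀ i, ‖partialDeriv i (qMap m ℓ α) x‖ ^ 2
        = Real.sin α ^ 2 * ∑ I, partialDeriv i (nakauchi m ℓ I) x ^ 2 := by
      intro i
      rw [EuclideanSpace.real_norm_sq_eq, Fintype.sum_sum_type]
      have e1 : ∀ I, partialDeriv i (qMap m ℓ α) x (Sum.inl I)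
          = Real.sin α * partialDeriv i (nakauchi m ℓ I) x := fun I => by
        rw [hpd x hx]
        exact partialDeriv_const_smul _ (differentiableAt_of_contDiffOn (hu.smooth I) hx)
      have e2 : ∀ j, partialDeriv i (qMap m ℓ α) x (Sum.inr j) = 0 := fun j => by
        rw [hpd x hx]
        exact partialDeriv_const i _ x
      simp [e1, e2, mul_pow, Finset.mul_sum]
    simp only [h1, ← Finset.mul_sum]
    rw [Finset.sum_comm, hu.sum_partialDeriv_sq hx]
    ring

end TargetMap

/-! ### Strict stability -/

section Stability

variable {m : ℕ} {F : Type*} [NormedAddCommGroup F] [InnerProductSpace ℝ F]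
  {q : Euc m → F} {e : F} {lam κ : ℝ}

theorem gradNormSq_nonneg (f : Euc m → F) (x : Euc m) : 0 ≤ gradNormSq f x :=
  Finset.sum_nonneg fun _ _ => by positivity

variable [CompleteSpace F]

/-- If `q - e` is orthogonal to `e`, the tension field of a profile has the component
`κ |x|⁻² |e|²` along `e`. -/
theorem IsProfile.not_isHarmonic (hm : 5 < m) (hq : IsProfile q e lam κ) (hκ : κ ≠ 0) (he : e ≠ 0)
    (hqe : ∀ x, (inner ℝ (q x) e : ℝ) = ‖e‖ ^ 2) : ¬ IsHarmonic q := by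
  intro h
  have hne : (ae (ballMeasure m)).NeBot := by
    rw [ae_neBot, Ne, Measure.restrict_eq_zero]
    exact (Metric.measure_ball_pos volume 0 one_pos).ne'
  obtain ⟨x, hx, h1, h2, h3⟩ := (h.tension_eq_zero.and (((hq.hasPole 2).weakLaplacian_ae_eq
    (by omega)).and ((hq.gradNormSq_ae_eq hm).and (ae_ball_ne_zero (by omega : 0 < m))))).exists
  rw [h1, h2, hq.laplacian_eq x h3.1] at hx
  have hi := congrArg (fun v => (inner ℝ v e : ℝ)) hx
  simp only [inner_add_left, real_inner_smul_left, inner_sub_left, hqe,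
    real_inner_self_eq_norm_sq, sub_self, mul_zero, zero_add, inner_zero_left] at hi
  have h4 : ‖x‖ ≠ 0 := norm_ne_zero_iff.2 h3.1
  have h5 : ‖e‖ ≠ 0 := norm_ne_zero_iff.2 he
  exact absurd hi (by positivity)

/-- The velocity of a curve with fixed boundary values vanishes on the boundary, because `W_0^{2,2}`
is closed. -/
theorem HasEnergySpaceDerivAt.memW22Zero (hm : 4 < m) {U : ℝ → Euc m → F} {V : Euc m → F} {t : ℝ}
    (h : HasEnergySpaceDerivAt U V t)
    (h0 : ∀ᶠ s in 𝓝 t, MemW22Zero (fun x => U s x - U t x)) : MemW22Zero V := by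
  refine memW22Zero_of_tendsto hm (l := 𝓝[≠] t)
    (u := fun s x => (s - t)⁻¹ • (U s x - U t x)) h.mem_deriv.memW22 ?_ ?_
  · filter_upwards [h0.filter_mono nhdsWithin_le_nhds] with s hs using hs.const_smul hm _
  · exact tendsto_of_tendsto_of_tendsto_of_le_of_le tendsto_const_nhds h.tendsto
      (fun _ => bot_le) fun _ => normW22_le_normEnergySpace _

/-- The velocities of a variation near `t = 0` and its acceleration at `t = 0` vanish on the
boundary. -/
theorem IsVariation.memW22Zero (hm : 4 < m) {u : Euc m → F} {U V : ℝ → Euc m → F} {W : Euc m → F}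
    (h : IsVariation u U V) (hW : HasEnergySpaceDerivAt V W 0) :
    MemW22Zero (V 0) ∧ MemW22Zero W := by
  have hV : ∀ᶠ t in 𝓝 (0 : ℝ), MemW22Zero (V t) := by
    filter_upwards [h.deriv, h.boundary.eventually_nhds, h.boundary] with t ht hb hbt
    refine ht.memW22Zero hm ?_
    filter_upwards [hb] with s hs
    have := hs.sub hm hbt
    simpa using this
  refine ⟨hV.self_of_nhds, hW.memW22Zero hm ?_⟩
  filter_upwards [hV] with s hs using hs.sub hm hV.self_of_nhds

/-- The second variation of a profile is positive definite when the Hardy–Rellich constant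
dominates the energy density. -/
theorem IsProfile.secondVariation_pos (hm : 8 ≤ m) (hq : IsProfile q e lam κ)
    (hstab : 6 * κ < (m : ℝ) ^ 2 / 4) (hqE : MemEnergySpace q) {V : Euc m → F}
    (hV : MemEnergySpace V) (hV0 : MemW22Zero V) (hne : ¬ V =ᵐ[ballMeasure m] 0) :
    0 < (∫ x in unitBall m, ‖weakLaplacian V x‖ ^ 2)
        - 4 * (∫ x in unitBall m,
            (∑ i, (inner ℝ (weakPartial i q x) (weakPartial i V x) : ℝ)) ^ 2)
        - 2 * (∫ x in unitBall m, gradNormSq q x * gradNormSq V x) := by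
  have hball := ae_ball_ne_zero (by omega : 0 < m)
  have hgrad := hq.gradNormSq_ae_eq (by omega)
  have hHi := hV.integrable_norm_sq_inv_mul_gradNormSq (by omega)
  set H := ∫ x in unitBall m, (‖x‖ ^ 2)⁻¹ * gradNormSq V x with hH
  have hHR := hV0.hardyRellich hm hV
  have h2 : (∫ x in unitBall m, gradNormSq q x * gradNormSq V x) = κ * H := by
    rw [hH, ← integral_const_mul]
    refine integral_congr_ae ?_
    filter_upwards [hgrad] with x hx
    rw [hx]
    ring
  have h4 : (∫ x in unitBall m,
      (∑ i, (inner ℝ (weakPartial i q x) (weakPartial i V x) : ℝ)) ^ 2) ≤ κ * H := by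
    rw [← h2]
    have i1 := integrable_gradPairing_mul hqE hV hqE hV
    have i2 : Integrable (fun x => gradNormSq q x * gradNormSq V x) (ballMeasure m) :=
      hqE.memLp_gradNormSq.integrable_mul hV.memLp_gradNormSq
    simp only [← sq] at i1
    refine integral_mono i1 i2 fun x => ?_
    have hcs : |∑ i, (inner ℝ (weakPartial i q x) (weakPartial i V x) : ℝ)|
        ≤ ∑ i, ‖weakPartial i q x‖ * ‖weakPartial i V x‖ :=
      (Finset.abs_sum_le_sum_abs _ _).trans
        (Finset.sum_le_sum fun i _ => abs_real_inner_le_norm _ _)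
    calc (∑ i, (inner ℝ (weakPartial i q x) (weakPartial i V x) : ℝ)) ^ 2
        ≤ (∑ i, ‖weakPartial i q x‖ * ‖weakPartial i V x‖) ^ 2 := by
          rw [← sq_abs]
          gcongr
      _ ≤ gradNormSq q x * gradNormSq V x := Finset.sum_mul_sq_le_sq_mul_sq _ _ _
  have hP := hV0.poincare (by omega)
  have : IsFiniteMeasure (ballMeasure m) := ⟨by
    rw [Measure.restrict_apply_univ]; exact measure_ball_lt_top⟩
  have hGH : ∫ x in unitBall m, gradNormSq V x ≤ H := by
    refine integral_mono_ae (hV.memLp_gradNormSq.integrable one_le_two) hHi ?_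
    filter_upwards [hball] with x hx
    refine le_mul_of_one_le_left (gradNormSq_nonneg V x) ?_
    have hx0 : 0 < ‖x‖ := norm_pos_iff.2 hx.1
    exact (one_le_inv₀ (by positivity)).2 (pow_le_one₀ hx0.le hx.2.le)
  have hVpos : 0 < ∫ x in unitBall m, ‖V x‖ ^ 2 := by
    refine lt_of_le_of_ne (integral_nonneg fun x => by positivity) fun h0 => hne ?_
    have := (integral_eq_zero_iff_of_nonneg (fun x => by positivity)
      (integrable_norm_sq hV0.memW22.memLp)).1 h0.symm
    filter_upwards [this] with x hx
    simpa using hx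
  have hm1 : (1 : ℝ) < m := by exact_mod_cast (by omega : 1 < m)
  have hHpos : 0 < H := by
    have : 0 < (m - 1 : ℝ) * ∫ x in unitBall m, ‖V x‖ ^ 2 := mul_pos (by linarith) hVpos
    linarith
  rw [h2]
  nlinarith [mul_pos (sub_pos.2 hstab) hHpos]

theorem IsProfile.isStrictlyStable (hm : 8 ≤ m) (hq : IsProfile q e lam κ)
    (hstab : 6 * κ < (m : ℝ) ^ 2 / 4) : IsStrictlyStable q := by
  intro U V hvar hne
  obtain ⟨W, hW⟩ := hvar.deriv₂
  obtain ⟨hV0, hW0⟩ := hvar.memW22Zero (by omega) hW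
  have hU0 := hvar.deriv.self_of_nhds
  have hqE := hU0.eventually_mem.self_of_nhds
  obtain ⟨hd, hdd⟩ := bienergy_secondVariation hvar.deriv hW
  rw [hvar.zero, hq.firstVariation_memW22Zero (by omega) hW0, add_zero] at hdd
  rw [hvar.zero] at hqE
  refine ⟨hd, hdd.differentiableAt, ?_⟩
  rw [hdd.deriv]
  exact hq.secondVariation_pos hm hstab hqE hU0.mem_deriv hV0 hne

end Stability

end Biharmonic

theorem theorem1p1 (m ℓ : ℕ) (hm : 5 ≤ m) (hℓ : 1 ≤ ℓ) (hℓm : ℓ ≤ m)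
    (hineq : (m : ℝ) > 2 * (Real.sqrt (12 * (ℓ : ℝ) ^ 2 + 30 * ℓ + 12) + 3 * ℓ + 6))
    (α : ℝ) (hα₀ : 0 < α) (hα₁ : α < Real.pi / 2)
    (hα : Real.sin α ^ 2 =
      ((ℓ : ℝ) * (ℓ + m - 2) + 2 * m - 8) / (2 * ℓ * (ℓ + m - 2))) :
    Biharmonic.IsProperWeakBiharmonic (Biharmonic.qMap m ℓ α) ∧
      Biharmonic.IsStrictlyStable (Biharmonic.qMap m ℓ α) := by
  have hℓ' : (1 : ℝ) ≤ ℓ := by exact_mod_cast hℓ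
  have hm' : (5 : ℝ) ≤ m := by exact_mod_cast hm
  have hs0 := Real.sqrt_nonneg (12 * (ℓ : ℝ) ^ 2 + 30 * ℓ + 12)
  have hs2 := Real.sq_sqrt (by positivity : 0 ≤ 12 * (ℓ : ℝ) ^ 2 + 30 * ℓ + 12)
  set S := Real.sqrt (12 * (ℓ : ℝ) ^ 2 + 30 * ℓ + 12)
  have hm18 : 18 < m := by
    have : (18 : ℝ) < m := by linarith
    exact_mod_cast this
  have hlam : 0 < (ℓ : ℝ) * (ℓ + m - 2) := mul_pos (by linarith) (by linarith)
  have hbal : 2 * (Real.sin α ^ 2 * ((ℓ : ℝ) * (ℓ + m - 2)))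
      = (ℓ : ℝ) * (ℓ + m - 2) + 2 * m - 8 := by
    have h1 : (ℓ : ℝ) + m - 2 ≠ 0 := by linarith
    have h2 : (ℓ : ℝ) ≠ 0 := by linarith
    rw [hα]
    field_simp
  have hq := Biharmonic.isProfile_qMap (m := m) (ℓ := ℓ) (α := α) (by omega) hbal
  have hsin : 0 < Real.sin α := Real.sin_pos_of_pos_of_lt_pi hα₀ (by linarith [Real.pi_pos])
  have hcos : 0 < Real.cos α := Real.cos_pos_of_mem_Ioo ⟨by linarith [Real.pi_pos], hα₁⟩
  have hκ : 0 < Real.sin α ^ 2 * ((ℓ : ℝ) * (ℓ + m - 2)) := by positivity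
  refine ⟨⟨hq.isWeakBiharmonic (by omega), hq.not_isHarmonic (by omega) hκ.ne' ?_ ?_⟩,
    hq.isStrictlyStable (by omega) ?_⟩
  · intro h0
    have := congrArg (fun v : Biharmonic.Target m ℓ => v (Sum.inr ())) h0
    simp only [Biharmonic.poleVector, Sum.elim_inr, PiLp.zero_apply] at this
    exact hcos.ne' this
  · intro x
    rw [EuclideanSpace.real_norm_sq_eq, PiLp.inner_apply, Fintype.sum_sum_type,
      Fintype.sum_sum_type]
    simp [Biharmonic.qMap, Biharmonic.poleVector, sq]
  · -- squaring `m / 2 - 3ℓ - 6 > S` gives `m² / 4 > 3 (ℓ (ℓ + m - 2) + 2m - 8)`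
    have h1 : S < m / 2 - 3 * ℓ - 6 := by linarith
    have h2 : S ^ 2 < ((m : ℝ) / 2 - 3 * ℓ - 6) ^ 2 := by gcongr
    nlinarith
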